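/- Let $k$ be an algebraically closed field of characteristic $0$, $R=k[[x_1,\dots,x_n]]$, and let $w\in k[x_1,\dots,x_n]$, $w(0)=0$, have an isolated singularity at the origin, i.e. $\dim_k R/(w,\partial_1w,\dots,\partial_nw)<\infty$. Let $\overline{\mathbf M}$ be a matrix factorization of $w$ of rank $d\ge1$ over $k$: an odd operator $\overline Q=\begin{pmatrix}0&\psi\\ \varphi&0\end{pmatrix}$ on $R^d\oplus R^d$ with $\overline Q^2=w\cdot 1$ and $\overline Q(0)=0$. Put $D(f)=\overline Qf-(-1)^{|f|}f\overline Q$ and ${\rm Ext}^i(\overline{\mathbf M},\overline{\mathbf M})=H^i({\rm End}(R^d\oplus R^d),D)$, $i\in\mathbb Z/2$. Let $\overline{\mathbf M}$ carry either an orthogonal ($\epsilon=1$) or symplectic ($\epsilon=-1$) structure $b$, that is, an odd invertible matrix over $R$ with ${}^tb=-\epsilon b$ and $b^{-1}\,{}^t\overline Q\,b=-\overline Q$, or a twisted one $q$, that is, an even invertible matrix with ${}^tq=\epsilon q$ and $q^{-1}\,{}^t\overline Q\,q=\overline Q$. Put $s=-1$ for $b$ and $s=+1$ for $q$. The adjunction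 $f\mapsto f^{\rm adj}=b^{-1}\,{}^tf\,b$ (resp. $q^{-1}\,{}^tf\,q$) acts on ${\rm Ext}^i(\overline{\mathbf M},\overline{\mathbf M})$; the superscripts $+$ and $-$ denote the selfadjoint and anti-selfadjoint elements. For a complete local Noetherian $k$-algebra $A$ with residue field $k$, a deformation to $A$ is an odd operator $Q$ over $A[[x_1,\dots,x_n]]$ with $Q^2=\omega\cdot1$ for some $\omega\in A[[x]]$, reducing to $\overline Q$ modulo $\mathfrak m_A$, with $Q^{\rm adj}=sQ$ for the constant structure $b\otimes1$ (resp. $q\otimes 1$). Two deformations are equivalent if they correspond under a gauge transformation preserving this structure, i.e. an $A$-automorphism of $A[[x]]$ followed by an even invertible matrix over $A[[x]]$, both reducing to the identity modulo $\mathfrak m_A$. Let ${\rm Def}_{\overline{\mathbf M},b}(A)$ (resp. ${\rm Def}_{\overline{\mathbf M},q}(A)$) be the set of classes, ${\rm Def}_{\overline{\mathbf M}}(A)$ the analogous set without bilinear structure, and $t_{\overline{\mathbf M},b}$, $t_{\overline{\mathbf M},q}$, $t_{\overline{\mathbf M}}$ their values at $k[\varepsilon]$, $\varepsilon^2=0$,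 with their natural vector space structure. Let $\mathcal I\subset R$ be the ideal of the $Q$-exact functions, i.e. of those $h$ for which $h\cdot1$ is a coboundary, and $\overline{\mathcal I}$ the ideal of their classes in $R/(\partial_1w,\dots,\partial_nw)$ (which is the Tjurina ring $R/(w,\partial w)$ when $w\in(\partial w)$). (1) The functor ${\rm Def}_{\overline{\mathbf M},b}$ (resp. ${\rm Def}_{\overline{\mathbf M},q}$) has a versal hull: there is a deformation over a complete local Noetherian $k$-algebra with residue field $k$ that is bijective on tangent spaces and has the lifting property for all surjections of Artinian local $k$-algebras with residue field $k$. (2) The natural map $t_{\overline{\mathbf M},b}\to t_{\overline{\mathbf M}}$ (resp. $t_{\overline{\mathbf M},q}\to t_{\overline{\mathbf M}}$) is injective, and its image is the anti-selfadjoint (resp. selfadjoint) part of $t_{\overline{\mathbf M}}$. (3) There is an exact sequence $0\to{\rm Ext}^1(\overline{\mathbf M},\overline{\mathbf M})^{-}\to t_{\overline{\mathbf M},b}\to\overline{\mathcal I}\to0$ (resp. $0\to{\rm Ext}^1(\overline{\mathbf M},\overline{\mathbf M})^{+}\to t_{\overline{\mathbf M},q}\to\overline{\mathcal I}\to0$),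 in which the class of $f$ (with $f^{\rm adj}=sf$) goes to the class of $\overline Q+\varepsilon f$, and the class of a deformation of potential $w+\varepsilon h$ goes to the class of $h$. (4) In both cases the obstructions lie in the cokernel $C$ of $R/\mathcal I\to{\rm Ext}^0(\overline{\mathbf M},\overline{\mathbf M})^{+}$, $h\mapsto[h\cdot 1]$: for every surjection $A'\to A$ of Artinian local $k$-algebras with residue field $k$ whose kernel $J$ satisfies $\mathfrak m_{A'}J=0$, each class in ${\rm Def}_{\overline{\mathbf M},b}(A)$ (resp. ${\rm Def}_{\overline{\mathbf M},q}(A)$) has an obstruction in $C\otimes_kJ$, which vanishes if and only if the class lifts to $A'$. It is the class of $Q'^2-\omega'\cdot1$ for any odd lift $Q'$ to $A'$ of the operator with $Q'^{\rm adj}=sQ'$ and any lift $\omega'$ of the potential. -/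

import Mathlib

open scoped TensorProduct
open IsLocalRing

universe u

namespace MF

noncomputable section

/-! ### Graded matrices -/

/-- Power series in `n` variables: `A[[x₁, …, xₙ]]`. For a complete local Noetherian `k`-algebra
`A` this is the completed tensor product of `k[[x]]` with `A`. -/
abbrev PS (n : ℕ) (A : Type*) := MvPowerSeries (Fin n) A

/-- Endomorphisms of the `ℤ/2`-graded free module `M₀ ⊕ M₁`, `M₀ = M₁ = C ^ d`. -/
abbrev Mat (d : ℕ) (C : Type*) := Matrix (Fin d ⊕ Fin d) (Fin d ⊕ Fin d) C

/-- The degree of a basis vector of `M₀ ⊕ M₁`. -/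
def par {d : ℕ} : Fin d ⊕ Fin d → ZMod 2 := Sum.elim (fun _ => 0) (fun _ => 1)

/-- The homogeneous matrices of degree `i`: block diagonal for `i = 0`, block antidiagonal for
`i = 1`. -/
def homDeg (d : ℕ) (C : Type*) [CommRing C] (i : ZMod 2) : Submodule C (Mat d C) where
  carrier := {f | ∀ a b, par a + par b ≠ i → f a b = 0}
  add_mem' := by
    intro f g hf hg a b h
    simp [hf a b h, hg a b h]
  zero_mem' := by intro a b _; rfl
  smul_mem' := by
    intro c f hf a b h
    simp [hf a b h]

section graded
variable {d : ℕ} {C : Type*} [CommRing C]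

theorem mul_mem_homDeg {i j : ZMod 2} {f g : Mat d C} (hf : f ∈ homDeg d C i)
    (hg : g ∈ homDeg d C j) : f * g ∈ homDeg d C (i + j) := by
  intro a b h
  rw [Matrix.mul_apply]
  refine Finset.sum_eq_zero fun c _ => ?_
  by_cases h1 : par a + par c = i
  · have h2 : par c + par b ≠ j := by
      rintro h2
      apply h
      rw [← h1, ← h2]
      generalize par a = x
      generalize par b = y
      generalize par c = z
      revert x y z
      decide
    rw [hg c b h2, mul_zero]
  · rw [hf a c h1, zero_mul]

theorem transpose_mem_homDeg {i : ZMod 2} {f : Mat d C} (hf : f ∈ homDeg d C i) :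
    f.transpose ∈ homDeg d C i := by
  intro a b h
  exact hf b a (by rwa [add_comm])

theorem one_mem_homDeg : (1 : Mat d C) ∈ homDeg d C 0 := by
  intro a b h
  by_cases hab : a = b
  · subst hab
    exfalso
    apply h
    generalize par a = x
    revert x
    decide
  · exact Matrix.one_apply_ne hab

theorem map_mem_homDeg {C' : Type*} [CommRing C'] (u : C →+* C') {i : ZMod 2} {f : Mat d C}
    (hf : f ∈ homDeg d C i) : u.mapMatrix f ∈ homDeg d C' i := by
  intro a b h
  simp [hf a b h]

/-- The inverse of a homogeneous matrix of degree `i` is homogeneous of degree `i`. -/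
theorem inv_mem_homDeg {i : ZMod 2} {f : (Mat d C)ˣ} (hf : (f : Mat d C) ∈ homDeg d C i) :
    ((f⁻¹ : (Mat d C)ˣ) : Mat d C) ∈ homDeg d C i := by
  classical
  set g : Mat d C := ((f⁻¹ : (Mat d C)ˣ) : Mat d C) with hg
  have hfg : (f : Mat d C) * g = 1 := by simp [hg]
  let p : Mat d C := Matrix.of fun a b => if par a + par b = i then g a b else 0
  have key : (f : Mat d C) * p = 1 := by
    ext a b
    by_cases hab : par a + par b = 0
    · rw [← hfg, Matrix.mul_apply, Matrix.mul_apply]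
      refine Finset.sum_congr rfl fun c _ => ?_
      by_cases h1 : par a + par c = i
      · have h2 : par c + par b = i := by
          rw [← h1]
          revert hab
          generalize par a = x
          generalize par b = y
          generalize par c = z
          revert x y z
          decide
        simp [p, h2]
      · rw [hf a c h1, zero_mul, zero_mul]
    · rw [one_mem_homDeg a b hab, Matrix.mul_apply]
      refine Finset.sum_eq_zero fun c _ => ?_
      by_cases h1 : par a + par c = i
      · have h2 : par c + par b ≠ i := by
          rintro h2
          apply hab
          have : par a + par b = (par a + par c) + (par c + par b) := by
            generalize par a = x
            generalize par b = y
            generalize par c = z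
            revert x y z
            decide
          rw [this, h1, h2]
          generalize i = x
          revert x
          decide
        simp [p, h2]
      · rw [hf a c h1, zero_mul]
  have hp : g = p := by
    have := congrArg (fun m => g * m) key
    simp only [mul_one] at this
    rw [← this, ← mul_assoc]
    simp [hg]
  rw [hp]
  intro a b h
  simp [p, h]

/-- The entrywise action of a ring map on invertible matrices. -/
def mapUnit {C' : Type*} [CommRing C'] (u : C →+* C') (f : (Mat d C)ˣ) : (Mat d C')ˣ :=
  Units.map (RingHom.mapMatrix u).toMonoidHom f

/-- The adjoint `b⁻¹ ᵗf b` of an endomorphism with respect to an invertible form `b`. -/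
def adj (b : (Mat d C)ˣ) (f : Mat d C) : Mat d C :=
  ((b⁻¹ : (Mat d C)ˣ) : Mat d C) * f.transpose * (b : Mat d C)

theorem adj_mul (b : (Mat d C)ˣ) (f g : Mat d C) : adj b (f * g) = adj b g * adj b f := by
  simp [adj, Matrix.transpose_mul, mul_assoc]

theorem adj_one (b : (Mat d C)ˣ) : adj b (1 : Mat d C) = 1 := by
  simp [adj]

theorem adj_mem_homDeg {b : (Mat d C)ˣ} {j : ZMod 2} (hb : (b : Mat d C) ∈ homDeg d C j)
    {i : ZMod 2} {f : Mat d C} (hf : f ∈ homDeg d C i) : adj b f ∈ homDeg d C i := by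
  have := mul_mem_homDeg (mul_mem_homDeg (inv_mem_homDeg hb) (transpose_mem_homDeg hf)) hb
  have e : j + i + j = i := by
    generalize i = x
    generalize j = y
    revert x y
    decide
  rwa [e] at this

/-- `adj` as a linear map. -/
def adjL (b : (Mat d C)ˣ) : Mat d C →ₗ[C] Mat d C where
  toFun := adj b
  map_add' f g := by simp [adj, mul_add, add_mul]
  map_smul' c f := by simp [adj]

theorem adj_eq_iff (b : (Mat d C)ˣ) (f : Mat d C) (g : Mat d C) :
    adj b f = g ↔ f.transpose * (b : Mat d C) = b * g := by
  unfold adj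
  rw [mul_assoc]
  constructor
  · rintro rfl
    simp
  · intro h
    rw [h]
    simp

end graded

/-! ### Matrix factorizations, `Ext`, bilinear structures -/

/-- A (reduced) matrix factorization of `w` over `k`, of rank `d`: an odd operator `Q` on
`M₀ ⊕ M₁` with `Q ^ 2 = w`, i.e. `Q = (0, ψ; φ, 0)` with `φ ψ = ψ φ = w`, vanishing at the
origin. -/
structure MatrixFactorization {k : Type u} [Field k] {n : ℕ} (w : MvPolynomial (Fin n) k)
    (d : ℕ) where
  /-- the odd operator -/
  Q : Mat d (PS n k)
  odd : Q ∈ homDeg d (PS n k) 1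
  sq : Q * Q = (w : PS n k) • (1 : Mat d (PS n k))
  zero : ∀ a b, MvPowerSeries.constantCoeff (Q a b) = 0

section overk
variable {k : Type u} [Field k] {n d : ℕ} {w : MvPolynomial (Fin n) k}

/-- The ideal of `k[[x]]` generated by the partial derivatives of `w`. -/
def jacobianIdeal (w : MvPolynomial (Fin n) k) : Ideal (PS n k) :=
  Ideal.span (Set.range fun i : Fin n => (MvPolynomial.pderiv i w : PS n k))

/-- The Tjurina ideal `(w, ∂w)`. -/
def tjurinaIdeal (w : MvPolynomial (Fin n) k) : Ideal (PS n k) :=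
  Ideal.span {(w : PS n k)} ⊔ jacobianIdeal w

/-- The hypersurface `w = 0` has an isolated singularity at the origin: its Tjurina algebra
`k[[x]] / (w, ∂w)` is finite dimensional. -/
def IsolatedSingularity (w : MvPolynomial (Fin n) k) : Prop :=
  Module.Finite k (PS n k ⧸ tjurinaIdeal w)

/-- The sign `(-1) ^ i`. -/
def sgn (i : ZMod 2) : ℤ := (-1) ^ i.val

theorem sgn_mul_self (i : ZMod 2) : sgn i * sgn i = 1 := by
  unfold sgn
  rw [← mul_pow]
  simp

namespace MatrixFactorization
variable (M : MatrixFactorization w d)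

/-- The differential `D f = Q f - (-1) ^ i f Q` on endomorphisms of degree `i`. -/
def D (i : ZMod 2) : Mat d (PS n k) →ₗ[PS n k] Mat d (PS n k) where
  toFun f := M.Q * f - sgn i • (f * M.Q)
  map_add' f g := by
    simp only [mul_add, add_mul, smul_add]
    abel
  map_smul' c f := by
    simp only [Matrix.mul_smul, Matrix.smul_mul, smul_sub, RingHom.id_apply]
    rw [smul_comm]

/-- Cocycles of degree `i`. -/
def Z (i : ZMod 2) : Submodule (PS n k) (Mat d (PS n k)) :=
  homDeg d (PS n k) i ⊓ LinearMap.ker (M.D i)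

/-- Coboundaries of degree `i`. -/
def B (i : ZMod 2) : Submodule (PS n k) (Mat d (PS n k)) :=
  (homDeg d (PS n k) (i + 1)).map (M.D (i + 1))

/-- `Ext^i(M, M)`: cocycles modulo coboundaries. -/
abbrev Ext (i : ZMod 2) := ↥(M.Z i) ⧸ (M.B i).submoduleOf (M.Z i)

/-- The class of a cocycle. -/
abbrev cls {i : ZMod 2} (f : M.Z i) : M.Ext i := Submodule.Quotient.mk f

/-- The ideal of `Q`-exact functions: those `h` for which `h • 1` is a coboundary. -/
def exactIdeal : Ideal (PS n k) :=
  (M.B 0).comap (LinearMap.toSpanSingleton (PS n k) (Mat d (PS n k)) 1)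

/-- The ideal formed by the classes of the `Q`-exact functions modulo `∂w`. -/
def exactClasses : Ideal (PS n k ⧸ jacobianIdeal w) :=
  M.exactIdeal.map (Ideal.Quotient.mk (jacobianIdeal w))

end MatrixFactorization

/-- The two kinds of structures: plain (an isomorphism `M ≅ M^*`, odd as a matrix) and twisted
(an isomorphism `M ≅ M^T`, even). -/
inductive FormKind
  | plain
  | twisted

namespace FormKind

/-- The degree of the matrix of the form. -/
def degree : FormKind → ZMod 2
  | plain => 1
  | twisted => 0

/-- The sign `s` in `Q^adj = s Q`. -/
def sign : FormKind → ℤ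
  | plain => -1
  | twisted => 1

theorem sign_mul_self (κ : FormKind) : κ.sign * κ.sign = 1 := by
  cases κ <;> rfl

end FormKind

/-- A bilinear structure on `M`. It is orthogonal for `ε = 1`, symplectic for `ε = -1`.
Plain kind: `b` is odd and invertible, `ᵗb = -ε b` and `Q^adj = -Q`.
Twisted kind: `q` is even and invertible, `ᵗq = ε q` and `Q^adj = Q`. -/
structure BilinearStructure (M : MatrixFactorization w d) where
  /-- plain or twisted -/
  kind : FormKind
  /-- orthogonal or symplectic -/
  ε : ℤˣ
  /-- the matrix of the form -/
  form : (Mat d (PS n k))ˣ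
  homogeneous : (form : Mat d (PS n k)) ∈ homDeg d (PS n k) kind.degree
  symm : (form : Mat d (PS n k)).transpose = (kind.sign * (ε : ℤ)) • (form : Mat d (PS n k))
  adj_Q : adj form M.Q = kind.sign • M.Q

namespace BilinearStructure
variable {M : MatrixFactorization w d} (b : BilinearStructure M)

theorem D_adj (i : ZMod 2) (f : Mat d (PS n k)) :
    M.D i (adj b.form f) = -(b.kind.sign * sgn i) • adj b.form (M.D i f) := by
  have h1 : adj b.form (M.D i f) =
      b.kind.sign • (adj b.form f * M.Q) - (sgn i * b.kind.sign) • (M.Q * adj b.form f) := by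
    have : M.D i f = M.Q * f - sgn i • (f * M.Q) := rfl
    rw [this]
    have h2 : adj b.form (M.Q * f - sgn i • (f * M.Q)) =
        adj b.form (M.Q * f) - sgn i • adj b.form (f * M.Q) := by
      rw [show adj b.form = adjL b.form from rfl, map_sub, map_zsmul]
    rw [h2, adj_mul, adj_mul, b.adj_Q, smul_mul_assoc, mul_smul_comm, smul_smul]
  have h3 : M.D i (adj b.form f) = M.Q * adj b.form f - sgn i • (adj b.form f * M.Q) := rfl
  rw [h1, h3, smul_sub, smul_smul, smul_smul]
  have e1 : -(b.kind.sign * sgn i) * b.kind.sign = - sgn i := by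
    linear_combination (-sgn i) * b.kind.sign_mul_self
  have e2 : -(b.kind.sign * sgn i) * (sgn i * b.kind.sign) = -1 := by
    linear_combination (-1 : ℤ) * b.kind.sign_mul_self -
      (b.kind.sign * b.kind.sign) * (sgn_mul_self i)
  rw [e1, e2]
  simp only [neg_smul, one_smul]
  abel

theorem adj_mem_Z {i : ZMod 2} {f : Mat d (PS n k)} (hf : f ∈ M.Z i) :
    adj b.form f ∈ M.Z i := by
  refine ⟨adj_mem_homDeg b.homogeneous hf.1, ?_⟩
  have h0 : M.D i f = 0 := hf.2
  change M.D i (adj b.form f) = 0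
  rw [D_adj, h0, show adj b.form = adjL b.form from rfl, map_zero, smul_zero]

theorem adj_mem_B {i : ZMod 2} {f : Mat d (PS n k)} (hf : f ∈ M.B i) :
    adj b.form f ∈ M.B i := by
  obtain ⟨g, hg, rfl⟩ := hf
  refine ⟨-(b.kind.sign * sgn (i + 1)) • adj b.form g,
    zsmul_mem (adj_mem_homDeg b.homogeneous hg) _, ?_⟩
  rw [map_zsmul, D_adj, smul_smul]
  have : -(b.kind.sign * sgn (i + 1)) * -(b.kind.sign * sgn (i + 1)) = 1 := by
    linear_combination b.kind.sign_mul_self * (sgn (i + 1) * sgn (i + 1)) + sgn_mul_self (i + 1)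
  rw [this, one_smul]

/-- The adjunction on cocycles. -/
def adjZ (i : ZMod 2) : M.Z i →ₗ[PS n k] M.Z i :=
  (adjL b.form).restrict fun _ hf => b.adj_mem_Z hf

/-- The adjunction on `Ext^i(M, M)`. -/
def adjExt (i : ZMod 2) : M.Ext i →ₗ[PS n k] M.Ext i :=
  Submodule.mapQ _ _ (b.adjZ i) fun _ hf => b.adj_mem_B hf

/-- The part of `Ext^i(M, M)` on which the adjunction is multiplication by `s`: the selfadjoint
elements for `s = 1`, the anti-selfadjoint ones for `s = -1`. -/
def extPart (i : ZMod 2) (s : ℤ) : Submodule (PS n k) (M.Ext i) :=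
  LinearMap.ker (b.adjExt i - s • LinearMap.id)

/-- The identity as a cocycle. -/
def oneZ (M : MatrixFactorization w d) : M.Z 0 :=
  ⟨1, one_mem_homDeg, by
    change M.Q * 1 - sgn 0 • (1 * M.Q) = 0
    simp [sgn]⟩

/-- The class of the identity; it is selfadjoint. -/
def oneExt : b.extPart 0 1 :=
  ⟨M.cls (oneZ M), by
    change b.adjExt 0 (M.cls (oneZ M)) - (1 : ℤ) • M.cls (oneZ M) = 0
    rw [one_smul, sub_eq_zero]
    have : b.adjZ 0 (oneZ M) = oneZ M := Subtype.ext (adj_one b.form)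
    change M.cls (b.adjZ 0 (oneZ M)) = _
    rw [this]⟩

/-- The map `R / I → Ext^0(M, M)^+`, `h ↦ [h • 1]`, where `I` is the ideal of `Q`-exact
functions. -/
def scalarMap : (PS n k ⧸ M.exactIdeal) →ₗ[PS n k] b.extPart 0 1 :=
  Submodule.liftQ M.exactIdeal (LinearMap.toSpanSingleton (PS n k) (b.extPart 0 1) b.oneExt) (by
    intro h hh
    apply Subtype.ext
    change M.cls (h • oneZ M) = 0
    rw [Submodule.Quotient.mk_eq_zero]
    exact hh)

/-- The cokernel of `R / I → Ext^0(M, M)^+`. -/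
abbrev ObstructionSpace := ↥(b.extPart 0 1) ⧸ LinearMap.range b.scalarMap

end BilinearStructure

end overk

/-! ### Deformations -/

/-- `A` is a local `k`-algebra with residue field `k`. -/
class IsCoeffRing (k A : Type*) [Field k] [CommRing A] [Algebra k A] : Prop
    extends IsLocalRing A where
  bijective : Function.Bijective (algebraMap k (ResidueField A))

/-- A `k`-algebra map between local `k`-algebras with residue field `k` is local. -/
theorem map_mem_maximalIdeal {k A A' : Type*} [Field k] [CommRing A] [Algebra k A]
    [CommRing A'] [Algebra k A'] [IsCoeffRing k A] [IsCoeffRing k A'] (u : A →ₐ[k] A') {a : A}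
    (ha : a ∈ maximalIdeal A) : u a ∈ maximalIdeal A' := by
  obtain ⟨c, hc⟩ := (IsCoeffRing.bijective (k := k) (A := A')).2 (residue A' (u a))
  have h1 : u a - algebraMap k A' c ∈ maximalIdeal A' := by
    rw [← residue_eq_zero_iff, map_sub, ← hc]
    exact sub_self _
  by_cases h0 : c = 0
  · simpa [h0] using h1
  · exfalso
    have h2 : IsUnit (a - algebraMap k A c) := by
      by_contra h
      have h3 : a - (a - algebraMap k A c) ∈ maximalIdeal A :=
        sub_mem ha ((mem_maximalIdeal _).2 h)
      rw [sub_sub_cancel] at h3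
      exact (mem_maximalIdeal _).1 h3 ((isUnit_iff_ne_zero.2 h0).map _)
    have h4 := h2.map u
    rw [map_sub, AlgHom.commutes] at h4
    exact (mem_maximalIdeal _).1 h1 h4

section deformations
variable {k : Type u} [Field k] {n d : ℕ} {w : MvPolynomial (Fin n) k}

/-- The inclusion `k[[x]] → A[[x]]`. -/
def const (n : ℕ) {k : Type*} [Field k] (A : Type*) [CommRing A] [Algebra k A] :
    PS n k →+* PS n A :=
  MvPowerSeries.map (algebraMap k A)

/-- Reduction modulo the maximal ideal of `A`. -/
def red (n : ℕ) (A : Type*) [CommRing A] [IsLocalRing A] : PS n A →+* PS n (ResidueField A) :=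
  MvPowerSeries.map (residue A)

theorem red_eq_zero_iff {A : Type*} [CommRing A] [IsLocalRing A] (f : PS n A) :
    red n A f = 0 ↔ ∀ m, MvPowerSeries.coeff m f ∈ maximalIdeal A := by
  rw [MvPowerSeries.ext_iff]
  simp [red, MvPowerSeries.coeff_map]

theorem map_const {A A' : Type*} [CommRing A] [Algebra k A] [CommRing A'] [Algebra k A']
    (u : A →ₐ[k] A') (f : PS n k) :
    MvPowerSeries.map (u : A →+* A') (const n A f) = const n A' f := by
  ext m
  simp [const, MvPowerSeries.coeff_map]

theorem red_map_eq {A A' : Type*} [CommRing A] [Algebra k A]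
    [CommRing A'] [Algebra k A'] [IsCoeffRing k A] [IsCoeffRing k A'] (u : A →ₐ[k] A')
    {f g : PS n A} (h : red n A f = red n A g) :
    red n A' (MvPowerSeries.map (u : A →+* A') f) =
      red n A' (MvPowerSeries.map (u : A →+* A') g) := by
  rw [← sub_eq_zero, ← map_sub, red_eq_zero_iff] at h
  rw [← sub_eq_zero, ← map_sub, ← map_sub, red_eq_zero_iff]
  intro m
  rw [MvPowerSeries.coeff_map]
  exact map_mem_maximalIdeal u (h m)

/-- The constant extension `b ⊗ 1` to `A` of the form of a bilinear structure. -/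
def BilinearStructure.formOver {M : MatrixFactorization w d} (b : BilinearStructure M)
    (A : Type*) [CommRing A] [Algebra k A] : (Mat d (PS n A))ˣ :=
  mapUnit (const n A) b.form

/-- A matrix factorization over `A` reducing to `M`, of some potential `ω ∈ A[[x]]`. If a bilinear
structure `b` on `M` is given (`β = some b`), the factorization is required to carry the constant
structure `b ⊗ 1`; for `β = none` there is no such condition. -/
@[ext]
structure Deformation (M : MatrixFactorization w d) (β : Option (BilinearStructure M))
    (A : Type*) [CommRing A] [Algebra k A] [IsLocalRing A] where
  /-- the odd operator -/
  Q : Mat d (PS n A)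
  odd : Q ∈ homDeg d (PS n A) 1
  sq : ∃ ω : PS n A, Q * Q = ω • (1 : Mat d (PS n A))
  red_eq : (red n A).mapMatrix Q = (red n A).mapMatrix ((const n A).mapMatrix M.Q)
  adj_eq : ∀ b ∈ β, adj (b.formOver A) Q = b.kind.sign • Q

variable {M : MatrixFactorization w d} {β : Option (BilinearStructure M)}

theorem const_sq (M : MatrixFactorization w d) (A : Type*) [CommRing A] [Algebra k A] :
    (const n A).mapMatrix M.Q * (const n A).mapMatrix M.Q =
      const n A (w : PS n k) • (1 : Mat d (PS n A)) := by
  rw [← map_mul, M.sq]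
  ext a b
  simp only [RingHom.mapMatrix_apply, Matrix.map_apply, Matrix.smul_apply, smul_eq_mul, map_mul]
  congr 1
  by_cases h : a = b <;> simp [h, Matrix.one_apply]

theorem adj_map {C C' : Type*} [CommRing C] [CommRing C'] (u : C →+* C') (b : (Mat d C)ˣ)
    (f : Mat d C) :
    adj (mapUnit u b) (u.mapMatrix f) =
      u.mapMatrix (adj b f) := by
  rw [adj, adj, map_mul, map_mul]
  rfl

/-- The trivial deformation. -/
def Deformation.trivial (M : MatrixFactorization w d) (β : Option (BilinearStructure M))
    (A : Type*) [CommRing A] [Algebra k A] [IsLocalRing A] : Deformation M β A where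
  Q := (const n A).mapMatrix M.Q
  odd := map_mem_homDeg _ M.odd
  sq := ⟨_, const_sq M A⟩
  red_eq := rfl
  adj_eq b _ := by
    rw [BilinearStructure.formOver, adj_map, b.adj_Q, map_zsmul]

/-- Extension of scalars of a deformation along `A → A'`. -/
def Deformation.map {A A' : Type*} [CommRing A] [Algebra k A]
    [CommRing A'] [Algebra k A'] [IsCoeffRing k A] [IsCoeffRing k A'] (u : A →ₐ[k] A')
    (N : Deformation M β A) : Deformation M β A' where
  Q := (MvPowerSeries.map (u : A →+* A')).mapMatrix N.Q
  odd := map_mem_homDeg _ N.odd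
  sq := by
    obtain ⟨ω, h⟩ := N.sq
    refine ⟨MvPowerSeries.map (u : A →+* A') ω, ?_⟩
    rw [← map_mul, h]
    ext1 a b
    simp only [RingHom.mapMatrix_apply, Matrix.map_apply, Matrix.smul_apply, smul_eq_mul, map_mul]
    congr 1
    by_cases h : a = b <;> simp [h, Matrix.one_apply]
  red_eq := by
    ext1 a b
    have h := congrFun (congrFun N.red_eq a) b
    simp only [RingHom.mapMatrix_apply, Matrix.map_apply] at h ⊢
    rw [red_map_eq u h, map_const]
  adj_eq b hb := by
    have h : b.formOver A' =
        mapUnit (MvPowerSeries.map (u : A →+* A')) (b.formOver A) := by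
      apply Units.ext
      ext1 i j
      change const n A' _ = MvPowerSeries.map (u : A →+* A') (const n A _)
      rw [map_const]
    rw [h, adj_map, N.adj_eq b hb, map_zsmul]

/-- Two deformations are equivalent if there is a gauge transformation between them: an
infinitesimal change of variables `σ` (an `A`-automorphism of `A[[x]]` reducing to the identity of
`k[[x]]`) followed by an infinitesimal automorphism `F = (S, T)` of the graded module (even,
invertible, reducing to the identity). If a bilinear structure is given, the semilinear isomorphism
`F ∘ σ` is required to be an isometry of the constant structure. -/
def Deformation.Equivalent {A : Type*} [CommRing A] [Algebra k A] [IsLocalRing A]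
    (N₁ N₂ : Deformation M β A) : Prop :=
  ∃ (σ : PS n A ≃ₐ[A] PS n A) (F : (Mat d (PS n A))ˣ),
    (∀ f, red n A (σ f) = red n A f) ∧
    (F : Mat d (PS n A)) ∈ homDeg d (PS n A) 0 ∧
    (red n A).mapMatrix (F : Mat d (PS n A)) = 1 ∧
    (∀ b ∈ β, (F : Mat d (PS n A)).transpose * (b.formOver A : Mat d (PS n A)) * F =
      σ.mapMatrix (b.formOver A : Mat d (PS n A))) ∧
    (F : Mat d (PS n A)) * σ.mapMatrix N₁.Q = N₂.Q * F

section equivalence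
variable {A : Type*} [CommRing A] [Algebra k A] [IsLocalRing A]

theorem red_mapMatrix_congr {σ : PS n A ≃ₐ[A] PS n A} (hσ : ∀ f, red n A (σ f) = red n A f)
    (X : Mat d (PS n A)) : (red n A).mapMatrix (σ.mapMatrix X) = (red n A).mapMatrix X := by
  ext1 a b
  exact hσ _

theorem mapMatrix_transpose {A : Type*} [CommRing A] (σ : PS n A ≃ₐ[A] PS n A) (X : Mat d (PS n A)) :
    σ.mapMatrix X.transpose = (σ.mapMatrix X).transpose := rfl

theorem Deformation.Equivalent.refl (N : Deformation M β A) : N.Equivalent N :=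
  ⟨AlgEquiv.refl, 1, fun _ => rfl, one_mem_homDeg, by simp, by intro b _; simp, by simp⟩

theorem Deformation.Equivalent.trans {N₁ N₂ N₃ : Deformation M β A} (h₁ : N₁.Equivalent N₂)
    (h₂ : N₂.Equivalent N₃) : N₁.Equivalent N₃ := by
  obtain ⟨σ, F, h1, h2, h3, h4, h5⟩ := h₁
  obtain ⟨τ, G, g1, g2, g3, g4, g5⟩ := h₂
  refine ⟨σ.trans τ, G * mapUnit (τ : PS n A →+* PS n A) F, ?_, ?_,
    ?_, ?_, ?_⟩
  · intro f
    simp [g1, h1]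
  · have := mul_mem_homDeg g2 (map_mem_homDeg (τ : PS n A →+* PS n A) h2)
    rw [zero_add] at this
    exact this
  · change (red n A).mapMatrix ((G : Mat d (PS n A)) * τ.mapMatrix (F : Mat d (PS n A))) = 1
    rw [map_mul, g3, red_mapMatrix_congr g1, h3, one_mul]
  · intro b hb
    change ((G : Mat d (PS n A)) * τ.mapMatrix (F : Mat d (PS n A))).transpose * _ *
      ((G : Mat d (PS n A)) * τ.mapMatrix (F : Mat d (PS n A))) =
        τ.mapMatrix (σ.mapMatrix (b.formOver A : Mat d (PS n A)))
    rw [← h4 b hb, map_mul, map_mul, ← g4 b hb, mapMatrix_transpose, Matrix.transpose_mul]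
    simp only [mul_assoc]
  · change ((G : Mat d (PS n A)) * τ.mapMatrix (F : Mat d (PS n A))) *
      τ.mapMatrix (σ.mapMatrix N₁.Q) = N₃.Q * (G * τ.mapMatrix (F : Mat d (PS n A)))
    rw [mul_assoc, ← map_mul, h5, map_mul, ← mul_assoc, g5, mul_assoc]

theorem Deformation.Equivalent.symm {N₁ N₂ : Deformation M β A} (h : N₁.Equivalent N₂) :
    N₂.Equivalent N₁ := by
  obtain ⟨σ, F, h1, h2, h3, h4, h5⟩ := h
  have hs : ∀ f, red n A (σ.symm f) = red n A f := fun f => by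
    rw [← h1 (σ.symm f), AlgEquiv.apply_symm_apply]
  have hF : σ.symm.mapMatrix (F : Mat d (PS n A)) *
      σ.symm.mapMatrix ((F⁻¹ : (Mat d (PS n A))ˣ) : Mat d (PS n A)) = 1 := by
    rw [← map_mul]
    simp
  have hF' : σ.symm.mapMatrix ((F⁻¹ : (Mat d (PS n A))ˣ) : Mat d (PS n A)) *
      σ.symm.mapMatrix (F : Mat d (PS n A)) = 1 := by
    rw [← map_mul]
    simp
  have hss : ∀ X : Mat d (PS n A), σ.symm.mapMatrix (σ.mapMatrix X) = X := fun X => by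
    ext1 a b
    exact σ.symm_apply_apply _
  refine ⟨σ.symm, mapUnit (σ.symm : PS n A →+* PS n A) F⁻¹, hs,
    map_mem_homDeg (σ.symm : PS n A →+* PS n A) (inv_mem_homDeg h2), ?_, ?_, ?_⟩
  · change (red n A).mapMatrix (σ.symm.mapMatrix ((F⁻¹ : (Mat d (PS n A))ˣ) : Mat d (PS n A))) = 1
    rw [red_mapMatrix_congr hs]
    have := congrArg (red n A).mapMatrix (F.inv_mul)
    rwa [map_mul, h3, mul_one, map_one] at this
  · intro b hb
    change (σ.symm.mapMatrix ((F⁻¹ : (Mat d (PS n A))ˣ) : Mat d (PS n A))).transpose * _ *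
      (σ.symm.mapMatrix ((F⁻¹ : (Mat d (PS n A))ˣ) : Mat d (PS n A))) = _
    have h6 := congrArg σ.symm.mapMatrix (h4 b hb)
    rw [hss, map_mul, map_mul, mapMatrix_transpose] at h6
    nth_rewrite 1 [← h6]
    have h7 : (σ.symm.mapMatrix ((F⁻¹ : (Mat d (PS n A))ˣ) : Mat d (PS n A))).transpose *
        (σ.symm.mapMatrix (F : Mat d (PS n A))).transpose = 1 := by
      rw [← Matrix.transpose_mul, hF, Matrix.transpose_one]
    calc _ = ((σ.symm.mapMatrix ((F⁻¹ : (Mat d (PS n A))ˣ) : Mat d (PS n A))).transpose *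
          (σ.symm.mapMatrix (F : Mat d (PS n A))).transpose) *
          σ.symm.mapMatrix (b.formOver A : Mat d (PS n A)) *
          (σ.symm.mapMatrix (F : Mat d (PS n A)) *
            σ.symm.mapMatrix ((F⁻¹ : (Mat d (PS n A))ˣ) : Mat d (PS n A))) := by
            simp only [mul_assoc]
      _ = _ := by rw [h7, hF, one_mul, mul_one]
  · change σ.symm.mapMatrix ((F⁻¹ : (Mat d (PS n A))ˣ) : Mat d (PS n A)) * σ.symm.mapMatrix N₂.Q =
      N₁.Q * σ.symm.mapMatrix ((F⁻¹ : (Mat d (PS n A))ˣ) : Mat d (PS n A))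
    have h6 := congrArg σ.symm.mapMatrix h5
    rw [map_mul, map_mul, hss] at h6
    calc _ = σ.symm.mapMatrix ((F⁻¹ : (Mat d (PS n A))ˣ) : Mat d (PS n A)) *
          (σ.symm.mapMatrix N₂.Q * σ.symm.mapMatrix (F : Mat d (PS n A))) *
          σ.symm.mapMatrix ((F⁻¹ : (Mat d (PS n A))ˣ) : Mat d (PS n A)) := by
            rw [mul_assoc, mul_assoc, hF, mul_one]
      _ = _ := by rw [← h6, ← mul_assoc, hF', one_mul]

end equivalence

/-- Equivalence of deformations as a setoid. -/
instance Deformation.setoid (M : MatrixFactorization w d) (β : Option (BilinearStructure M))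
    (A : Type*) [CommRing A] [Algebra k A] [IsLocalRing A] : Setoid (Deformation M β A) where
  r := Deformation.Equivalent
  iseqv := ⟨Deformation.Equivalent.refl, Deformation.Equivalent.symm, Deformation.Equivalent.trans⟩

/-- The value at `A` of the deformation functor of `M` (`β = none`), or of `M` equipped with the
bilinear structure `b` (`β = some b`). -/
def Def (M : MatrixFactorization w d) (β : Option (BilinearStructure M))
    (A : Type*) [CommRing A] [Algebra k A] [IsLocalRing A] :=
  Quotient (Deformation.setoid M β A)

/-- The class of a deformation. -/
def Deformation.cls {A : Type*} [CommRing A] [Algebra k A] [IsLocalRing A]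
    (N : Deformation M β A) : Def M β A := Quotient.mk _ N

/-- Forgetting the bilinear structure. -/
def Deformation.forget {A : Type*} [CommRing A] [Algebra k A] [IsLocalRing A]
    (N : Deformation M β A) : Deformation M none A where
  Q := N.Q
  odd := N.odd
  sq := N.sq
  red_eq := N.red_eq
  adj_eq := by simp

/-- Duality: the factorization `M^*` (plain kind) or `M^T` (twisted kind) of a deformation,
transported back by the form `b`. Its operator is `s • Q^adj`, `s` being the sign of `b`. -/
def Deformation.dual (b : BilinearStructure M) {A : Type*} [CommRing A] [Algebra k A]
    [IsLocalRing A] (N : Deformation M none A) : Deformation M none A where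
  Q := b.kind.sign • adj (b.formOver A) N.Q
  odd := zsmul_mem (adj_mem_homDeg (map_mem_homDeg (const n A) b.homogeneous) N.odd) _
  sq := by
    obtain ⟨ω, h⟩ := N.sq
    refine ⟨ω, ?_⟩
    rw [smul_mul_smul_comm, b.kind.sign_mul_self, one_smul, ← adj_mul, h,
      show adj (b.formOver A) = adjL (b.formOver A) from rfl, map_smul]
    congr 1
    exact adj_one _
  red_eq := by
    have h1 : ∀ X : Mat d (PS n A), (red n A).mapMatrix (adj (b.formOver A) X) =
        adj (mapUnit (red n A) (b.formOver A))
          ((red n A).mapMatrix X) := fun X => (adj_map _ _ _).symm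
    have h2 : (const n A).mapMatrix M.Q =
        b.kind.sign • adj (b.formOver A) ((const n A).mapMatrix M.Q) := by
      rw [BilinearStructure.formOver, adj_map, b.adj_Q, map_zsmul, smul_smul,
        b.kind.sign_mul_self, one_smul]
    rw [h2, map_zsmul, map_zsmul, h1, h1, N.red_eq]
  adj_eq := by simp

/-! ### The tangent space `Def(k[ε])` and its vector space structure -/

section tangent

instance : IsCoeffRing k (DualNumber k) where
  bijective := by
    refine ⟨RingHom.injective _, fun x => ?_⟩
    obtain ⟨a, rfl⟩ := residue_surjective x
    refine ⟨a.fst, ?_⟩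
    change residue _ (algebraMap k (DualNumber k) a.fst) = _
    rw [← sub_eq_zero, ← map_sub, residue_eq_zero_iff, mem_maximalIdeal, mem_nonunits_iff,
      TrivSqZeroExt.isUnit_iff_isUnit_fst]
    simp [TrivSqZeroExt.algebraMap_eq_inl]

theorem mem_maximalIdeal_dual (a : DualNumber k) :
    a ∈ maximalIdeal (DualNumber k) ↔ a.fst = 0 := by
  rw [mem_maximalIdeal, mem_nonunits_iff, TrivSqZeroExt.isUnit_iff_isUnit_fst]
  simp

theorem dual_mul_eq_zero {f g : PS n (DualNumber k)} (hf : red n _ f = 0) (hg : red n _ g = 0) :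
    f * g = 0 := by
  rw [red_eq_zero_iff] at hf hg
  ext1 m
  rw [MvPowerSeries.coeff_mul, map_zero]
  refine Finset.sum_eq_zero fun x _ => ?_
  have h1 := (mem_maximalIdeal_dual _).1 (hf x.1)
  have h2 := (mem_maximalIdeal_dual _).1 (hg x.2)
  ext <;> simp [h1, h2]

theorem dual_exists_eps {f : PS n (DualNumber k)} (hf : red n _ f = 0) :
    ∃ g : PS n (DualNumber k), f = (DualNumber.eps : DualNumber k) • g := by
  rw [red_eq_zero_iff] at hf
  refine ⟨fun m => TrivSqZeroExt.inl (MvPowerSeries.coeff m f).snd, ?_⟩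
  ext1 m
  have h1 := (mem_maximalIdeal_dual _).1 (hf m)
  change _ = (DualNumber.eps : DualNumber k) • (TrivSqZeroExt.inl (MvPowerSeries.coeff m f).snd : DualNumber k)
  ext <;> simp [h1]

theorem dual_matrix_mul_eq_zero {X Y : Mat d (PS n (DualNumber k))}
    (hX : (red n _).mapMatrix X = 0) (hY : (red n _).mapMatrix Y = 0) : X * Y = 0 := by
  ext1 a b
  rw [Matrix.mul_apply]
  refine Finset.sum_eq_zero fun c _ => ?_
  exact dual_mul_eq_zero (congrFun (congrFun hX a) c) (congrFun (congrFun hY c) b)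

/-- An infinitesimal change of variables is the identity on multiples of `ε`. -/
theorem dual_fix {σ : PS n (DualNumber k) ≃ₐ[DualNumber k] PS n (DualNumber k)}
    (hσ : ∀ f, red n _ (σ f) = red n _ f) {f : PS n (DualNumber k)} (hf : red n _ f = 0) :
    σ f = f := by
  obtain ⟨g, rfl⟩ := dual_exists_eps hf
  rw [map_smul, ← sub_eq_zero, ← smul_sub]
  have h1 : red n _ (σ g - g) = 0 := by rw [map_sub, hσ, sub_self]
  rw [MvPowerSeries.smul_eq_C_mul]
  refine dual_mul_eq_zero ?_ h1
  rw [red, MvPowerSeries.map_C]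
  have : residue (DualNumber k) DualNumber.eps = 0 := by
    rw [residue_eq_zero_iff, mem_maximalIdeal_dual]
    simp
  rw [this, map_zero]

theorem dual_fix_mat {σ : PS n (DualNumber k) ≃ₐ[DualNumber k] PS n (DualNumber k)}
    (hσ : ∀ f, red n _ (σ f) = red n _ f) {X : Mat d (PS n (DualNumber k))}
    (hX : (red n _).mapMatrix X = 0) : σ.mapMatrix X = X := by
  ext1 a b
  exact dual_fix hσ (congrFun (congrFun hX a) b)

theorem red_smul (c : k) (f : PS n (DualNumber k)) (hf : red n _ f = 0) :
    red n _ (c • f) = 0 := by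
  rw [red_eq_zero_iff] at hf ⊢
  intro m
  have := (mem_maximalIdeal_dual _).1 (hf m)
  rw [mem_maximalIdeal_dual]
  change (c • MvPowerSeries.coeff m f).fst = 0
  simp [this]

/-- The endomorphism `f ↦ f + c (σ f - f)`. -/
def scaleHom (c : k) (σ : PS n (DualNumber k) ≃ₐ[DualNumber k] PS n (DualNumber k))
    (hσ : ∀ f, red n _ (σ f) = red n _ f) :
    PS n (DualNumber k) →ₐ[DualNumber k] PS n (DualNumber k) :=
  AlgHom.ofLinearMap
    (LinearMap.id + c • (σ.toLinearMap - LinearMap.id)) (by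
      change (1 : PS n (DualNumber k)) + c • (σ 1 - 1) = 1
      rw [map_one, sub_self, smul_zero, add_zero]) (by
      intro f g
      change f * g + c • (σ (f * g) - f * g) = (f + c • (σ f - f)) * (g + c • (σ g - g))
      have h1 : red n _ (σ f - f) = 0 := by rw [map_sub, hσ, sub_self]
      have h2 : red n _ (σ g - g) = 0 := by rw [map_sub, hσ, sub_self]
      have h3 := dual_mul_eq_zero h1 h2
      rw [map_mul]
      have h4 : σ f * σ g - f * g = (σ f - f) * g + f * (σ g - g) := by
        linear_combination h3
      rw [h4, add_mul, mul_add, mul_add, smul_mul_smul_comm, h3, smul_zero, add_zero, smul_add,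
        mul_smul_comm, smul_mul_assoc]
      abel)

theorem scaleHom_apply (c : k) (σ : PS n (DualNumber k) ≃ₐ[DualNumber k] PS n (DualNumber k))
    (hσ : ∀ f, red n _ (σ f) = red n _ f) (f : PS n (DualNumber k)) :
    scaleHom c σ hσ f = f + c • (σ f - f) := rfl

theorem scaleHom_comp (c : k) (σ : PS n (DualNumber k) ≃ₐ[DualNumber k] PS n (DualNumber k))
    (hσ : ∀ f, red n _ (σ f) = red n _ f) (f : PS n (DualNumber k)) :
    scaleHom c σ hσ (scaleHom (-c) σ hσ f) = f := by
  have h1 : red n _ (σ f - f) = 0 := by rw [map_sub, hσ, sub_self]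
  have h2 : σ ((-c) • (σ f - f)) = (-c) • (σ f - f) := dual_fix hσ (red_smul _ _ h1)
  rw [scaleHom_apply, scaleHom_apply, map_add, h2]
  rw [add_sub_add_right_eq_sub, neg_smul]
  abel

/-- The automorphism `f ↦ f + c (σ f - f)`. -/
def scale (c : k) (σ : PS n (DualNumber k) ≃ₐ[DualNumber k] PS n (DualNumber k))
    (hσ : ∀ f, red n _ (σ f) = red n _ f) :
    PS n (DualNumber k) ≃ₐ[DualNumber k] PS n (DualNumber k) :=
  AlgEquiv.ofAlgHom (scaleHom c σ hσ) (scaleHom (-c) σ hσ)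
    (AlgHom.ext fun f => scaleHom_comp c σ hσ f)
    (AlgHom.ext fun f => by
      have := scaleHom_comp (-c) σ hσ f
      rwa [neg_neg] at this)

/-- The constant operator. -/
abbrev Q0 (M : MatrixFactorization w d) : Mat d (PS n (DualNumber k)) :=
  (const n (DualNumber k)).mapMatrix M.Q

theorem Deformation.red_sub (N : Deformation M β (DualNumber k)) :
    (red n _).mapMatrix (N.Q - Q0 M) = 0 := by
  rw [map_sub, N.red_eq, sub_self]

theorem Q0_odd (M : MatrixFactorization w d) : Q0 M ∈ homDeg d (PS n (DualNumber k)) 1 :=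
  map_mem_homDeg _ M.odd

theorem smulk_mem (c : k) {i : ZMod 2} {X : Mat d (PS n (DualNumber k))}
    (h : X ∈ homDeg d (PS n (DualNumber k)) i) : c • X ∈ homDeg d (PS n (DualNumber k)) i := by
  intro a b hab
  rw [Matrix.smul_apply, h a b hab, smul_zero]

theorem adj_smulk (b : (Mat d (PS n (DualNumber k)))ˣ) (c : k) (X : Mat d (PS n (DualNumber k))) :
    adj b (c • X) = c • adj b X := by
  simp [adj]

theorem adj_add' (b : (Mat d (PS n (DualNumber k)))ˣ) (X Y : Mat d (PS n (DualNumber k))) :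
    adj b (X + Y) = adj b X + adj b Y := map_add (adjL b) X Y

theorem adj_sub' (b : (Mat d (PS n (DualNumber k)))ˣ) (X Y : Mat d (PS n (DualNumber k))) :
    adj b (X - Y) = adj b X - adj b Y := map_sub (adjL b) X Y

theorem Q0_adj (b : BilinearStructure M) :
    adj (b.formOver (DualNumber k)) (Q0 M) = b.kind.sign • Q0 M :=
  (Deformation.trivial M (some b) (DualNumber k)).adj_eq b rfl

theorem red_mat_smul (c : k) (X : Mat d (PS n (DualNumber k)))
    (hX : (red n _).mapMatrix X = 0) : (red n _).mapMatrix (c • X) = 0 := by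
  ext1 a b
  exact red_smul c _ (congrFun (congrFun hX a) b)

/-- The sum of the first order deformations `Q + ε Q₁` and `Q + ε Q₂` is `Q + ε (Q₁ + Q₂)`. -/
def Deformation.add (N₁ N₂ : Deformation M β (DualNumber k)) : Deformation M β (DualNumber k) where
  Q := N₁.Q + (N₂.Q - Q0 M)
  odd := add_mem N₁.odd (sub_mem N₂.odd (Q0_odd M))
  sq := by
    obtain ⟨ω₁, h₁⟩ := N₁.sq
    obtain ⟨ω₂, h₂⟩ := N₂.sq
    refine ⟨ω₁ + ω₂ - const n _ (w : PS n k), ?_⟩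
    have h3 := dual_matrix_mul_eq_zero N₁.red_sub N₂.red_sub
    have h4 := dual_matrix_mul_eq_zero N₂.red_sub N₁.red_sub
    have h5 := dual_matrix_mul_eq_zero N₂.red_sub N₂.red_sub
    rw [sub_smul, add_smul, ← h₁, ← h₂, ← const_sq M]
    have : (N₁.Q + (N₂.Q - Q0 M)) * (N₁.Q + (N₂.Q - Q0 M)) =
      N₁.Q * N₁.Q + N₂.Q * N₂.Q - Q0 M * Q0 M + (N₁.Q - Q0 M) * (N₂.Q - Q0 M) +
        (N₂.Q - Q0 M) * (N₁.Q - Q0 M) := by noncomm_ring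
    rw [this, h3, h4, add_zero, add_zero]
  red_eq := by rw [map_add, N₂.red_sub, add_zero, N₁.red_eq]
  adj_eq b hb := by
    rw [adj_add', adj_sub', N₁.adj_eq b hb, N₂.adj_eq b hb, Q0_adj, smul_add, smul_sub]

/-- The multiple `Q + ε c Q₁` of the first order deformation `Q + ε Q₁`. -/
def Deformation.smul (c : k) (N : Deformation M β (DualNumber k)) :
    Deformation M β (DualNumber k) where
  Q := Q0 M + c • (N.Q - Q0 M)
  odd := add_mem (Q0_odd M) (smulk_mem c (sub_mem N.odd (Q0_odd M)))
  sq := by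
    obtain ⟨ω, h⟩ := N.sq
    refine ⟨const n _ (w : PS n k) + c • (ω - const n _ (w : PS n k)), ?_⟩
    have h3 := dual_matrix_mul_eq_zero N.red_sub N.red_sub
    have h4 : Q0 M * (N.Q - Q0 M) + (N.Q - Q0 M) * Q0 M = N.Q * N.Q - Q0 M * Q0 M := by
      rw [← sub_eq_zero, ← neg_eq_zero, ← h3]
      noncomm_ring
    rw [add_smul, smul_assoc, sub_smul, ← h, ← const_sq M, add_mul, mul_add, mul_add,
      smul_mul_smul_comm, h3, smul_zero, add_zero, mul_smul_comm, smul_mul_assoc, add_assoc,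
      ← smul_add, h4]
  red_eq := by rw [map_add, red_mat_smul c _ N.red_sub, add_zero]
  adj_eq b hb := by
    rw [adj_add', adj_smulk, adj_sub', N.adj_eq b hb, Q0_adj, smul_add, ← smul_sub,
      smul_comm c]

/-- Equivalence of first order deformations in linearized form. -/
theorem equivalent_iff_linear (N₁ N₂ : Deformation M β (DualNumber k)) :
    N₁.Equivalent N₂ ↔
    ∃ (σ : PS n (DualNumber k) ≃ₐ[DualNumber k] PS n (DualNumber k))
      (G : Mat d (PS n (DualNumber k))),
      (∀ f, red n _ (σ f) = red n _ f) ∧ G ∈ homDeg d (PS n (DualNumber k)) 0 ∧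
      (red n _).mapMatrix G = 0 ∧
      (∀ b ∈ β, G.transpose * (b.formOver (DualNumber k) : Mat d (PS n (DualNumber k))) +
        (b.formOver (DualNumber k) : Mat d (PS n (DualNumber k))) * G =
        σ.mapMatrix (b.formOver (DualNumber k) : Mat d (PS n (DualNumber k))) -
          (b.formOver (DualNumber k) : Mat d (PS n (DualNumber k)))) ∧
      N₁.Q + (σ.mapMatrix (Q0 M) - Q0 M) + G * Q0 M = N₂.Q + Q0 M * G := by
  have key : ∀ (σ : PS n (DualNumber k) ≃ₐ[DualNumber k] PS n (DualNumber k))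
      (G : Mat d (PS n (DualNumber k))), (∀ f, red n _ (σ f) = red n _ f) →
      (red n _).mapMatrix G = 0 →
      ((∀ b : BilinearStructure M, (1 + G).transpose *
          (b.formOver (DualNumber k) : Mat d (PS n (DualNumber k))) * (1 + G) =
        (b.formOver (DualNumber k) : Mat d (PS n (DualNumber k))) + (G.transpose *
          (b.formOver (DualNumber k) : Mat d (PS n (DualNumber k))) +
        (b.formOver (DualNumber k) : Mat d (PS n (DualNumber k))) * G)) ∧
      (1 + G) * σ.mapMatrix N₁.Q - N₂.Q * (1 + G) =
        N₁.Q + (σ.mapMatrix (Q0 M) - Q0 M) + G * Q0 M - (N₂.Q + Q0 M * G)) := by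
    intro σ G hσ hG
    constructor
    · intro b
      have h1 : G.transpose * ((b.formOver (DualNumber k) : Mat d (PS n (DualNumber k))) * G) = 0 := by
        apply dual_matrix_mul_eq_zero
        · change ((red n _).mapMatrix G).transpose = 0
          rw [hG, Matrix.transpose_zero]
        · rw [map_mul, hG, mul_zero]
      rw [Matrix.transpose_add, Matrix.transpose_one, add_mul, add_mul, mul_add, mul_add,
        mul_assoc G.transpose _ G, h1]
      simp only [one_mul, mul_one]
      abel
    · have h1 : σ.mapMatrix N₁.Q = N₁.Q + (σ.mapMatrix (Q0 M) - Q0 M) := by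
        have h2 := dual_fix_mat hσ N₁.red_sub
        rw [map_sub] at h2
        rw [sub_eq_sub_iff_add_eq_add] at h2
        rw [← add_sub_assoc, ← h2, add_sub_cancel_right]
      have h3 : G * (N₁.Q - Q0 M) = 0 := dual_matrix_mul_eq_zero hG N₁.red_sub
      have h4 : (N₂.Q - Q0 M) * G = 0 := dual_matrix_mul_eq_zero N₂.red_sub hG
      have h5 : G * (σ.mapMatrix (Q0 M) - Q0 M) = 0 := by
        apply dual_matrix_mul_eq_zero hG
        rw [map_sub, red_mapMatrix_congr hσ, sub_self]
      have h3' : G * N₁.Q = G * Q0 M := by rwa [mul_sub, sub_eq_zero] at h3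
      have h4' : N₂.Q * G = Q0 M * G := by rwa [sub_mul, sub_eq_zero] at h4
      rw [h1, add_mul, mul_add, mul_add, mul_add, h5, h3', h4']
      simp only [one_mul, mul_one]
      abel
  constructor
  · rintro ⟨σ, F, h1, h2, h3, h4, h5⟩
    have hF : (F : Mat d (PS n (DualNumber k))) = 1 + (F - 1) := by abel
    have hG : (red n _).mapMatrix ((F : Mat d (PS n (DualNumber k))) - 1) = 0 := by
      rw [map_sub, h3, map_one, sub_self]
    obtain ⟨k1, k2⟩ := key σ (F - 1) h1 hG
    refine ⟨σ, F - 1, h1, sub_mem h2 one_mem_homDeg, hG, ?_, ?_⟩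
    · intro b hb
      have := k1 b
      rw [← hF, h4 b hb] at this
      rw [this, add_sub_cancel_left]
    · rw [← hF, h5, sub_self] at k2
      exact (sub_eq_zero.1 k2.symm)
  · rintro ⟨σ, G, h1, h2, h3, h4, h5⟩
    obtain ⟨k1, k2⟩ := key σ G h1 h3
    have hGG := dual_matrix_mul_eq_zero h3 h3
    refine ⟨σ, ⟨1 + G, 1 - G, ?_, ?_⟩, h1, add_mem one_mem_homDeg h2, ?_, ?_, ?_⟩
    · have : (1 + G) * (1 - G) = 1 - G * G := by noncomm_ring
      rw [this, hGG, sub_zero]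
    · have : (1 - G) * (1 + G) = 1 - G * G := by noncomm_ring
      rw [this, hGG, sub_zero]
    · change (red n _).mapMatrix (1 + G) = 1
      rw [map_add, h3, add_zero, map_one]
    · intro b hb
      change (1 + G).transpose * _ * (1 + G) = _
      rw [k1, h4 b hb, add_sub_cancel]
    · change (1 + G) * _ = _ * (1 + G)
      rw [← sub_eq_zero, k2, h5, sub_self]

theorem Deformation.add_congr {N₁ N₂ N₁' N₂' : Deformation M β (DualNumber k)}
    (h₁ : N₁.Equivalent N₁') (h₂ : N₂.Equivalent N₂') :
    (N₁.add N₂).Equivalent (N₁'.add N₂') := by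
  rw [equivalent_iff_linear] at h₁ h₂ ⊢
  obtain ⟨σ, G, a1, a2, a3, a4, a5⟩ := h₁
  obtain ⟨τ, H, b1, b2, b3, b4, b5⟩ := h₂
  have hst : ∀ X : Mat d (PS n (DualNumber k)), (σ.trans τ).mapMatrix X - X =
      (σ.mapMatrix X - X) + (τ.mapMatrix X - X) := by
    intro X
    have h1 : τ.mapMatrix (σ.mapMatrix X - X) = σ.mapMatrix X - X := by
      apply dual_fix_mat b1
      rw [map_sub, red_mapMatrix_congr a1, sub_self]
    rw [map_sub] at h1
    change τ.mapMatrix (σ.mapMatrix X) - X = _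
    rw [← h1]
    abel
  refine ⟨σ.trans τ, G + H, fun f => by simp [a1, b1], add_mem a2 b2, by rw [map_add, a3, b3, add_zero],
    ?_, ?_⟩
  · intro b hb
    rw [hst, ← a4 b hb, ← b4 b hb, Matrix.transpose_add]
    noncomm_ring
  · rw [hst]
    change N₁.Q + (N₂.Q - Q0 M) + _ + _ = N₁'.Q + (N₂'.Q - Q0 M) + _
    have h3 : N₁.Q + (N₂.Q - Q0 M) + ((σ.mapMatrix (Q0 M) - Q0 M) + (τ.mapMatrix (Q0 M) - Q0 M)) +
        (G + H) * Q0 M = (N₁.Q + (σ.mapMatrix (Q0 M) - Q0 M) + G * Q0 M) +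
        (N₂.Q + (τ.mapMatrix (Q0 M) - Q0 M) + H * Q0 M) - Q0 M := by
      rw [add_mul]
      abel
    rw [h3, a5, b5, mul_add]
    abel

theorem Deformation.smul_congr (c : k) {N N' : Deformation M β (DualNumber k)}
    (h : N.Equivalent N') : (N.smul c).Equivalent (N'.smul c) := by
  rw [equivalent_iff_linear] at h ⊢
  obtain ⟨σ, G, a1, a2, a3, a4, a5⟩ := h
  have hst : ∀ X : Mat d (PS n (DualNumber k)), (scale c σ a1).mapMatrix X - X =
      c • (σ.mapMatrix X - X) := by
    intro X
    rw [sub_eq_iff_eq_add']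
    ext1 a b
    rfl
  refine ⟨scale c σ a1, c • G, ?_, smulk_mem c a2, red_mat_smul c _ a3, ?_, ?_⟩
  · intro f
    change red n _ (f + c • (σ f - f)) = _
    rw [map_add, red_smul c, add_zero]
    rw [map_sub, a1, sub_self]
  · intro b hb
    rw [hst, ← a4 b hb, Matrix.transpose_smul, smul_mul_assoc, mul_smul_comm, smul_add]
  · rw [hst]
    change Q0 M + c • (N.Q - Q0 M) + _ + _ = Q0 M + c • (N'.Q - Q0 M) + _
    rw [smul_mul_assoc, mul_smul_comm, add_assoc, add_assoc, add_assoc, ← smul_add, ← smul_add, ← smul_add]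
    congr 2
    rw [← sub_eq_zero]
    rw [← sub_eq_zero] at a5
    rw [← a5]
    abel

/-- The tangent space `Def(k[ε])` of the deformation functor. -/
abbrev Tangent (M : MatrixFactorization w d) (β : Option (BilinearStructure M)) :=
  Def M β (DualNumber k)

instance : Zero (Tangent M β) := ⟨(Deformation.trivial M β (DualNumber k)).cls⟩

instance : Add (Tangent M β) :=
  ⟨Quotient.map₂ Deformation.add fun _ _ h₁ _ _ h₂ => Deformation.add_congr h₁ h₂⟩

instance : SMul k (Tangent M β) :=
  ⟨fun c => Quotient.map (Deformation.smul c) fun _ _ h => Deformation.smul_congr c h⟩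

instance : Neg (Tangent M β) := ⟨fun x => (-1 : k) • x⟩

instance : AddCommGroup (Tangent M β) where
  add_assoc x y z := by
    induction x, y, z using Quotient.inductionOn₃ with | _ N₁ N₂ N₃ =>
    refine congrArg (Quotient.mk _) (Deformation.ext ?_)
    change N₁.Q + (N₂.Q - Q0 M) + (N₃.Q - Q0 M) = N₁.Q + ((N₂.Q + (N₃.Q - Q0 M)) - Q0 M)
    abel
  zero_add x := by
    induction x using Quotient.inductionOn with | _ N =>
    refine congrArg (Quotient.mk _) (Deformation.ext ?_)
    change Q0 M + (N.Q - Q0 M) = N.Q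
    abel
  add_zero x := by
    induction x using Quotient.inductionOn with | _ N =>
    refine congrArg (Quotient.mk _) (Deformation.ext ?_)
    change N.Q + (Q0 M - Q0 M) = N.Q
    abel
  nsmul := nsmulRec
  zsmul := zsmulRec
  neg_add_cancel x := by
    induction x using Quotient.inductionOn with | _ N =>
    refine congrArg (Quotient.mk _) (Deformation.ext ?_)
    change (Q0 M + (-1 : k) • (N.Q - Q0 M)) + (N.Q - Q0 M) = Q0 M
    rw [neg_one_smul]
    abel
  add_comm x y := by
    induction x, y using Quotient.inductionOn₂ with | _ N₁ N₂ =>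
    refine congrArg (Quotient.mk _) (Deformation.ext ?_)
    change N₁.Q + (N₂.Q - Q0 M) = N₂.Q + (N₁.Q - Q0 M)
    abel

instance : Module k (Tangent M β) where
  one_smul x := by
    induction x using Quotient.inductionOn with | _ N =>
    refine congrArg (Quotient.mk _) (Deformation.ext ?_)
    change Q0 M + (1 : k) • (N.Q - Q0 M) = N.Q
    rw [one_smul]
    abel
  mul_smul c e x := by
    induction x using Quotient.inductionOn with | _ N =>
    refine congrArg (Quotient.mk _) (Deformation.ext ?_)
    change Q0 M + (c * e) • (N.Q - Q0 M) =
      Q0 M + c • ((Q0 M + e • (N.Q - Q0 M)) - Q0 M)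
    rw [mul_smul, add_sub_cancel_left]
  smul_zero c := by
    refine congrArg (Quotient.mk _) (Deformation.ext ?_)
    change Q0 M + c • (Q0 M - Q0 M) = Q0 M
    rw [sub_self, smul_zero, add_zero]
  smul_add c x y := by
    induction x, y using Quotient.inductionOn₂ with | _ N₁ N₂ =>
    refine congrArg (Quotient.mk _) (Deformation.ext ?_)
    change Q0 M + c • ((N₁.Q + (N₂.Q - Q0 M)) - Q0 M) =
      (Q0 M + c • (N₁.Q - Q0 M)) + ((Q0 M + c • (N₂.Q - Q0 M)) - Q0 M)
    simp only [smul_sub, smul_add]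
    abel
  add_smul c e x := by
    induction x using Quotient.inductionOn with | _ N =>
    refine congrArg (Quotient.mk _) (Deformation.ext ?_)
    change Q0 M + (c + e) • (N.Q - Q0 M) =
      (Q0 M + c • (N.Q - Q0 M)) + ((Q0 M + e • (N.Q - Q0 M)) - Q0 M)
    rw [add_smul]
    abel
  zero_smul x := by
    induction x using Quotient.inductionOn with | _ N =>
    refine congrArg (Quotient.mk _) (Deformation.ext ?_)
    change Q0 M + (0 : k) • (N.Q - Q0 M) = Q0 M
    rw [zero_smul, add_zero]

/-! Duality and adjunction on the tangent space -/

theorem dual_aux {R : Type*} [Monoid R] (B F S : Rˣ) {X Y : R} (h : (F : R) * X = Y * F) :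
    ((B⁻¹ * F * S : Rˣ) : R) * (((S⁻¹ : Rˣ) : R) * X * S) =
      (((B⁻¹ : Rˣ) : R) * Y * B) * ((B⁻¹ * F * S : Rˣ) : R) := by
  simp only [Units.val_mul, mul_assoc, Units.mul_inv_cancel_left]
  rw [← mul_assoc (F : R), h, mul_assoc]

theorem Deformation.dual_congr (b : BilinearStructure M) {A : Type*} [CommRing A] [Algebra k A]
    [IsLocalRing A] {N₁ N₂ : Deformation M none A} (h : N₁.Equivalent N₂) :
    (N₁.dual b).Equivalent (N₂.dual b) := by
  obtain ⟨σ, F, h1, h2, h3, -, h5⟩ := h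
  set B := b.formOver A with hB
  have hBd : (B : Mat d (PS n A)) ∈ homDeg d (PS n A) b.kind.degree :=
    map_mem_homDeg (const n A) b.homogeneous
  let FT : (Mat d (PS n A))ˣ :=
    ⟨((F⁻¹ : (Mat d (PS n A))ˣ) : Mat d (PS n A)).transpose, (F : Mat d (PS n A)).transpose,
      by rw [← Matrix.transpose_mul, Units.mul_inv, Matrix.transpose_one],
      by rw [← Matrix.transpose_mul, Units.inv_mul, Matrix.transpose_one]⟩
  have hFT : (FT : Mat d (PS n A)) =
    ((F⁻¹ : (Mat d (PS n A))ˣ) : Mat d (PS n A)).transpose := rfl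
  let σB : (Mat d (PS n A))ˣ := mapUnit (σ : PS n A →+* PS n A) B
  have hσB : (σB : Mat d (PS n A)) = σ.mapMatrix (B : Mat d (PS n A)) := rfl
  refine ⟨σ, B⁻¹ * FT * σB, h1, ?_, ?_, by simp, ?_⟩
  · have e := mul_mem_homDeg (mul_mem_homDeg (inv_mem_homDeg hBd)
      (transpose_mem_homDeg (inv_mem_homDeg h2))) (map_mem_homDeg (σ : PS n A →+* PS n A) hBd)
    have e0 : b.kind.degree + 0 + b.kind.degree = 0 := by
      generalize b.kind.degree = x
      revert x
      decide
    rw [e0] at e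
    exact e
  · have e1 : (red n A).mapMatrix (FT : Mat d (PS n A)) = 1 := by
      have e2 := congrArg (red n A).mapMatrix F.inv_mul
      rw [map_mul, h3, mul_one, map_one] at e2
      change ((red n A).mapMatrix ((F⁻¹ : (Mat d (PS n A))ˣ) : Mat d (PS n A))).transpose = 1
      rw [e2, Matrix.transpose_one]
    rw [Units.val_mul, Units.val_mul, map_mul, map_mul, e1, mul_one, hσB, red_mapMatrix_congr h1,
      ← map_mul, Units.inv_mul, map_one]
  · have e3 : σ.mapMatrix (adj B N₁.Q) = adj σB (σ.mapMatrix N₁.Q) :=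
      (adj_map (σ : PS n A →+* PS n A) B N₁.Q).symm
    have e4 : (FT : Mat d (PS n A)) * (σ.mapMatrix N₁.Q).transpose =
        N₂.Q.transpose * (FT : Mat d (PS n A)) := by
      rw [hFT, ← Matrix.transpose_mul, ← Matrix.transpose_mul]
      congr 1
      calc σ.mapMatrix N₁.Q * ((F⁻¹ : (Mat d (PS n A))ˣ) : Mat d (PS n A)) =
          ((F⁻¹ : (Mat d (PS n A))ˣ) : Mat d (PS n A)) * ((F : Mat d (PS n A)) *
            σ.mapMatrix N₁.Q) * ((F⁻¹ : (Mat d (PS n A))ˣ) : Mat d (PS n A)) := by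
            rw [← mul_assoc, Units.inv_mul, one_mul]
        _ = _ := by rw [h5, mul_assoc, mul_assoc, Units.mul_inv, mul_one]
    change ((B⁻¹ * FT * σB : (Mat d (PS n A))ˣ) : Mat d (PS n A)) *
      σ.mapMatrix (b.kind.sign • adj B N₁.Q) = (b.kind.sign • adj B N₂.Q) *
      ((B⁻¹ * FT * σB : (Mat d (PS n A))ˣ) : Mat d (PS n A))
    rw [map_zsmul, mul_smul_comm, smul_mul_assoc, e3]
    exact congrArg (b.kind.sign • ·) (dual_aux B FT σB e4)

/-- The adjoint `Q + ε Q₁^adj` of a first order deformation `Q + ε Q₁`. -/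
def Deformation.firstOrderAdj (b : BilinearStructure M) (N : Deformation M none (DualNumber k)) :
    Deformation M none (DualNumber k) :=
  (N.dual b).smul (b.kind.sign : k)

theorem Deformation.firstOrderAdj_Q (b : BilinearStructure M)
    (N : Deformation M none (DualNumber k)) :
    (N.firstOrderAdj b).Q = Q0 M + adj (b.formOver (DualNumber k)) (N.Q - Q0 M) := by
  change Q0 M + (b.kind.sign : k) • (b.kind.sign • adj (b.formOver (DualNumber k)) N.Q - Q0 M) = _
  rw [adj_sub', Q0_adj, Int.cast_smul_eq_zsmul, smul_sub, smul_smul, b.kind.sign_mul_self, one_smul]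

/-- The adjunction `[Q₁] ↦ [Q₁^adj]` on the tangent space of the deformation functor of `M`. -/
def tangentAdj (b : BilinearStructure M) : Tangent M none →ₗ[k] Tangent M none where
  toFun := Quotient.map (Deformation.firstOrderAdj b) fun _ _ h =>
    Deformation.smul_congr _ (Deformation.dual_congr b h)
  map_add' x y := by
    induction x, y using Quotient.inductionOn₂ with | _ N₁ N₂ =>
    refine congrArg (Quotient.mk _) (Deformation.ext ?_)
    change ((N₁.add N₂).firstOrderAdj b).Q =
      (N₁.firstOrderAdj b).Q + ((N₂.firstOrderAdj b).Q - Q0 M)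
    rw [Deformation.firstOrderAdj_Q, Deformation.firstOrderAdj_Q, Deformation.firstOrderAdj_Q]
    change Q0 M + adj _ (N₁.Q + (N₂.Q - Q0 M) - Q0 M) = _
    rw [add_sub_cancel_left, add_assoc, ← adj_add']
    congr 2
    abel
  map_smul' c x := by
    induction x using Quotient.inductionOn with | _ N =>
    refine congrArg (Quotient.mk _) (Deformation.ext ?_)
    change ((N.smul c).firstOrderAdj b).Q = Q0 M + c • ((N.firstOrderAdj b).Q - Q0 M)
    rw [Deformation.firstOrderAdj_Q, Deformation.firstOrderAdj_Q]
    change Q0 M + adj _ (Q0 M + c • (N.Q - Q0 M) - Q0 M) = _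
    rw [add_sub_cancel_left, add_sub_cancel_left, adj_smulk]

/-- The part of the tangent space `t_M` on which the adjunction is multiplication by `s`. -/
def tangentPart (b : BilinearStructure M) (s : ℤ) : Submodule k (Tangent M none) :=
  LinearMap.ker (tangentAdj b - s • LinearMap.id)

/-- The map `t_{M,b} → t_M` forgetting the bilinear structure. -/
def tangentForget (b : BilinearStructure M) : Tangent M (some b) →ₗ[k] Tangent M none where
  toFun := Quotient.map Deformation.forget fun _ _ ⟨σ, F, h1, h2, h3, _, h5⟩ =>
    ⟨σ, F, h1, h2, h3, by simp, h5⟩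
  map_add' x y := by
    induction x, y using Quotient.inductionOn₂ with | _ N₁ N₂ => rfl
  map_smul' c x := by
    induction x using Quotient.inductionOn with | _ N => rfl

end tangent

/-! ### Versal hulls and small extensions -/

/-- The deformation functor has a versal hull: there are a complete local Noetherian `k`-algebra
`S` with residue field `k` and a deformation `ξ` over `S` such that `u ↦ u_* ξ` is bijective on
`k[ε]`-points and smooth, i.e. has the lifting property with respect to all surjections `A' → A` of
Artinian local `k`-algebras with residue field `k`. -/
def HasVersalHull (M : MatrixFactorization w d) (β : Option (BilinearStructure M)) : Prop :=
  ∃ (S : Type u) (_ : CommRing S) (_ : Algebra k S) (_ : IsCoeffRing k S)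
    (_ : IsNoetherianRing S) (_ : IsAdicComplete (maximalIdeal S) S) (ξ : Deformation M β S),
    (Function.Bijective fun u : S →ₐ[k] DualNumber k => (ξ.map u).cls) ∧
    ∀ (A' A : Type u) [CommRing A'] [CommRing A] [Algebra k A'] [Algebra k A]
      [IsCoeffRing k A'] [IsCoeffRing k A] [IsArtinianRing A'] [IsArtinianRing A]
      (p : A' →ₐ[k] A), Function.Surjective p →
      ∀ (u : S →ₐ[k] A) (N : Deformation M β A'), (N.map p).cls = (ξ.map u).cls →
        ∃ u' : S →ₐ[k] A', p.comp u' = u ∧ (ξ.map u').cls = N.cls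

/-- `Q'` is an odd lift to `A'` of the operator of `N` with `Q'^adj = s Q'`, `ω` is a lift of the
potential of `N`, and `Q' ^ 2 - ω = ∑ ηᵢ fᵢ` with `ηᵢ ∈ ker p` and degree `0` cocycles `fᵢ` whose
classes `eᵢ` are selfadjoint. -/
structure IsDefect (b : BilinearStructure M) {A' A : Type u} [CommRing A'] [CommRing A]
    [Algebra k A'] [Algebra k A] [IsLocalRing A] (p : A' →ₐ[k] A)
    (N : Deformation M (some b) A) (Q' : Mat d (PS n A')) (ω : PS n A') {m : ℕ}
    (η : Fin m → RingHom.ker p) (f : Fin m → M.Z 0) (e : Fin m → b.extPart 0 1) : Prop where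
  odd : Q' ∈ homDeg d (PS n A') 1
  adj_eq : adj (b.formOver A') Q' = b.kind.sign • Q'
  lift_Q : (MvPowerSeries.map (p : A' →+* A)).mapMatrix Q' = N.Q
  lift_potential : N.Q * N.Q = MvPowerSeries.map (p : A' →+* A) ω • (1 : Mat d (PS n A))
  defect : Q' * Q' - ω • (1 : Mat d (PS n A')) =
    ∑ i, (η i : A') • (const n A').mapMatrix (f i : Mat d (PS n k))
  class_eq : ∀ i, (e i : M.Ext 0) = M.cls (f i)

/-- The map `ob` computes the obstructions to lifting deformations of `(M, b)` along a
surjection `p : A' → A`, with values in `coker (R / I → Ext^0(M, M)^+) ⊗ ker p`.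

Any deformation `N` over `A` has a lift `Q'` of its operator to `A'` which is odd and satisfies
`Q'^adj = s Q'`; for a lift `ω` of the potential, the defect `Q' ^ 2 - ω` can be written as
`∑ ηᵢ fᵢ` with `ηᵢ ∈ ker p` and cocycles `fᵢ` of degree `0` with selfadjoint classes; the
obstruction is `∑ [fᵢ] ⊗ ηᵢ` for any such choices, and it vanishes if and only if `N` lifts
to a deformation over `A'`. -/
def IsObstructionMap (b : BilinearStructure M) {A' A : Type u} [CommRing A'] [CommRing A]
    [Algebra k A'] [Algebra k A] [IsCoeffRing k A'] [IsCoeffRing k A] (p : A' →ₐ[k] A)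
    (ob : Def M (some b) A → b.ObstructionSpace ⊗[k] RingHom.ker p) : Prop :=
  ∀ N : Deformation M (some b) A,
    (∃ (Q' : Mat d (PS n A')) (ω : PS n A') (m : ℕ) (η : Fin m → RingHom.ker p)
      (f : Fin m → M.Z 0) (e : Fin m → b.extPart 0 1), IsDefect b p N Q' ω η f e) ∧
    (∀ (Q' : Mat d (PS n A')) (ω : PS n A') (m : ℕ) (η : Fin m → RingHom.ker p)
      (f : Fin m → M.Z 0) (e : Fin m → b.extPart 0 1), IsDefect b p N Q' ω η f e →
      ob N.cls = ∑ i, Submodule.Quotient.mk (e i) ⊗ₜ[k] η i) ∧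
    (ob N.cls = 0 ↔ ∃ N' : Deformation M (some b) A', (N'.map p).cls = N.cls)

end deformations

end

end MF

open MF

namespace MF

noncomputable section

/-! ### Power series: order, Krull separation, continuity of ring maps -/

section powerSeries

/-! Three mechanisms carry the proof: averaging over the adjunction (2 is invertible), triviality of
the relations between the partial derivatives of `w`, and a formal power series solution of the
deformation equation.

Tangent space. A first order deformation is `Q + ε f` with `f` odd, `f^adj = s f` and `Q f + f Q = h
· 1`. An infinitesimal gauge transformation is a vector field `v` with an even matrix `G`; it moves
`f` by `v(Q) + [G, Q]`. It preserves the form exactly when it is fixed by the involution `(v, G) ↦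
(v, b⁻¹ v(b) - G^adj)`, and this involution induces `f ↦ s f^adj` on the displacements
(`adj_infAct`). Averaging a gauge transformation with its dual shows that an `f` with `f^adj = s f`
that is trivial without the form is trivial with it. Averaging `f` itself shows that the whole part
of `t_M` where the adjunction is `s` is attained.

Exact sequence. The projection sends `f` to its potential `h`, which gauge transformations change by
`v(w)`, an arbitrary element of `(∂w)`. The delicate point is injectivity on `Ext¹`: if `v(Q) + [G,
Q]` is a cocycle then `v(w) = 0`, and `v(Q)` has to be a coboundary. For a prime `P` containing
`(∂w)`, every `k`-derivation of the fraction field of `R/P` kills the image of `w` by the chain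
rule, so that image is algebraic over `k`, hence a constant, hence zero. So `w` is nilpotent modulo
`(∂w)`, powers of all variables lie in `(∂w)` (`exists_X_pow_mem_jacobianIdeal`), and all relations
between the `∂ᵢw` are Koszul relations (`mem_koszulRel`). The relation `x(w) y - y(w) x` acts on `Q`
as the commutator of `Q` with `x(Q) y(Q)` (`exists_matD_eq_commutator`).

Obstructions. Along a small extension an operator lifts compatibly with the form, again by
averaging. The defect `Q'² - ω'` has entries in `J`, is selfadjoint and commutes with `Q'`, so its
coordinates are selfadjoint even cocycles. Other choices change it by scalars and coboundaries.
Isometric gauge transformations lift (`IsGauge.exists_lift`) and act trivially on `J`, so the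
obstruction depends only on the class of the deformation.

Versal hull. Let `t₁, …, tᵣ` be coordinates on the finite dimensional tangent space. Even
selfadjoint matrices split into coboundaries, scalars, finitely many cocycles `c_j` independent
modulo these, and a part determined by the commutator with `Q` (`exists_decomposition`). With `H`
the resulting homotopy, `Γ = ∑ tᵢ φᵢ - H(Γ²)` is solved monomial by monomial. The identity `[Q + Γ,
(Q + Γ)²] = 0` and Krull's theorem then give `(Q + Γ)² = ω + ∑ g_j c_j` modulo `𝔪 · (g)`
(`exists_formalSolution`), and the hull is `k[[t]]/(g)`. Lifting is checked on small extensions: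
independence of the `c_j` forces the `g_j` to vanish at a point over which a deformation exists, and
the remaining discrepancy is a tangent vector, absorbed by moving the point. -/

open MvPowerSeries in
theorem coeff_eq_zero_of_mem_span_X_pow {r : ℕ} {A : Type*} [CommRing A] {N : ℕ}
    {f : MvPowerSeries (Fin r) A}
    (hf : f ∈ (Ideal.span (Set.range X) : Ideal (MvPowerSeries (Fin r) A)) ^ N)
    {m : Fin r →₀ ℕ} (hm : m.degree < N) : coeff m f = 0 := by
  have key : ∀ N : ℕ, ∀ f ∈ (Ideal.span (Set.range X) : Ideal (MvPowerSeries (Fin r) A)) ^ N,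
      (N : ℕ∞) ≤ f.order := by
    intro N
    induction N with
    | zero => intro f _; simp
    | succ N ih =>
      intro f hf
      rw [pow_succ] at hf
      refine Submodule.mul_induction_on hf ?_ ?_
      · intro g hg h hh
        refine le_trans ?_ (le_order_mul)
        push_cast
        refine add_le_add (ih g hg) ?_
        rw [MvPowerSeries.one_le_order_iff_constCoeff_eq_zero]
        have h2 : (Ideal.span (Set.range X) : Ideal (MvPowerSeries (Fin r) A)) ≤
            RingHom.ker (constantCoeff (σ := Fin r) (R := A)) := by
          rw [Ideal.span_le]
          rintro _ ⟨i, rfl⟩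
          simp [RingHom.mem_ker]
        exact h2 hh
      · intro g h hg hh
        exact le_trans (le_min hg hh) (min_order_le_add)
  apply coeff_of_lt_order
  exact lt_of_lt_of_le (by exact_mod_cast hm) (key N f hf)

open MvPowerSeries in
-- The truncations of `f` form a Cauchy sequence for the ideal of the variables, for which the power
-- series ring is complete. The limit is congruent to the vanishing `N`-th truncation modulo the
-- `N`-th power, and it is `f`.
theorem mem_span_X_pow_of_coeff {r : ℕ} {A : Type*} [CommRing A] {N : ℕ}
    {f : MvPowerSeries (Fin r) A} (hf : ∀ m : Fin r →₀ ℕ, m.degree < N → coeff m f = 0) :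
    f ∈ (Ideal.span (Set.range X) : Ideal (MvPowerSeries (Fin r) A)) ^ N := by
  classical
  set I := (Ideal.span (Set.range X) : Ideal (MvPowerSeries (Fin r) A)) with hI
  have hmap : (MvPolynomial.idealOfVars (Fin r) A).map
      (MvPolynomial.coeToMvPowerSeries.ringHom (σ := Fin r) (R := A)) = I := by
    rw [MvPolynomial.idealOfVars, Ideal.map_span, ← Set.range_comp, hI]
    congr 2
    ext i
    simp
  have hpow : ∀ (l : ℕ) (p : MvPolynomial (Fin r) A), p ∈ MvPolynomial.idealOfVars (Fin r) A ^ l →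
      (p : MvPowerSeries (Fin r) A) ∈ I ^ l := by
    intro l p hp
    rw [← hmap, ← Ideal.map_pow]
    exact Ideal.mem_map_of_mem _ hp
  obtain ⟨L, hL⟩ := IsPrecomplete.prec (I := I) (M := MvPowerSeries (Fin r) A) inferInstance
    (f := fun l => (truncTotal l f : MvPowerSeries (Fin r) A)) (by
      intro m l hml
      rw [SModEq.sub_mem, smul_eq_mul, Ideal.mul_top]
      have := hpow m _ (truncTotal_sub_truncTotal_mem_pow_idealOfVars (le_refl m) hml f)
      have e := map_sub (MvPolynomial.coeToMvPowerSeries.ringHom (σ := Fin r) (R := A))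
        (truncTotal m f) (truncTotal l f)
      simp only [MvPolynomial.coeToMvPowerSeries.ringHom_apply] at e
      rwa [e] at this)
  -- The coefficient at `m` is settled modulo the power `m.degree + 1`, where limit and truncation
  -- agree.
  have hLf : L = f := by
    ext m
    have h1 := hL (m.degree + 1)
    rw [SModEq.sub_mem, smul_eq_mul, Ideal.mul_top] at h1
    have h2 := coeff_eq_zero_of_mem_span_X_pow h1 (Nat.lt_succ_self m.degree)
    rw [map_sub, MvPolynomial.coeff_coe, coeff_truncTotal _ (Nat.lt_succ_self _), sub_eq_zero] at h2
    exact h2.symm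
  have h1 := hL N
  rw [SModEq.sub_mem, smul_eq_mul, Ideal.mul_top, hLf] at h1
  have h2 : truncTotal N f = 0 := by
    ext m
    by_cases h : m.degree < N
    · rw [coeff_truncTotal _ h, hf m h]; rfl
    · rw [coeff_truncTotal_eq_zero _ (not_lt.1 h)]; rfl
  rw [h2] at h1
  simpa using h1

/-- A ring map from power series to a Noetherian local ring, sending the variables to the maximal
ideal, is determined by its values on constants and variables. -/
theorem powerSeries_hom_ext {r : ℕ} {A B : Type*} [CommRing A] [CommRing B] [IsLocalRing B]
    [IsNoetherianRing B] {φ ψ : MvPowerSeries (Fin r) A →+* B}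
    (hC : ∀ a, φ (MvPowerSeries.C a) = ψ (MvPowerSeries.C a))
    (hX : ∀ i, φ (MvPowerSeries.X i) = ψ (MvPowerSeries.X i))
    (hm : ∀ i, φ (MvPowerSeries.X i) ∈ maximalIdeal B) : φ = ψ := by
  classical
  ext f
  rw [← sub_eq_zero]
  -- By Krull's intersection theorem it suffices to compare modulo every power of the maximal ideal.
  refine IsHausdorff.haus (I := maximalIdeal B) (M := B) inferInstance _ fun N => ?_
  rw [SModEq.sub_mem, smul_eq_mul, Ideal.mul_top, sub_zero]
  have hpoly : ∀ p : MvPolynomial (Fin r) A,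
      φ (p : MvPowerSeries (Fin r) A) = ψ (p : MvPowerSeries (Fin r) A) := by
    intro p
    have : φ.comp MvPolynomial.coeToMvPowerSeries.ringHom =
        ψ.comp MvPolynomial.coeToMvPowerSeries.ringHom := by
      apply MvPolynomial.ringHom_ext
      · intro a; simpa using hC a
      · intro i; simpa using hX i
    exact RingHom.congr_fun this p
  -- The two maps agree on the polynomial truncation, and both send the tail into the `N`-th power
  -- of the maximal ideal.
  set T := (MvPowerSeries.truncTotal N f : MvPowerSeries (Fin r) A) with hT
  have hfT : f - T ∈ (Ideal.span (Set.range MvPowerSeries.X) :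
      Ideal (MvPowerSeries (Fin r) A)) ^ N := by
    apply mem_span_X_pow_of_coeff
    intro m hm
    rw [map_sub, hT, MvPolynomial.coeff_coe, MvPowerSeries.coeff_truncTotal _ hm, sub_self]
  have hle : ∀ χ : MvPowerSeries (Fin r) A →+* B,
      (∀ i, χ (MvPowerSeries.X i) ∈ maximalIdeal B) → χ (f - T) ∈ maximalIdeal B ^ N := by
    intro χ hχ
    have h1 : (Ideal.span (Set.range MvPowerSeries.X) :
      Ideal (MvPowerSeries (Fin r) A)).map χ ≤ maximalIdeal B := by
      rw [Ideal.map_span, Ideal.span_le]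
      rintro _ ⟨_, ⟨i, rfl⟩, rfl⟩
      exact hχ i
    have h2 := Ideal.mem_map_of_mem χ hfT
    rw [Ideal.map_pow] at h2
    exact Ideal.pow_right_mono h1 N h2
  have e : φ f - ψ f = φ (f - T) - ψ (f - T) := by
    rw [map_sub, map_sub, hpoly]
    ring
  rw [e]
  exact sub_mem (hle φ hm) (hle ψ fun i => by rw [← hX]; exact hm i)

/-- Evaluation of power series at nilpotent elements. -/
theorem exists_powerSeries_eval {r : ℕ} {k A : Type*} [CommRing k] [CommRing A] [Algebra k A]
    (a : Fin r → A) (ha : ∀ i, IsNilpotent (a i)) :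
    ∃ u : MvPowerSeries (Fin r) k →ₐ[k] A, ∀ i, u (MvPowerSeries.X i) = a i := by
  -- Evaluation is realized as substitution into power series in no variables, a ring isomorphic to
  -- `A`.
  have hs : MvPowerSeries.HasSubst (fun i => (MvPowerSeries.C (a i) : MvPowerSeries (Fin 0) A)) :=
    MvPowerSeries.hasSubst_of_constantCoeff_nilpotent fun i => by simpa using ha i
  refine ⟨((MvPowerSeries.isEmptyEquiv (Fin 0) A).toAlgHom.restrictScalars k).comp
    (MvPowerSeries.substAlgHom hs), fun i => ?_⟩
  change MvPowerSeries.isEmptyEquiv (Fin 0) A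
    (MvPowerSeries.substAlgHom hs (MvPowerSeries.X i)) = a i
  rw [MvPowerSeries.substAlgHom_X]
  simp

end powerSeries

/-! ### Power series and matrices with coefficients in an ideal -/

section ideals
variable {n d : ℕ} {A : Type*} [CommRing A]

/-- The ideal of power series with coefficients in `𝔞`. -/
def psIdeal (n : ℕ) {A : Type*} [CommRing A] (𝔞 : Ideal A) : Ideal (PS n A) where
  carrier := {f | ∀ m, MvPowerSeries.coeff m f ∈ 𝔞}
  add_mem' hf hg m := by
    rw [map_add]
    exact add_mem (hf m) (hg m)
  zero_mem' m := by
    rw [map_zero]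
    exact zero_mem _
  smul_mem' c f hf m := by
    classical
    rw [smul_eq_mul, MvPowerSeries.coeff_mul]
    exact sum_mem fun x _ => 𝔞.mul_mem_left _ (hf _)

theorem mem_psIdeal {𝔞 : Ideal A} {f : PS n A} :
    f ∈ psIdeal n 𝔞 ↔ ∀ m, MvPowerSeries.coeff m f ∈ 𝔞 := Iff.rfl

theorem psIdeal_mul_mem {𝔞 𝔟 : Ideal A} {f g : PS n A} (hf : f ∈ psIdeal n 𝔞)
    (hg : g ∈ psIdeal n 𝔟) : f * g ∈ psIdeal n (𝔞 * 𝔟) := by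
  classical
  intro m
  rw [MvPowerSeries.coeff_mul]
  exact sum_mem fun x _ => Ideal.mul_mem_mul (hf _) (hg _)

theorem mem_psIdeal_ker {A' : Type*} [CommRing A'] (u : A →+* A') (f : PS n A) :
    f ∈ psIdeal n (RingHom.ker u) ↔ MvPowerSeries.map u f = 0 := by
  rw [MvPowerSeries.ext_iff]
  simp [mem_psIdeal, RingHom.mem_ker, MvPowerSeries.coeff_map]

theorem mem_psIdeal_map {A' : Type*} [CommRing A'] (u : A →+* A') {𝔞 : Ideal A} {f : PS n A}
    (hf : f ∈ psIdeal n 𝔞) : MvPowerSeries.map u f ∈ psIdeal n (𝔞.map u) := by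
  intro m
  rw [MvPowerSeries.coeff_map]
  exact Ideal.mem_map_of_mem _ (hf m)

theorem mem_psIdeal_bot {f : PS n A} : f ∈ psIdeal n (⊥ : Ideal A) ↔ f = 0 := by
  rw [MvPowerSeries.ext_iff]
  simp [mem_psIdeal]

theorem psIdeal_mono {𝔞 𝔟 : Ideal A} (h : 𝔞 ≤ 𝔟) : psIdeal n 𝔞 ≤ psIdeal n 𝔟 :=
  fun _ hf m => h (hf m)

theorem psIdeal_smul_mem {𝔞 : Ideal A} {a : A} (ha : a ∈ 𝔞) (f : PS n A) :
    a • f ∈ psIdeal n 𝔞 := by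
  intro m
  rw [map_smul, smul_eq_mul]
  exact 𝔞.mul_mem_right _ ha

/-- The same finitely many generators serve every coefficient, so the multipliers can be chosen
coefficient by coefficient and assembled into series. For an ideal without a finite generating
family this device is not available. -/
theorem exists_of_mem_psIdeal_span {r : ℕ} {η : Fin r → A} {f : PS n A}
    (hf : f ∈ psIdeal n (Ideal.span (Set.range η))) :
    ∃ g : Fin r → PS n A, f = ∑ l, η l • g l := by
  have h : ∀ m, ∃ c : Fin r → A, ∑ l, c l * η l = MvPowerSeries.coeff m f := fun m =>
    (Ideal.mem_span_range_iff_exists_fun).1 (hf m)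
  choose c hc using h
  let g : Fin r → PS n A := fun l m => c m l
  refine ⟨g, ?_⟩
  ext m
  rw [map_sum, ← hc m]
  refine Finset.sum_congr rfl fun l _ => ?_
  rw [mul_comm]
  exact (map_smul (MvPowerSeries.coeff m) (η l) (g l)).symm

/-- The matrices whose entries have coefficients in `𝔞`. -/
def matIdeal (n d : ℕ) {A : Type*} [CommRing A] (𝔞 : Ideal A) :
    Submodule (PS n A) (Mat d (PS n A)) where
  carrier := {X | ∀ a b, X a b ∈ psIdeal n 𝔞}
  add_mem' hX hY a b := add_mem (hX a b) (hY a b)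
  zero_mem' _ _ := zero_mem (psIdeal n 𝔞)
  smul_mem' c _ hX a b := (psIdeal n 𝔞).mul_mem_left c (hX a b)

theorem mem_matIdeal {𝔞 : Ideal A} {X : Mat d (PS n A)} :
    X ∈ matIdeal n d 𝔞 ↔ ∀ a b, X a b ∈ psIdeal n 𝔞 := Iff.rfl

theorem matIdeal_mul_mem {𝔞 𝔟 : Ideal A} {X Y : Mat d (PS n A)} (hX : X ∈ matIdeal n d 𝔞)
    (hY : Y ∈ matIdeal n d 𝔟) : X * Y ∈ matIdeal n d (𝔞 * 𝔟) := by
  intro a b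
  rw [Matrix.mul_apply]
  exact sum_mem fun c _ => psIdeal_mul_mem (hX a c) (hY c b)

theorem mem_matIdeal_top (X : Mat d (PS n A)) : X ∈ matIdeal n d (⊤ : Ideal A) :=
  fun _ _ _ => trivial

theorem matIdeal_mul_left {𝔞 : Ideal A} (X : Mat d (PS n A)) {Y : Mat d (PS n A)}
    (hY : Y ∈ matIdeal n d 𝔞) : X * Y ∈ matIdeal n d 𝔞 := by
  have := matIdeal_mul_mem (mem_matIdeal_top X) hY
  rwa [Ideal.top_mul] at this

theorem matIdeal_mul_right {𝔞 : Ideal A} {X : Mat d (PS n A)} (Y : Mat d (PS n A))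
    (hX : X ∈ matIdeal n d 𝔞) : X * Y ∈ matIdeal n d 𝔞 := by
  have := matIdeal_mul_mem hX (mem_matIdeal_top Y)
  rwa [Ideal.mul_top] at this

theorem matIdeal_transpose {𝔞 : Ideal A} {X : Mat d (PS n A)} (hX : X ∈ matIdeal n d 𝔞) :
    X.transpose ∈ matIdeal n d 𝔞 := fun a b => hX b a

theorem matIdeal_mono {𝔞 𝔟 : Ideal A} (h : 𝔞 ≤ 𝔟) : matIdeal n d 𝔞 ≤ matIdeal n d 𝔟 :=
  fun _ hX a b => psIdeal_mono h (hX a b)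

theorem mem_matIdeal_ker {A' : Type*} [CommRing A'] (u : A →+* A') (X : Mat d (PS n A)) :
    X ∈ matIdeal n d (RingHom.ker u) ↔ (MvPowerSeries.map u).mapMatrix X = 0 := by
  rw [← Matrix.ext_iff, mem_matIdeal]
  exact forall₂_congr fun a b => mem_psIdeal_ker u (X a b)

theorem mem_matIdeal_map {A' : Type*} [CommRing A'] (u : A →+* A') {𝔞 : Ideal A}
    {X : Mat d (PS n A)} (hX : X ∈ matIdeal n d 𝔞) :
    (MvPowerSeries.map u).mapMatrix X ∈ matIdeal n d (𝔞.map u) :=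
  fun a b => mem_psIdeal_map u (hX a b)

theorem mem_matIdeal_bot {X : Mat d (PS n A)} : X ∈ matIdeal n d (⊥ : Ideal A) ↔ X = 0 := by
  rw [← Matrix.ext_iff, mem_matIdeal]
  exact forall₂_congr fun a b => mem_psIdeal_bot

theorem matIdeal_smul_mem {𝔞 : Ideal A} {a : A} (ha : a ∈ 𝔞) (X : Mat d (PS n A)) :
    a • X ∈ matIdeal n d 𝔞 := fun i j => psIdeal_smul_mem ha (X i j)

theorem smul_one_mem_matIdeal {𝔞 : Ideal A} {h : PS n A} (hh : h ∈ psIdeal n 𝔞) :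
    h • (1 : Mat d (PS n A)) ∈ matIdeal n d 𝔞 := by
  intro a b
  rw [Matrix.smul_apply, smul_eq_mul]
  exact Ideal.mul_mem_right _ _ hh

/-- The scalar is read off a diagonal entry, which exists because the rank is positive. -/
theorem smul_one_mem_matIdeal_iff (hd : 1 ≤ d) {𝔞 : Ideal A} {h : PS n A} :
    h • (1 : Mat d (PS n A)) ∈ matIdeal n d 𝔞 ↔ h ∈ psIdeal n 𝔞 := by
  refine ⟨fun H => ?_, smul_one_mem_matIdeal⟩
  have := H (Sum.inl ⟨0, hd⟩) (Sum.inl ⟨0, hd⟩)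
  rwa [Matrix.smul_apply, Matrix.one_apply_eq, smul_eq_mul, mul_one] at this

theorem exists_of_mem_matIdeal_span {r : ℕ} {η : Fin r → A} {X : Mat d (PS n A)}
    (hX : X ∈ matIdeal n d (Ideal.span (Set.range η))) :
    ∃ Y : Fin r → Mat d (PS n A), X = ∑ l, η l • Y l := by
  choose g hg using fun a b => exists_of_mem_psIdeal_span (hX a b)
  refine ⟨fun l => Matrix.of fun a b => g a b l, ?_⟩
  ext1 a b
  rw [Matrix.sum_apply, hg a b]
  rfl

theorem mem_matIdeal_maximalIdeal [IsLocalRing A] (X : Mat d (PS n A)) :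
    X ∈ matIdeal n d (maximalIdeal A) ↔ (red n A).mapMatrix X = 0 := by
  rw [red, ← mem_matIdeal_ker, IsLocalRing.ker_residue]

theorem mem_psIdeal_maximalIdeal [IsLocalRing A] (f : PS n A) :
    f ∈ psIdeal n (maximalIdeal A) ↔ red n A f = 0 := (red_eq_zero_iff f).symm

theorem exists_fin_span_eq [IsNoetherianRing A] (𝔞 : Ideal A) :
    ∃ (r : ℕ) (η : Fin r → A), Ideal.span (Set.range η) = 𝔞 :=
  Submodule.fg_iff_exists_fin_generating_family.1 (IsNoetherian.noetherian 𝔞)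

end ideals

/-! ### Infinitesimal automorphisms of power series rings -/

theorem derivation_sum_apply {R A M ι : Type*} [CommSemiring R] [CommSemiring A] [AddCommMonoid M]
    [Algebra R A] [Module A M] [Module R M] (s : Finset ι) (D : ι → Derivation R A M) (f : A) :
    (∑ i ∈ s, D i) f = ∑ i ∈ s, D i f := by
  have := map_sum (Derivation.coeFnAddMonoidHom (R := R) (A := A) (M := M)) D s
  have h := congrFun this f
  rwa [Finset.sum_apply] at h

section automorphisms
variable {n d : ℕ} {A : Type*} [CommRing A]

variable [IsLocalRing A]

/-- By `A`-linearity `φ` acts only on the series multiplying finitely many generators of `𝔞`, and it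
moves each of these by a series with coefficients in the maximal ideal. -/
theorem algHom_sub_mem_psIdeal [IsNoetherianRing A] {φ : PS n A →ₐ[A] PS n A}
    (hφ : ∀ f, red n A (φ f) = red n A f) {𝔞 : Ideal A} {f : PS n A} (hf : f ∈ psIdeal n 𝔞) :
    φ f - f ∈ psIdeal n (maximalIdeal A * 𝔞) := by
  obtain ⟨r, η, rfl⟩ := exists_fin_span_eq 𝔞
  obtain ⟨g, rfl⟩ := exists_of_mem_psIdeal_span hf
  rw [map_sum, ← Finset.sum_sub_distrib]
  refine sum_mem fun l _ => ?_
  rw [map_smul, ← smul_sub, MvPowerSeries.smul_eq_C_mul, mul_comm (MvPowerSeries.C (η l))]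
  refine psIdeal_mul_mem ?_ ?_
  · rw [mem_psIdeal_maximalIdeal, map_sub, hφ, sub_self]
  · rw [← mul_one (MvPowerSeries.C (η l)), ← MvPowerSeries.smul_eq_C_mul]
    exact psIdeal_smul_mem (Ideal.subset_span (Set.mem_range_self l)) _

/-- The difference `φ - 1` raises the filtration by powers of the maximal ideal, which is finite
over an Artinian ring: a kernel element lies in every step, and preimages are found by successive
approximation. -/
theorem algHom_bijective [IsArtinianRing A] {φ : PS n A →ₐ[A] PS n A}
    (hφ : ∀ f, red n A (φ f) = red n A f) : Function.Bijective φ := by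
  obtain ⟨e, he⟩ := (isArtinianRing_iff_isNilpotent_maximalIdeal A).1 inferInstance
  have h0 : ∀ f : PS n A, f ∈ psIdeal n (maximalIdeal A ^ e) → f = 0 := by
    intro f hf
    rwa [he, Ideal.zero_eq_bot, mem_psIdeal_bot] at hf
  constructor
  · rw [injective_iff_map_eq_zero]
    intro f hf
    apply h0
    have : ∀ q, f ∈ psIdeal n (maximalIdeal A ^ q) := by
      intro q
      induction q with
      | zero => rw [pow_zero, Ideal.one_eq_top]; exact fun _ => trivial
      | succ q ih =>
        have h := algHom_sub_mem_psIdeal hφ ih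
        rw [hf, zero_sub, neg_mem_iff] at h
        rwa [pow_succ']
    exact this e
  · intro g
    have : ∀ q, ∃ f, g - φ f ∈ psIdeal n (maximalIdeal A ^ q) := by
      intro q
      induction q with
      | zero => exact ⟨0, by rw [pow_zero, Ideal.one_eq_top]; exact fun _ => trivial⟩
      | succ q ih =>
        obtain ⟨f, hf⟩ := ih
        -- Adding the current error to the approximate preimage moves the new error one step deeper.
        refine ⟨f + (g - φ f), ?_⟩
        have h := algHom_sub_mem_psIdeal hφ hf
        rw [← neg_mem_iff, neg_sub] at h
        rw [pow_succ', map_add]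
        rwa [sub_sub] at h
    obtain ⟨f, hf⟩ := this e
    exact ⟨f, (sub_eq_zero.1 (h0 _ hf)).symm⟩

/-- An endomorphism reducing to the identity is an automorphism. -/
def autoOfRed [IsArtinianRing A] (φ : PS n A →ₐ[A] PS n A)
    (hφ : ∀ f, red n A (φ f) = red n A f) : PS n A ≃ₐ[A] PS n A :=
  AlgEquiv.ofBijective φ (algHom_bijective hφ)

theorem X_mem_maximalIdeal (i : Fin n) :
    (MvPowerSeries.X i : PS n A) ∈ maximalIdeal (PS n A) := by
  rw [mem_maximalIdeal, mem_nonunits_iff, MvPowerSeries.isUnit_iff_constantCoeff]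
  simp

theorem algEquiv_X_mem_maximalIdeal (σ : PS n A ≃ₐ[A] PS n A) (i : Fin n) :
    σ (MvPowerSeries.X i) ∈ maximalIdeal (PS n A) := by
  rw [mem_maximalIdeal, mem_nonunits_iff, MulEquiv.isUnit_map]
  exact (mem_maximalIdeal _).1 (X_mem_maximalIdeal i)

theorem autom_ext [IsNoetherianRing A] {σ τ : PS n A ≃ₐ[A] PS n A}
    (h : ∀ i, σ (MvPowerSeries.X i) = τ (MvPowerSeries.X i)) : σ = τ := by
  apply AlgEquiv.ext
  have := powerSeries_hom_ext (φ := (σ : PS n A →+* PS n A)) (ψ := (τ : PS n A →+* PS n A))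
    (fun a => by
      change σ (algebraMap A (PS n A) a) = τ (algebraMap A (PS n A) a)
      rw [AlgEquiv.commutes, AlgEquiv.commutes]) h (algEquiv_X_mem_maximalIdeal σ)
  exact fun f => RingHom.congr_fun this f

/-- Endomorphisms with prescribed values on the variables. -/
theorem exists_auto [IsArtinianRing A] (g : Fin n → PS n A)
    (hg : ∀ i, red n A (g i) = red n A (MvPowerSeries.X i)) :
    ∃ σ : PS n A ≃ₐ[A] PS n A, (∀ f, red n A (σ f) = red n A f) ∧
      ∀ i, σ (MvPowerSeries.X i) = g i := by
  -- Substitution makes sense because the constant terms lie in the maximal ideal, which is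
  -- nilpotent.
  have hs : MvPowerSeries.HasSubst g := by
    refine MvPowerSeries.hasSubst_of_constantCoeff_nilpotent fun i => ?_
    have h1 : g i - MvPowerSeries.X i ∈ psIdeal n (maximalIdeal A) := by
      rw [mem_psIdeal_maximalIdeal, map_sub, hg, sub_self]
    have h2 := h1 0
    rw [map_sub, MvPowerSeries.coeff_zero_eq_constantCoeff, MvPowerSeries.constantCoeff_X,
      sub_zero] at h2
    obtain ⟨e, he⟩ := (isArtinianRing_iff_isNilpotent_maximalIdeal A).1 inferInstance
    refine ⟨e, ?_⟩
    have := Ideal.pow_mem_pow h2 e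
    rwa [he] at this
  let φ : PS n A →ₐ[A] PS n A := MvPowerSeries.substAlgHom hs
  have hφX : ∀ i, φ (MvPowerSeries.X i) = g i := fun i => MvPowerSeries.substAlgHom_X hs i
  -- Both sides are ring maps to a Noetherian local ring, so agreement on constants and variables is
  -- enough.
  have hφ : ∀ f, red n A (φ f) = red n A f := by
    have := powerSeries_hom_ext (φ := (red n A).comp (φ : PS n A →+* PS n A)) (ψ := red n A)
      (fun a => by
        change red n A (φ (algebraMap A (PS n A) a)) = _
        rw [AlgHom.commutes]
        rfl)
      (fun i => by
        change red n A (φ _) = _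
        rw [hφX, hg])
      (fun i => by
        change red n A (φ _) ∈ _
        rw [hφX, hg, red, MvPowerSeries.map_X]
        exact X_mem_maximalIdeal i)
    exact fun f => RingHom.congr_fun this f
  exact ⟨autoOfRed φ hφ, hφ, hφX⟩

end automorphisms

/-! ### Lifting series, matrices and automorphisms along surjections -/

section lifting
variable {n d : ℕ}

theorem powerSeries_map_surjective {A A' : Type*} [CommRing A] [CommRing A'] {p : A' →+* A}
    (hp : Function.Surjective p) : Function.Surjective (MvPowerSeries.map (σ := Fin n) p) := by
  intro f
  choose g hg using hp
  let h : PS n A' := fun m => g (f m)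
  refine ⟨h, ?_⟩
  ext m
  rw [MvPowerSeries.coeff_map]
  exact hg _

theorem matrix_map_surjective {A A' : Type*} [CommRing A] [CommRing A'] {p : A' →+* A}
    (hp : Function.Surjective p) :
    Function.Surjective (RingHom.mapMatrix (m := Fin d ⊕ Fin d)
      (MvPowerSeries.map (σ := Fin n) p)) := by
  intro X
  choose g hg using powerSeries_map_surjective (n := n) hp
  exact ⟨Matrix.of fun a b => g (X a b), Matrix.ext fun a b => hg _⟩

theorem isLocalHom_of_surjective_local {A A' : Type*} [CommRing A] [CommRing A'] [IsLocalRing A]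
    [IsLocalRing A'] {p : A' →+* A} {a : A'} (ha : p a ∈ maximalIdeal A) : a ∈ maximalIdeal A' := by
  rw [mem_maximalIdeal, mem_nonunits_iff] at ha ⊢
  exact fun h => ha (h.map p)

variable {A A' : Type*} [CommRing A] [CommRing A'] [IsLocalRing A] [IsLocalRing A']

/-- Ring maps preserve units, so an element whose image is in the maximal ideal is itself in the
maximal ideal; this is applied to each coefficient of `f - g`. -/
theorem red_eq_of_map {p : A' →+* A} {f g : PS n A'}
    (h : red n A (MvPowerSeries.map p f) = red n A (MvPowerSeries.map p g)) :
    red n A' f = red n A' g := by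
  rw [← sub_eq_zero, ← map_sub, red_eq_zero_iff]
  rw [← sub_eq_zero, ← map_sub, ← map_sub, red_eq_zero_iff] at h
  intro m
  have := h m
  rw [MvPowerSeries.coeff_map] at this
  exact isLocalHom_of_surjective_local this

/-- Infinitesimal automorphisms lift along surjections of Artinian local rings. -/
theorem exists_auto_lift [IsArtinianRing A] [IsArtinianRing A'] {p : A' →+* A}
    (hp : Function.Surjective p) (σ : PS n A ≃ₐ[A] PS n A) (hσ : ∀ f, red n A (σ f) = red n A f) :
    ∃ σ' : PS n A' ≃ₐ[A'] PS n A', (∀ f, red n A' (σ' f) = red n A' f) ∧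
      ∀ f, MvPowerSeries.map p (σ' f) = σ (MvPowerSeries.map p f) := by
  choose g hg using fun i : Fin n =>
    powerSeries_map_surjective (n := n) hp (σ (MvPowerSeries.X i))
  obtain ⟨σ', h1, h2⟩ := exists_auto g fun i => red_eq_of_map (p := p) (by
    rw [hg, hσ, MvPowerSeries.map_X])
  refine ⟨σ', h1, ?_⟩
  have := powerSeries_hom_ext
    (φ := (MvPowerSeries.map p).comp (σ' : PS n A' →+* PS n A'))
    (ψ := (σ : PS n A →+* PS n A).comp (MvPowerSeries.map p))
    (fun a => by
      change MvPowerSeries.map p (σ' (algebraMap A' (PS n A') a)) = σ _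
      rw [AlgEquiv.commutes, MvPowerSeries.map_C]
      change MvPowerSeries.map p (MvPowerSeries.C a) = σ (algebraMap A (PS n A) (p a))
      rw [AlgEquiv.commutes, MvPowerSeries.map_C]
      rfl)
    (fun i => by
      change MvPowerSeries.map p (σ' (MvPowerSeries.X i)) = σ (MvPowerSeries.map p _)
      rw [h2, hg, MvPowerSeries.map_X])
    (fun i => by
      change MvPowerSeries.map p (σ' (MvPowerSeries.X i)) ∈ _
      rw [h2, hg]
      exact algEquiv_X_mem_maximalIdeal σ i)
  exact fun f => RingHom.congr_fun this f

end lifting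

/-! ### Derivations and first order automorphisms -/

section derivations
variable {k : Type*} [Field k] {n d : ℕ}

/-- The vector field `∑ vᵢ ∂ᵢ`. -/
def vf (v : Fin n → PS n k) : Derivation k (PS n k) (PS n k) :=
  ∑ i, v i • MvPowerSeries.pderiv k i

theorem vf_apply (v : Fin n → PS n k) (f : PS n k) :
    vf v f = ∑ i, v i * MvPowerSeries.pderiv k i f := by
  rw [vf, derivation_sum_apply]
  rfl

/-- The entrywise action of a vector field on matrices. -/
def matD (v : Fin n → PS n k) : Mat d (PS n k) →ₗ[k] Mat d (PS n k) :=
  (vf v : PS n k →ₗ[k] PS n k).mapMatrix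

theorem matD_apply (v : Fin n → PS n k) (X : Mat d (PS n k)) (a b : Fin d ⊕ Fin d) :
    matD v X a b = vf v (X a b) := rfl

theorem matD_mul (v : Fin n → PS n k) (X Y : Mat d (PS n k)) :
    matD v (X * Y) = matD v X * Y + X * matD v Y := by
  ext1 a b
  rw [Matrix.add_apply, matD_apply, Matrix.mul_apply, Matrix.mul_apply, Matrix.mul_apply, map_sum,
    ← Finset.sum_add_distrib]
  refine Finset.sum_congr rfl fun c _ => ?_
  rw [Derivation.leibniz, matD_apply, matD_apply, smul_eq_mul, smul_eq_mul, add_comm, mul_comm (Y c b)]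

theorem matD_one (v : Fin n → PS n k) : matD v (1 : Mat d (PS n k)) = 0 := by
  ext1 a b
  rw [matD_apply]
  by_cases h : a = b <;> simp [h, Matrix.one_apply]

theorem matD_transpose (v : Fin n → PS n k) (X : Mat d (PS n k)) :
    matD v X.transpose = (matD v X).transpose := rfl

theorem matD_smul_one (v : Fin n → PS n k) (f : PS n k) :
    matD v (f • (1 : Mat d (PS n k))) = vf v f • (1 : Mat d (PS n k)) := by
  ext1 a b
  rw [matD_apply, Matrix.smul_apply, Matrix.smul_apply]
  by_cases h : a = b <;> simp [h, Matrix.one_apply]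

theorem matD_mem_homDeg (v : Fin n → PS n k) {i : ZMod 2} {X : Mat d (PS n k)}
    (hX : X ∈ homDeg d (PS n k) i) : matD v X ∈ homDeg d (PS n k) i := by
  intro a b h
  rw [matD_apply, hX a b h, map_zero]

theorem matD_add_left (v v' : Fin n → PS n k) (X : Mat d (PS n k)) :
    matD (v + v') X = matD v X + matD v' X := by
  ext1 a b
  simp only [Matrix.add_apply, matD_apply, vf_apply, Pi.add_apply, add_mul, Finset.sum_add_distrib]

theorem matD_smul_left (c : k) (v : Fin n → PS n k) (X : Mat d (PS n k)) :
    matD (c • v) X = c • matD v X := by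
  ext1 a b
  simp only [Matrix.smul_apply, matD_apply, vf_apply, Pi.smul_apply, smul_mul_assoc,
    Finset.smul_sum]

theorem pderiv_const {A : Type*} [CommRing A] [Algebra k A] (i : Fin n) (f : PS n k) :
    MvPowerSeries.pderiv A i (const n A f) = const n A (MvPowerSeries.pderiv k i f) := by
  ext m
  rw [const, MvPowerSeries.coeff_pderiv, MvPowerSeries.coeff_map, MvPowerSeries.coeff_map,
    MvPowerSeries.coeff_pderiv, map_mul]
  simp

end derivations

section firstOrder
variable {n d : ℕ} {A : Type*} [CommRing A] [IsLocalRing A]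

theorem mul_mem_bot_of_small {J : Ideal A} (hJ : maximalIdeal A * J = ⊥) {f g : PS n A}
    (hf : f ∈ psIdeal n (maximalIdeal A)) (hg : g ∈ psIdeal n J) : f * g = 0 := by
  rw [← mem_psIdeal_bot, ← hJ]
  exact psIdeal_mul_mem hf hg

theorem matrix_mul_eq_zero_of_small {J : Ideal A} (hJ : maximalIdeal A * J = ⊥)
    {X Y : Mat d (PS n A)} (hX : X ∈ matIdeal n d (maximalIdeal A)) (hY : Y ∈ matIdeal n d J) :
    X * Y = 0 := by
  rw [← mem_matIdeal_bot, ← hJ]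
  exact matIdeal_mul_mem hX hY

theorem matrix_mul_eq_zero_of_small' {J : Ideal A} (hJ : maximalIdeal A * J = ⊥)
    {X Y : Mat d (PS n A)} (hX : X ∈ matIdeal n d J) (hY : Y ∈ matIdeal n d (maximalIdeal A)) :
    X * Y = 0 := by
  rw [← mem_matIdeal_bot, ← hJ, mul_comm]
  exact matIdeal_mul_mem hX hY

/-- The endomorphism `f ↦ f + ∑ δᵢ ∂ᵢ f`, for `δᵢ` with coefficients in `J`, `𝔪 J = 0`. -/
def firstOrderHom {J : Ideal A} (hJ : maximalIdeal A * J = ⊥) (hJm : J ≤ maximalIdeal A)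
    (δ : Fin n → PS n A) (hδ : ∀ i, δ i ∈ psIdeal n J) : PS n A →ₐ[A] PS n A :=
  AlgHom.ofLinearMap
    (LinearMap.id + ((∑ i, δ i • MvPowerSeries.pderiv A i : Derivation A (PS n A) (PS n A)) :
      PS n A →ₗ[A] PS n A)) (by simp) (by
      intro f g
      set D : Derivation A (PS n A) (PS n A) := ∑ i, δ i • MvPowerSeries.pderiv A i with hD
      have hDm : ∀ f, D f ∈ psIdeal n J := by
        intro f
        rw [hD, derivation_sum_apply]
        exact sum_mem fun i _ => Ideal.mul_mem_right _ _ (hδ i)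
      change f * g + D (f * g) = (f + D f) * (g + D g)
      rw [Derivation.leibniz, smul_eq_mul, smul_eq_mul]
      -- The only term violating multiplicativity is `D f * D g`, which lies in `J · J` and vanishes
      -- since `J ≤ 𝔪` and `𝔪 J = 0`.
      linear_combination - mul_mem_bot_of_small hJ (psIdeal_mono hJm (hDm f)) (hDm g))

theorem firstOrderHom_apply {J : Ideal A} (hJ : maximalIdeal A * J = ⊥) (hJm : J ≤ maximalIdeal A)
    (δ : Fin n → PS n A) (hδ : ∀ i, δ i ∈ psIdeal n J) (f : PS n A) :
    firstOrderHom hJ hJm δ hδ f = f + ∑ i, δ i * MvPowerSeries.pderiv A i f := by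
  change f + (∑ i, δ i • MvPowerSeries.pderiv A i : Derivation A (PS n A) (PS n A)) f = _
  rw [derivation_sum_apply]
  rfl

theorem red_firstOrderHom {J : Ideal A} (hJ : maximalIdeal A * J = ⊥) (hJm : J ≤ maximalIdeal A)
    (δ : Fin n → PS n A) (hδ : ∀ i, δ i ∈ psIdeal n J) (f : PS n A) :
    red n A (firstOrderHom hJ hJm δ hδ f) = red n A f := by
  rw [firstOrderHom_apply, map_add, add_eq_left, ← mem_psIdeal_maximalIdeal]
  exact sum_mem fun i _ => Ideal.mul_mem_right _ _ (psIdeal_mono hJm (hδ i))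

theorem exists_firstOrder_auto [IsArtinianRing A] {J : Ideal A} (hJ : maximalIdeal A * J = ⊥)
    (hJm : J ≤ maximalIdeal A) (δ : Fin n → PS n A) (hδ : ∀ i, δ i ∈ psIdeal n J) :
    ∃ σ : PS n A ≃ₐ[A] PS n A, (∀ f, red n A (σ f) = red n A f) ∧
      ∀ f, σ f = f + ∑ i, δ i * MvPowerSeries.pderiv A i f :=
  ⟨autoOfRed _ (red_firstOrderHom hJ hJm δ hδ), red_firstOrderHom hJ hJm δ hδ,
    firstOrderHom_apply hJ hJm δ hδ⟩

/-- A first order Taylor formula: the right side is also an automorphism, and it agrees with `σ` on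
the variables. -/
theorem auto_eq_firstOrder [IsArtinianRing A] {J : Ideal A} (hJ : maximalIdeal A * J = ⊥)
    (hJm : J ≤ maximalIdeal A) (σ : PS n A ≃ₐ[A] PS n A)
    (hσ : ∀ i, σ (MvPowerSeries.X i) - MvPowerSeries.X i ∈ psIdeal n J) (f : PS n A) :
    σ f = f + ∑ i, (σ (MvPowerSeries.X i) - MvPowerSeries.X i) *
      MvPowerSeries.pderiv A i f := by
  classical
  obtain ⟨τ, -, hτ⟩ := exists_firstOrder_auto hJ hJm _ hσ
  rw [← hτ]
  have : σ = τ := by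
    apply autom_ext
    intro i
    rw [hτ]
    simp [MvPowerSeries.pderiv_X, Pi.single_apply]
  rw [this]

end firstOrder

/-! ### Coordinates with respect to a basis of an ideal -/

section coordinates
variable {k A : Type*} [Field k] [CommRing A] [Algebra k A] {n d r : ℕ}

theorem coeff_sum_smul_const (η : Fin r → A) (f : Fin r → PS n k) (m : Fin n →₀ ℕ) :
    MvPowerSeries.coeff m (∑ l, η l • const n A (f l)) =
      ∑ l, MvPowerSeries.coeff m (f l) • η l := by
  rw [map_sum]
  refine Finset.sum_congr rfl fun l _ => ?_
  rw [map_smul, const, MvPowerSeries.coeff_map, smul_eq_mul, mul_comm, Algebra.smul_def]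

variable {J : Ideal A} (η : Module.Basis (Fin r) k J)

/-- A finite `k`-basis of `J` identifies the series with coefficients in `J` with `r`-tuples of
series over `k`. Equations over a small kernel thereby become equations over `k[[x]]`. -/
theorem exists_coord {f : PS n A} (hf : f ∈ psIdeal n J) :
    ∃ g : Fin r → PS n k, f = ∑ l, (η l : A) • const n A (g l) := by
  let g : Fin r → PS n k := fun l m => η.repr ⟨MvPowerSeries.coeff m f, hf m⟩ l
  refine ⟨g, ?_⟩
  ext m
  rw [coeff_sum_smul_const]
  have h := congrArg (Subtype.val) (η.sum_repr ⟨MvPowerSeries.coeff m f, hf m⟩)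
  refine h.symm.trans ?_
  rw [AddSubmonoidClass.coe_finsetSum]
  rfl

theorem coord_unique {g : Fin r → PS n k} (h : ∑ l, (η l : A) • const n A (g l) = 0) (l : Fin r) :
    g l = 0 := by
  ext m
  have h1 := congrArg (MvPowerSeries.coeff m) h
  rw [coeff_sum_smul_const, map_zero] at h1
  have h2 : ∑ l, MvPowerSeries.coeff m (g l) • η l = 0 := by
    apply Subtype.ext
    rw [AddSubmonoidClass.coe_finsetSum]
    exact h1
  rw [map_zero]
  exact Fintype.linearIndependent_iff.1 η.linearIndependent _ h2 l

theorem exists_matrix_coord {X : Mat d (PS n A)} (hX : X ∈ matIdeal n d J) :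
    ∃ x : Fin r → Mat d (PS n k), X = ∑ l, (η l : A) • (const n A).mapMatrix (x l) := by
  choose g hg using fun a b => exists_coord η (hX a b)
  refine ⟨fun l => Matrix.of fun a b => g a b l, ?_⟩
  ext1 a b
  rw [Matrix.sum_apply, hg a b]
  rfl

theorem matrix_coord_unique {x : Fin r → Mat d (PS n k)}
    (h : ∑ l, (η l : A) • (const n A).mapMatrix (x l) = 0) (l : Fin r) : x l = 0 := by
  ext1 a b
  have := congrFun (congrFun h a) b
  rw [Matrix.sum_apply] at this
  exact coord_unique η (g := fun l => x l a b) this l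

theorem matrix_coord_eq {x y : Fin r → Mat d (PS n k)}
    (h : ∑ l, (η l : A) • (const n A).mapMatrix (x l) =
      ∑ l, (η l : A) • (const n A).mapMatrix (y l)) (l : Fin r) : x l = y l := by
  rw [← sub_eq_zero, ← Finset.sum_sub_distrib] at h
  rw [← sub_eq_zero]
  refine matrix_coord_unique η (x := fun l => x l - y l) ?_ l
  rw [← h]
  refine Finset.sum_congr rfl fun l _ => ?_
  rw [map_sub, smul_sub]

theorem coord_homDeg {x : Fin r → Mat d (PS n k)} {i : ZMod 2}
    (h : ∑ l, (η l : A) • (const n A).mapMatrix (x l) ∈ homDeg d (PS n A) i) (l : Fin r) :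
    x l ∈ homDeg d (PS n k) i := by
  intro a b hab
  have := h a b hab
  rw [Matrix.sum_apply] at this
  exact coord_unique η (g := fun l => x l a b) this l

theorem const_smul_one (f : PS n k) :
    (const n A).mapMatrix (f • (1 : Mat d (PS n k))) = const n A f • (1 : Mat d (PS n A)) := by
  ext1 a b
  simp only [RingHom.mapMatrix_apply, Matrix.map_apply, Matrix.smul_apply, smul_eq_mul, map_mul]
  congr 1
  by_cases h : a = b <;> simp [h, Matrix.one_apply]

theorem const_smul (c : k) (x : Mat d (PS n k)) :
    (const n A).mapMatrix (c • x) = algebraMap k A c • (const n A).mapMatrix x := by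
  ext a b m
  simp only [RingHom.mapMatrix_apply, Matrix.map_apply, Matrix.smul_apply, const,
    MvPowerSeries.coeff_map, map_smul, smul_eq_mul, map_mul]

theorem sum_smul_mem_matIdeal {η : Fin r → A} {J : Ideal A} (hη : ∀ l, η l ∈ J)
    (X : Fin r → Mat d (PS n A)) : ∑ l, η l • X l ∈ matIdeal n d J :=
  sum_mem fun l _ => matIdeal_smul_mem (hη l) _

end coordinates

/-! ### Coefficient rings and small ideals -/

section coeffRing
variable {k A : Type*} [Field k] [CommRing A] [Algebra k A] {n d : ℕ}

theorem exists_const_sub_mem [IsCoeffRing k A] (a : A) :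
    ∃ c : k, a - algebraMap k A c ∈ maximalIdeal A := by
  obtain ⟨c, hc⟩ := (IsCoeffRing.bijective (k := k) (A := A)).2 (residue A a)
  refine ⟨c, ?_⟩
  rw [← residue_eq_zero_iff, map_sub, ← hc]
  exact sub_self _

theorem isCoeffRing_of_exists [IsLocalRing A]
    (h : ∀ a : A, ∃ c : k, a - algebraMap k A c ∈ maximalIdeal A) : IsCoeffRing k A where
  bijective := by
    refine ⟨RingHom.injective _, fun x => ?_⟩
    obtain ⟨a, rfl⟩ := residue_surjective x
    obtain ⟨c, hc⟩ := h a
    refine ⟨c, ?_⟩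
    rw [← residue_eq_zero_iff, map_sub, sub_eq_zero] at hc
    exact hc.symm

theorem isCoeffRing_of_surjective {A' : Type*} [CommRing A'] [Algebra k A'] [IsCoeffRing k A']
    [Nontrivial A] (p : A' →ₐ[k] A) (hp : Function.Surjective p) : IsCoeffRing k A := by
  have : IsLocalRing A := IsLocalRing.of_surjective' (p : A' →+* A) hp
  have : IsLocalHom (p : A' →+* A) := hp.isLocalHom (f := (p : A' →+* A))
  refine isCoeffRing_of_exists fun a => ?_
  obtain ⟨a', rfl⟩ := hp a
  obtain ⟨c, hc⟩ := exists_const_sub_mem (k := k) a'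
  refine ⟨c, ?_⟩
  rw [← AlgHom.commutes p, ← map_sub]
  have h2 := ((IsLocalRing.local_hom_TFAE (p : A' →+* A)).out 0 4).1 this
  rw [← h2] at hc
  exact hc

/-- An ideal killed by the maximal ideal of a Noetherian ring is finite dimensional. -/
theorem finite_of_small [IsCoeffRing k A] [IsNoetherianRing A] {J : Ideal A}
    (hJ : maximalIdeal A * J = ⊥) : Module.Finite k J := by
  obtain ⟨s, hs⟩ := IsNoetherian.noetherian (⊤ : Submodule A J)
  refine ⟨⟨s, ?_⟩⟩
  rw [eq_top_iff]
  rintro x -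
  have hx : x ∈ Submodule.span A (s : Set J) := hs ▸ Submodule.mem_top
  induction hx using Submodule.span_induction with
  | mem x hx => exact Submodule.subset_span hx
  | zero => exact zero_mem _
  | add x y _ _ hx hy => exact add_mem hx hy
  | smul a x _ hx =>
    obtain ⟨c, hc⟩ := exists_const_sub_mem (k := k) a
    -- Since `𝔪 J = 0`, an element acts on `J` through its residue class `c`.
    have : a • x = c • x := by
      apply Subtype.ext
      have h1 : (a - algebraMap k A c) * (x : A) ∈ maximalIdeal A * J :=
        Ideal.mul_mem_mul hc x.2
      rw [hJ, Ideal.mem_bot, sub_mul, sub_eq_zero] at h1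
      change a * (x : A) = c • (x : A)
      rw [h1, Algebra.smul_def]
    rw [this]
    exact Submodule.smul_mem _ _ hx

theorem ker_le_maximalIdeal {A' : Type*} [CommRing A'] [Algebra k A'] [IsLocalRing A']
    [Nontrivial A] (p : A' →ₐ[k] A) : RingHom.ker p ≤ maximalIdeal A' :=
  IsLocalRing.le_maximalIdeal (RingHom.ker_ne_top p)

theorem const_sub_mem_of_red [IsLocalRing A] {X : Mat d (PS n A)} {Y : Mat d (PS n A)}
    (h : (red n A).mapMatrix X = (red n A).mapMatrix Y) : X - Y ∈ matIdeal n d (maximalIdeal A) := by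
  rw [mem_matIdeal_maximalIdeal, map_sub, h, sub_self]

end coeffRing

/-! ### Gauge transformations -/

section forms
variable {k : Type u} [Field k] {n d : ℕ} {w : MvPolynomial (Fin n) k}
  {M : MatrixFactorization w d} (b : BilinearStructure M) {A : Type*} [CommRing A] [Algebra k A]

theorem formOver_transpose : (b.formOver A : Mat d (PS n A)).transpose =
    (b.kind.sign * (b.ε : ℤ)) • (b.formOver A : Mat d (PS n A)) := by
  change ((const n A).mapMatrix (b.form : Mat d (PS n k))).transpose = _ • (const n A).mapMatrix _
  rw [← map_zsmul, ← b.symm]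
  rfl

theorem sign_sq : (b.kind.sign * (b.ε : ℤ)) * (b.kind.sign * (b.ε : ℤ)) = 1 := by
  have h : (b.ε : ℤ) * (b.ε : ℤ) = 1 := Int.units_coe_mul_self _
  linear_combination (b.ε : ℤ) * (b.ε : ℤ) * b.kind.sign_mul_self + h

theorem formOver_mem : (b.formOver A : Mat d (PS n A)) ∈ homDeg d (PS n A) b.kind.degree :=
  map_mem_homDeg _ b.homogeneous

/-- Applying the adjunction twice conjugates by `B⁻¹ ᵗB`, which is the sign `z` because the form is
symmetric or antisymmetric. -/
theorem adj_adj {C : Type*} [CommRing C] (B : (Mat d C)ˣ) {z : ℤ} (hz : z * z = 1)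
    (hB : (B : Mat d C).transpose = z • (B : Mat d C)) (X : Mat d C) : adj B (adj B X) = X := by
  have h1 : ((B⁻¹ : (Mat d C)ˣ) : Mat d C).transpose * (B : Mat d C) = z • (1 : Mat d C) := by
    have h2 : (B : Mat d C) = z • (B : Mat d C).transpose := by rw [hB, smul_smul, hz, one_smul]
    rw [show ((B⁻¹ : (Mat d C)ˣ) : Mat d C).transpose * (B : Mat d C) =
      ((B⁻¹ : (Mat d C)ˣ) : Mat d C).transpose * (z • (B : Mat d C).transpose) by rw [← h2],
      mul_smul_comm, ← Matrix.transpose_mul, Units.mul_inv, Matrix.transpose_one]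
  have h3 : adj B (adj B X) = ((B⁻¹ : (Mat d C)ˣ) : Mat d C) * (B : Mat d C).transpose * X *
      (((B⁻¹ : (Mat d C)ˣ) : Mat d C).transpose * (B : Mat d C)) := by
    unfold adj
    simp only [Matrix.transpose_mul, Matrix.transpose_transpose, mul_assoc]
  rw [h3, h1, hB]
  simp only [mul_smul_comm, Units.inv_mul, smul_mul_assoc, one_mul, mul_one]
  rw [smul_smul, hz, one_smul]

theorem adj_adj_form (X : Mat d (PS n k)) : adj b.form (adj b.form X) = X :=
  adj_adj b.form (sign_sq b) b.symm X

theorem adj_adj_formOver (X : Mat d (PS n A)) : adj (b.formOver A) (adj (b.formOver A) X) = X :=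
  adj_adj (b.formOver A) (sign_sq b) (formOver_transpose b) X

theorem adj_smul_scalar {C : Type*} [CommRing C] [Algebra k C] (B : (Mat d C)ˣ) (c : k)
    (X : Mat d C) : adj B (c • X) = c • adj B X := by
  simp [adj]

theorem adj_add {C : Type*} [CommRing C] (B : (Mat d C)ˣ) (X Y : Mat d C) :
    adj B (X + Y) = adj B X + adj B Y := map_add (adjL B) X Y

theorem adj_sub {C : Type*} [CommRing C] (B : (Mat d C)ˣ) (X Y : Mat d C) :
    adj B (X - Y) = adj B X - adj B Y := map_sub (adjL B) X Y

theorem adj_zsmul {C : Type*} [CommRing C] (B : (Mat d C)ˣ) (z : ℤ) (X : Mat d C) :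
    adj B (z • X) = z • adj B X := map_zsmul (adjL B) z X

theorem adj_sum {C ι : Type*} [CommRing C] (B : (Mat d C)ˣ) (s : Finset ι) (X : ι → Mat d C) :
    adj B (∑ i ∈ s, X i) = ∑ i ∈ s, adj B (X i) := map_sum (adjL B) X s

theorem adj_smul_one {C : Type*} [CommRing C] (B : (Mat d C)ˣ) (f : C) :
    adj B (f • (1 : Mat d C)) = f • (1 : Mat d C) := by
  have := map_smul (adjL B) f 1
  change adj B _ = f • adj B 1 at this
  rw [this, adj_one]

theorem adj_const (x : Mat d (PS n k)) :
    adj (b.formOver A) ((const n A).mapMatrix x) = (const n A).mapMatrix (adj b.form x) :=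
  adj_map _ _ _

theorem adj_smul_const (a : A) (x : Mat d (PS n k)) :
    adj (b.formOver A) (a • (const n A).mapMatrix x) =
      a • (const n A).mapMatrix (adj b.form x) := by
  rw [← adj_const]
  simp [adj]

theorem adj_sum_smul_const {r : ℕ} (η : Fin r → A) (x : Fin r → Mat d (PS n k)) :
    adj (b.formOver A) (∑ l, η l • (const n A).mapMatrix (x l)) =
      ∑ l, η l • (const n A).mapMatrix (adj b.form (x l)) := by
  rw [adj_sum]
  exact Finset.sum_congr rfl fun l _ => adj_smul_const b _ _

theorem coord_adj {r : ℕ} {J : Ideal A} (η : Module.Basis (Fin r) k J)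
    {x : Fin r → Mat d (PS n k)} {z : ℤ}
    (h : adj (b.formOver A) (∑ l, (η l : A) • (const n A).mapMatrix (x l)) =
      z • ∑ l, (η l : A) • (const n A).mapMatrix (x l)) (l : Fin r) :
    adj b.form (x l) = z • x l := by
  rw [adj_sum_smul_const, Finset.smul_sum] at h
  refine matrix_coord_eq η (y := fun l => z • x l) (h.trans ?_) l
  refine Finset.sum_congr rfl fun l _ => ?_
  rw [map_zsmul, smul_comm]

end forms

/-! ### Isometric gauge transformations and their lifting -/

section gauge
variable {k : Type u} [Field k] {n d : ℕ} {w : MvPolynomial (Fin n) k}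
  {M : MatrixFactorization w d} (b : BilinearStructure M)
  {A : Type*} [CommRing A] [Algebra k A]

/-- The action of a gauge transformation on operators. -/
def gaugeAct (σ : PS n A ≃ₐ[A] PS n A) (F : (Mat d (PS n A))ˣ) (X : Mat d (PS n A)) :
    Mat d (PS n A) :=
  (F : Mat d (PS n A)) * σ.mapMatrix X * ((F⁻¹ : (Mat d (PS n A))ˣ) : Mat d (PS n A))

theorem gaugeAct_mul {σ : PS n A ≃ₐ[A] PS n A} {F : (Mat d (PS n A))ˣ} (X Y : Mat d (PS n A)) :
    gaugeAct σ F (X * Y) = gaugeAct σ F X * gaugeAct σ F Y := by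
  have : gaugeAct σ F X * gaugeAct σ F Y = (F : Mat d (PS n A)) * σ.mapMatrix X *
      (((F⁻¹ : (Mat d (PS n A))ˣ) : Mat d (PS n A)) * (F : Mat d (PS n A))) * σ.mapMatrix Y *
      ((F⁻¹ : (Mat d (PS n A))ˣ) : Mat d (PS n A)) := by
    simp only [gaugeAct, mul_assoc]
  rw [this, Units.inv_mul, mul_one, gaugeAct, map_mul]
  simp only [mul_assoc]

theorem gaugeAct_sub {σ : PS n A ≃ₐ[A] PS n A} {F : (Mat d (PS n A))ˣ} (X Y : Mat d (PS n A)) :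
    gaugeAct σ F (X - Y) = gaugeAct σ F X - gaugeAct σ F Y := by
  simp only [gaugeAct, map_sub, mul_sub, sub_mul]

theorem gaugeAct_zsmul {σ : PS n A ≃ₐ[A] PS n A} {F : (Mat d (PS n A))ˣ} (z : ℤ) (X : Mat d (PS n A)) :
    gaugeAct σ F (z • X) = z • gaugeAct σ F X := by
  simp only [gaugeAct, map_zsmul, mul_smul_comm, smul_mul_assoc]

theorem gaugeAct_smul_one {σ : PS n A ≃ₐ[A] PS n A} {F : (Mat d (PS n A))ˣ} (f : PS n A) :
    gaugeAct σ F (f • (1 : Mat d (PS n A))) = σ f • (1 : Mat d (PS n A)) := by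
  have : σ.mapMatrix (f • (1 : Mat d (PS n A))) = σ f • (1 : Mat d (PS n A)) := by
    ext1 a c
    simp only [AlgEquiv.mapMatrix_apply, Matrix.map_apply, Matrix.smul_apply, smul_eq_mul, map_mul]
    by_cases h : a = c <;> simp [h, Matrix.one_apply]
  rw [gaugeAct, this, mul_smul_comm, smul_mul_assoc, mul_one, Units.mul_inv]

theorem exists_lift_homDeg {A' : Type*} [CommRing A'] {p : A' →+* A} (hp : Function.Surjective p)
    {i : ZMod 2} {X : Mat d (PS n A)} (hX : X ∈ homDeg d (PS n A) i) :
    ∃ X' ∈ homDeg d (PS n A') i, (MvPowerSeries.map p).mapMatrix X' = X := by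
  classical
  obtain ⟨Y, rfl⟩ := matrix_map_surjective hp X
  refine ⟨Matrix.of fun a c => if par a + par c = i then Y a c else 0, ?_, ?_⟩
  · intro a c h
    simp [h]
  · ext1 a c
    by_cases h : par a + par c = i
    · simp [h]
    · rw [hX a c h]
      simp [h]

theorem map_formOver {A' : Type*} [CommRing A'] [Algebra k A'] (p : A' →ₐ[k] A) :
    (MvPowerSeries.map (p : A' →+* A)).mapMatrix (b.formOver A' : Mat d (PS n A')) =
      (b.formOver A : Mat d (PS n A)) := by
  ext1 a c
  exact map_const p _

theorem map_constMatrix {A' : Type*} [CommRing A'] [Algebra k A'] (p : A' →ₐ[k] A)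
    (x : Mat d (PS n k)) :
    (MvPowerSeries.map (p : A' →+* A)).mapMatrix ((const n A').mapMatrix x) =
      (const n A).mapMatrix x := by
  ext1 a c
  exact map_const p _

theorem map_adj {A' : Type*} [CommRing A'] [Algebra k A'] (p : A' →ₐ[k] A)
    (X : Mat d (PS n A')) :
    (MvPowerSeries.map (p : A' →+* A)).mapMatrix (adj (b.formOver A') X) =
      adj (b.formOver A) ((MvPowerSeries.map (p : A' →+* A)).mapMatrix X) := by
  rw [← adj_map]
  congr 1
  exact Units.ext (map_formOver b p)

theorem matIdeal_smul_scalar_mem {𝔞 : Ideal A} (c : k) {X : Mat d (PS n A)}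
    (hX : X ∈ matIdeal n d 𝔞) : c • X ∈ matIdeal n d 𝔞 := by
  intro i j m
  change c • MvPowerSeries.coeff m (X i j) ∈ 𝔞
  rw [Algebra.smul_def]
  exact 𝔞.mul_mem_left _ (hX i j m)

theorem homDeg_smul_scalar_mem {i : ZMod 2} (c : k) {X : Mat d (PS n A)}
    (h : X ∈ homDeg d (PS n A) i) : c • X ∈ homDeg d (PS n A) i := by
  intro a b hab
  rw [Matrix.smul_apply, h a b hab, smul_zero]

variable [IsLocalRing A]

/-- Infinitesimal isometric gauge transformations. -/
structure IsGauge (σ : PS n A ≃ₐ[A] PS n A) (F : (Mat d (PS n A))ˣ) : Prop where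
  red_apply : ∀ f, red n A (σ f) = red n A f
  even : (F : Mat d (PS n A)) ∈ homDeg d (PS n A) 0
  red_matrix : (red n A).mapMatrix (F : Mat d (PS n A)) = 1
  isometry : (F : Mat d (PS n A)).transpose * (b.formOver A : Mat d (PS n A)) * F =
      σ.mapMatrix (b.formOver A : Mat d (PS n A))

theorem equivalent_iff_gauge (N₁ N₂ : Deformation M (some b) A) :
    N₁.Equivalent N₂ ↔ ∃ σ F, IsGauge b σ F ∧ gaugeAct σ F N₁.Q = N₂.Q := by
  constructor
  · rintro ⟨σ, F, h1, h2, h3, h4, h5⟩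
    refine ⟨σ, F, ⟨h1, h2, h3, h4 b rfl⟩, ?_⟩
    rw [gaugeAct, h5, mul_assoc, Units.mul_inv, mul_one]
  · rintro ⟨σ, F, ⟨h1, h2, h3, h4⟩, h5⟩
    refine ⟨σ, F, h1, h2, h3, ?_, ?_⟩
    · rintro b' hb'
      obtain rfl : b = b' := by simpa using hb'
      exact h4
    · rw [← h5, gaugeAct, mul_assoc, mul_assoc, Units.inv_mul, mul_one]

section act
variable {σ : PS n A ≃ₐ[A] PS n A} {F : (Mat d (PS n A))ˣ}

variable {b}

theorem IsGauge.act_homDeg (h : IsGauge b σ F) {i : ZMod 2} {X : Mat d (PS n A)}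
    (hX : X ∈ homDeg d (PS n A) i) : gaugeAct σ F X ∈ homDeg d (PS n A) i := by
  have := mul_mem_homDeg (mul_mem_homDeg h.even (map_mem_homDeg (σ : PS n A →+* PS n A) hX))
    (inv_mem_homDeg h.even)
  rw [zero_add, add_zero] at this
  exact this

/-- Transport by an isometry commutes with adjoints. In matrices, the isometry equation is solved
for `B F σ(B⁻¹) = ᵗF⁻¹` (`hB`), which moves the form through `F`. -/
theorem IsGauge.act_adj (h : IsGauge b σ F) (X : Mat d (PS n A)) :
    adj (b.formOver A) (gaugeAct σ F X) = gaugeAct σ F (adj (b.formOver A) X) := by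
  set B := b.formOver A
  set Fi := ((F⁻¹ : (Mat d (PS n A))ˣ) : Mat d (PS n A))
  have hσB : σ.mapMatrix (adj B X) =
      σ.mapMatrix ((B⁻¹ : (Mat d (PS n A))ˣ) : Mat d (PS n A)) * (σ.mapMatrix X).transpose *
        σ.mapMatrix (B : Mat d (PS n A)) := by
    rw [adj, map_mul, map_mul]
    rfl
  rw [adj_eq_iff, gaugeAct, gaugeAct, hσB, ← h.isometry]
  have hTi : Fi.transpose * (F : Mat d (PS n A)).transpose = 1 := by
    rw [← Matrix.transpose_mul, Units.mul_inv, Matrix.transpose_one]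
  have hB : (B : Mat d (PS n A)) * (F : Mat d (PS n A)) *
      σ.mapMatrix ((B⁻¹ : (Mat d (PS n A))ˣ) : Mat d (PS n A)) = Fi.transpose := by
    have h1 : σ.mapMatrix (B : Mat d (PS n A)) *
      σ.mapMatrix ((B⁻¹ : (Mat d (PS n A))ˣ) : Mat d (PS n A)) = 1 := by
      rw [← map_mul, Units.mul_inv, map_one]
    have h2 := h.isometry
    calc _ = Fi.transpose * ((F : Mat d (PS n A)).transpose * B * F) *
          σ.mapMatrix ((B⁻¹ : (Mat d (PS n A))ˣ) : Mat d (PS n A)) := by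
          simp only [← mul_assoc]
          rw [hTi, one_mul]
      _ = _ := by rw [h2, mul_assoc, h1, mul_one]
  rw [Matrix.transpose_mul, Matrix.transpose_mul]
  have e : (B : Mat d (PS n A)) * ((F : Mat d (PS n A)) *
      (σ.mapMatrix ((B⁻¹ : (Mat d (PS n A))ˣ) : Mat d (PS n A)) * (σ.mapMatrix X).transpose *
        ((F : Mat d (PS n A)).transpose * B * F)) * Fi) =
      ((B : Mat d (PS n A)) * F * σ.mapMatrix ((B⁻¹ : (Mat d (PS n A))ˣ) : Mat d (PS n A))) *
      ((σ.mapMatrix X).transpose * ((F : Mat d (PS n A)).transpose * B * ((F : Mat d (PS n A)) * Fi))) := by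
    simp only [mul_assoc]
  rw [e, hB, Units.mul_inv, mul_one]
  simp only [mul_assoc]
  rfl

theorem IsGauge.sub_one_mem (h : IsGauge b σ F) :
    (F : Mat d (PS n A)) - 1 ∈ matIdeal n d (maximalIdeal A) := by
  rw [mem_matIdeal_maximalIdeal, map_sub, h.red_matrix, map_one, sub_self]

theorem IsGauge.act_red (h : IsGauge b σ F) (X : Mat d (PS n A)) :
    (red n A).mapMatrix (gaugeAct σ F X) = (red n A).mapMatrix X := by
  have h1 := congrArg (red n A).mapMatrix (F.inv_mul)
  rw [map_mul, h.red_matrix, mul_one, map_one] at h1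
  rw [gaugeAct, map_mul, map_mul, h.red_matrix, h1, one_mul, mul_one,
    red_mapMatrix_congr h.red_apply]

/-- A gauge transformation is the identity modulo `𝔪`, and `𝔪` kills `J`; hence defects of lifts are
gauge invariant. -/
theorem IsGauge.act_of_small (h : IsGauge b σ F) [IsNoetherianRing A] {J : Ideal A}
    (hJ : maximalIdeal A * J = ⊥) {X : Mat d (PS n A)} (hX : X ∈ matIdeal n d J) :
    gaugeAct σ F X = X := by
  have h1 : σ.mapMatrix X = X := by
    ext1 a c
    have := algHom_sub_mem_psIdeal (φ := (σ : PS n A →ₐ[A] PS n A)) h.red_apply (hX a c)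
    rw [hJ, mem_psIdeal_bot, sub_eq_zero] at this
    exact this
  have h2 : (F : Mat d (PS n A)) * X = X := by
    have := matrix_mul_eq_zero_of_small hJ h.sub_one_mem hX
    rwa [sub_mul, one_mul, sub_eq_zero] at this
  have h3 : X * (F : Mat d (PS n A)) = X := by
    have := matrix_mul_eq_zero_of_small' hJ hX h.sub_one_mem
    rwa [mul_sub, mul_one, sub_eq_zero] at this
  rw [gaugeAct, h1, h2]
  nth_rewrite 1 [← h3]
  rw [mul_assoc, Units.mul_inv, mul_one]

/-- A gauge transformation applied to a deformation. -/
def Deformation.act (N : Deformation M (some b) A) (h : IsGauge b σ F) :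
    Deformation M (some b) A where
  Q := gaugeAct σ F N.Q
  odd := h.act_homDeg N.odd
  sq := by
    obtain ⟨ω, hω⟩ := N.sq
    exact ⟨σ ω, by rw [← gaugeAct_mul, hω, gaugeAct_smul_one]⟩
  red_eq := by rw [h.act_red, N.red_eq]
  adj_eq := by
    rintro b' hb'
    obtain rfl : b = b' := by simpa using hb'
    rw [h.act_adj, N.adj_eq b rfl, gaugeAct_zsmul]

theorem Deformation.equivalent_act (N : Deformation M (some b) A) (h : IsGauge b σ F) :
    N.Equivalent (N.act h) :=
  (equivalent_iff_gauge b _ _).2 ⟨σ, F, h, rfl⟩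

end act

theorem isUnit_of_red_eq_one {f : PS n A} (hf : red n A f = 1) : IsUnit f := by
  rw [MvPowerSeries.isUnit_iff_constantCoeff]
  have h1 : residue A (MvPowerSeries.constantCoeff f) = 1 := by
    have := congrArg MvPowerSeries.constantCoeff hf
    rwa [red, MvPowerSeries.constantCoeff_map, map_one] at this
  by_contra h
  have h2 := (residue_eq_zero_iff (R := A) _).2 ((mem_maximalIdeal _).2 h)
  rw [h1] at h2
  exact one_ne_zero h2

theorem isUnit_matrix_of_red_eq_one {X : Mat d (PS n A)} (hX : (red n A).mapMatrix X = 1) :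
    IsUnit X := by
  rw [Matrix.isUnit_iff_isUnit_det]
  apply isUnit_of_red_eq_one
  rw [RingHom.map_det, hX, Matrix.det_one]

variable [CharZero k]

theorem half_add_half {V : Type*} [AddCommGroup V] [Module k V] (x : V) :
    (2⁻¹ : k) • x + (2⁻¹ : k) • x = x := by
  rw [← add_smul]
  norm_num

/-- Isometric gauge transformations lift along small extensions. -/
theorem IsGauge.exists_lift {A' : Type*} [CommRing A'] [Algebra k A'] [IsLocalRing A']
    [IsArtinianRing A] [IsArtinianRing A'] {p : A' →ₐ[k] A} (hp : Function.Surjective p)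
    (hJ : maximalIdeal A' * RingHom.ker p = ⊥) {σ : PS n A ≃ₐ[A] PS n A}
    {F : (Mat d (PS n A))ˣ} (h : IsGauge b σ F) :
    ∃ (σ' : PS n A' ≃ₐ[A'] PS n A') (F' : (Mat d (PS n A'))ˣ), IsGauge b σ' F' ∧
      ∀ X, (MvPowerSeries.map (p : A' →+* A)).mapMatrix (gaugeAct σ' F' X) =
        gaugeAct σ F ((MvPowerSeries.map (p : A' →+* A)).mapMatrix X) := by
  obtain ⟨σ', hσ', hσσ'⟩ := exists_auto_lift (p := (p : A' →+* A)) hp σ h.red_apply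
  have hσm : ∀ X : Mat d (PS n A'), (MvPowerSeries.map (p : A' →+* A)).mapMatrix (σ'.mapMatrix X) =
      σ.mapMatrix ((MvPowerSeries.map (p : A' →+* A)).mapMatrix X) :=
    fun X => Matrix.ext fun a c => hσσ' _
  obtain ⟨F₀, hF₀, hF₀F⟩ := exists_lift_homDeg (p := (p : A' →+* A)) hp h.even
  set B : (Mat d (PS n A'))ˣ := b.formOver A' with hB
  -- `Δ` measures how far an arbitrary even lift of `F` is from an isometry. It has coefficients in
  -- the kernel, and it inherits the parity and the symmetry of the form.
  set Δ : Mat d (PS n A') := σ'.mapMatrix (B : Mat d (PS n A')) - F₀.transpose * B * F₀ with hΔ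
  have hΔJ : Δ ∈ matIdeal n d (RingHom.ker (p : A' →+* A)) := by
    rw [mem_matIdeal_ker, hΔ, map_sub, hσm, map_mul, map_mul, map_formOver, ← h.isometry, ← hF₀F]
    exact sub_self _
  have hJm : RingHom.ker (p : A' →+* A) ≤ maximalIdeal A' := ker_le_maximalIdeal p
  have hJ' : maximalIdeal A' * RingHom.ker (p : A' →+* A) = ⊥ := hJ
  have hΔT : Δ.transpose = (b.kind.sign * (b.ε : ℤ)) • Δ := by
    have h1 : (σ'.mapMatrix (B : Mat d (PS n A'))).transpose =
        (b.kind.sign * (b.ε : ℤ)) • σ'.mapMatrix (B : Mat d (PS n A')) := by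
      rw [← mapMatrix_transpose, hB, formOver_transpose, map_zsmul]
    rw [hΔ, Matrix.transpose_sub, h1, Matrix.transpose_mul, Matrix.transpose_mul,
      Matrix.transpose_transpose, hB, formOver_transpose, smul_sub]
    simp only [smul_mul_assoc, mul_smul_comm, mul_assoc]
  have hΔ0 : Δ ∈ homDeg d (PS n A') b.kind.degree := by
    refine sub_mem (map_mem_homDeg (σ' : PS n A' →+* PS n A') (formOver_mem b)) ?_
    have := mul_mem_homDeg (mul_mem_homDeg (transpose_mem_homDeg hF₀) (formOver_mem b (A := A')))
      hF₀
    rwa [zero_add, add_zero] at this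
  have hF₀red : (red n A').mapMatrix F₀ = 1 := by
    rw [← map_one (red n A').mapMatrix]
    ext1 a c
    refine red_eq_of_map (p := (p : A' →+* A)) ?_
    have h1 := congrFun (congrFun h.red_matrix a) c
    rw [← hF₀F] at h1
    refine h1.trans ?_
    have h2 : (MvPowerSeries.map (p : A' →+* A)).mapMatrix (1 : Mat d (PS n A')) = 1 := map_one _
    have h3 : (red n A).mapMatrix (1 : Mat d (PS n A)) = 1 := map_one _
    rw [← h2] at h3
    exact (congrFun (congrFun h3 a) c).symm
  set Bi : Mat d (PS n A') := ((B⁻¹ : (Mat d (PS n A'))ˣ) : Mat d (PS n A')) with hBi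
  -- The correction has to satisfy `ᵗG B + B G = Δ`. As `Δ` is as symmetric as `B`, the choice `G =
  -- B⁻¹ Δ / 2` makes each of the two terms equal to `Δ / 2`.
  set G : Mat d (PS n A') := (2⁻¹ : k) • (Bi * Δ) with hG
  have hGJ : G ∈ matIdeal n d (RingHom.ker (p : A' →+* A)) :=
    matIdeal_smul_scalar_mem _ (matIdeal_mul_left _ hΔJ)
  have hGm := matIdeal_mono hJm hGJ
  have hGp : (MvPowerSeries.map (p : A' →+* A)).mapMatrix G = 0 := (mem_matIdeal_ker _ _).1 hGJ
  have hG0 : G ∈ homDeg d (PS n A') 0 := by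
    refine homDeg_smul_scalar_mem _ ?_
    have := mul_mem_homDeg (inv_mem_homDeg (formOver_mem b (A := A'))) hΔ0
    have e : b.kind.degree + b.kind.degree = 0 := by
      generalize b.kind.degree = x
      revert x
      decide
    rwa [e] at this
  have hF₁red : (red n A').mapMatrix (F₀ + G) = 1 := by
    rw [map_add, hF₀red, (mem_matIdeal_maximalIdeal G).1 hGm, add_zero]
  obtain ⟨F', hF'⟩ := isUnit_matrix_of_red_eq_one hF₁red
  have hF₀1 : F₀ - 1 ∈ matIdeal n d (maximalIdeal A') := by
    rw [mem_matIdeal_maximalIdeal, map_sub, hF₀red, map_one, sub_self]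
  have hBG : (B : Mat d (PS n A')) * G = (2⁻¹ : k) • Δ := by
    rw [hG, mul_smul_comm, ← mul_assoc, hBi, Units.mul_inv, one_mul]
  have hGB : G.transpose * (B : Mat d (PS n A')) = (2⁻¹ : k) • Δ := by
    have h1 : (G.transpose * (B : Mat d (PS n A'))).transpose =
        (b.kind.sign * (b.ε : ℤ)) • (2⁻¹ : k) • Δ := by
      rw [Matrix.transpose_mul, Matrix.transpose_transpose, hB, formOver_transpose, smul_mul_assoc,
        ← hB, hBG]
    have h2 := congrArg Matrix.transpose h1
    rw [Matrix.transpose_transpose, Matrix.transpose_smul (b.kind.sign * (b.ε : ℤ)),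
      Matrix.transpose_smul (2⁻¹ : k) Δ, hΔT, smul_comm (2⁻¹ : k), smul_smul, sign_sq,
      one_smul] at h2
    exact h2
  have hiso : (F₀ + G).transpose * (B : Mat d (PS n A')) * (F₀ + G) =
      σ'.mapMatrix (B : Mat d (PS n A')) := by
    have e1 : F₀.transpose * (B : Mat d (PS n A')) * G = (2⁻¹ : k) • Δ := by
      have h1 : (F₀ - 1).transpose * ((B : Mat d (PS n A')) * G) = 0 :=
        matrix_mul_eq_zero_of_small hJ' (matIdeal_transpose hF₀1) (matIdeal_mul_left _ hGJ)
      rw [Matrix.transpose_sub, Matrix.transpose_one, sub_mul, one_mul, sub_eq_zero] at h1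
      rw [mul_assoc, h1, hBG]
    have e2 : G.transpose * (B : Mat d (PS n A')) * F₀ = (2⁻¹ : k) • Δ := by
      have h1 : (G.transpose * (B : Mat d (PS n A'))) * (F₀ - 1) = 0 :=
        matrix_mul_eq_zero_of_small' hJ' (matIdeal_mul_right _ (matIdeal_transpose hGJ)) hF₀1
      rw [mul_sub, mul_one, sub_eq_zero] at h1
      rw [h1, hGB]
    have e3 : G.transpose * (B : Mat d (PS n A')) * G = 0 :=
      matrix_mul_eq_zero_of_small' hJ' (matIdeal_mul_right _ (matIdeal_transpose hGJ)) hGm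
    rw [Matrix.transpose_add, add_mul, add_mul, mul_add, mul_add, e1, e2, e3, add_zero, add_assoc,
      half_add_half, hΔ, add_sub_cancel]
  have hgauge : IsGauge b σ' F' := by
    refine ⟨hσ', ?_, ?_, ?_⟩
    · rw [hF']
      exact add_mem hF₀ hG0
    · rw [hF', hF₁red]
    · rw [hF', hiso]
  refine ⟨σ', F', hgauge, fun X => ?_⟩
  have hpF : (MvPowerSeries.map (p : A' →+* A)).mapMatrix (F' : Mat d (PS n A')) =
      (F : Mat d (PS n A)) := by
    rw [hF', map_add, hF₀F, hGp, add_zero]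
  have hpFi : (MvPowerSeries.map (p : A' →+* A)).mapMatrix
      ((F'⁻¹ : (Mat d (PS n A'))ˣ) : Mat d (PS n A')) =
      ((F⁻¹ : (Mat d (PS n A))ˣ) : Mat d (PS n A)) := by
    rw [← mul_one ((MvPowerSeries.map (p : A' →+* A)).mapMatrix _), ← F.mul_inv, ← mul_assoc,
      ← hpF, ← map_mul, Units.inv_mul, map_one, one_mul]
  rw [gaugeAct, gaugeAct, map_mul, map_mul, hσm, hpF, hpFi]

end gauge

/-! ### First order deformations and infinitesimal gauge transformations -/

section infinitesimal
variable {k : Type u} [Field k] {n d : ℕ} {w : MvPolynomial (Fin n) k}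

theorem homDeg_smul_field_mem {C : Type*} [CommRing C] [Algebra k C] {i : ZMod 2} (c : k)
    {X : Mat d C} (h : X ∈ homDeg d C i) : c • X ∈ homDeg d C i := by
  intro a b hab
  rw [Matrix.smul_apply, h a b hab, smul_zero]

/-- First order deformations: odd `f` with `Q f + f Q` a scalar and `f^adj = s f`. -/
def tangentCocycles (M : MatrixFactorization w d) (β : Option (BilinearStructure M)) :
    Submodule k (Mat d (PS n k)) where
  carrier := {f | f ∈ homDeg d (PS n k) 1 ∧ (∃ h : PS n k, M.Q * f + f * M.Q = h • 1) ∧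
    ∀ b ∈ β, adj b.form f = b.kind.sign • f}
  add_mem' := by
    rintro f g ⟨hf, ⟨h₁, h1⟩, hf'⟩ ⟨hg, ⟨h₂, h2⟩, hg'⟩
    refine ⟨add_mem hf hg, ⟨h₁ + h₂, ?_⟩, fun b hb => ?_⟩
    · rw [add_smul, ← h1, ← h2]
      noncomm_ring
    · rw [adj_add, hf' b hb, hg' b hb, smul_add]
  zero_mem' := ⟨zero_mem _, ⟨0, by simp⟩, fun b _ => by simp [adj]⟩
  smul_mem' := by
    rintro c f ⟨hf, ⟨h₁, h1⟩, hf'⟩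
    refine ⟨homDeg_smul_field_mem c hf, ⟨c • h₁, ?_⟩, fun b hb => ?_⟩
    · rw [smul_assoc, ← h1, mul_smul_comm, smul_mul_assoc, smul_add]
    · rw [adj_smul_scalar, hf' b hb, smul_comm]

/-- Infinitesimal gauge transformations: vector fields `v` together with even matrices `G`. -/
def infGauge (M : MatrixFactorization w d) (β : Option (BilinearStructure M)) :
    Submodule k ((Fin n → PS n k) × Mat d (PS n k)) where
  carrier := {x | x.2 ∈ homDeg d (PS n k) 0 ∧ ∀ b ∈ β,
    x.2.transpose * (b.form : Mat d (PS n k)) + (b.form : Mat d (PS n k)) * x.2 =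
      matD x.1 (b.form : Mat d (PS n k))}
  add_mem' := by
    rintro ⟨v, G⟩ ⟨v', G'⟩ ⟨h1, h2⟩ ⟨h1', h2'⟩
    refine ⟨add_mem h1 h1', fun b hb => ?_⟩
    simp only [Prod.mk_add_mk, matD_add_left] at h2 h2' ⊢
    rw [← h2 b hb, ← h2' b hb, Matrix.transpose_add]
    noncomm_ring
  zero_mem' := by
    refine ⟨zero_mem _, fun b _ => ?_⟩
    have : matD (0 : Fin n → PS n k) (b.form : Mat d (PS n k)) = 0 := by
      have := matD_smul_left (0 : k) (0 : Fin n → PS n k) (b.form : Mat d (PS n k))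
      rwa [zero_smul, zero_smul] at this
    simp [this]
  smul_mem' := by
    rintro c ⟨v, G⟩ ⟨h1, h2⟩
    refine ⟨homDeg_smul_field_mem c h1, fun b hb => ?_⟩
    simp only [Prod.smul_mk, matD_smul_left] at h2 ⊢
    rw [← h2 b hb, Matrix.transpose_smul, smul_mul_assoc, mul_smul_comm, smul_add]

/-- The infinitesimal action `v(Q) + [G, Q]`. -/
def infAct (M : MatrixFactorization w d) :
    ((Fin n → PS n k) × Mat d (PS n k)) →ₗ[k] Mat d (PS n k) where
  toFun x := matD x.1 M.Q + (x.2 * M.Q - M.Q * x.2)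
  map_add' x y := by
    simp only [Prod.fst_add, Prod.snd_add, matD_add_left]
    noncomm_ring
  map_smul' c x := by
    simp only [Prod.smul_fst, Prod.smul_snd, matD_smul_left, smul_mul_assoc, mul_smul_comm,
      smul_add, smul_sub, RingHom.id_apply]

theorem infAct_apply (M : MatrixFactorization w d) (v : Fin n → PS n k) (G : Mat d (PS n k)) :
    infAct M (v, G) = matD v M.Q + (G * M.Q - M.Q * G) := rfl

/-- First order deformations that are trivial up to gauge. -/
def tangentBoundaries (M : MatrixFactorization w d) (β : Option (BilinearStructure M)) :
    Submodule k (Mat d (PS n k)) := (infGauge M β).map (infAct M)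

variable {M : MatrixFactorization w d} {β : Option (BilinearStructure M)}

theorem smul_matrix_mul {A : Type*} [CommRing A] (a : A) (X Y : Mat d (PS n A)) :
    (a • X) * Y = a • (X * Y) := smul_mul_assoc a X Y

theorem matrix_mul_smul {A : Type*} [CommRing A] (a : A) (X Y : Mat d (PS n A)) :
    X * (a • Y) = a • (X * Y) := mul_smul_comm a X Y

section general
variable {A : Type*} [CommRing A] [Algebra k A] {r : ℕ}

theorem firstOrder_auto_const {σ : PS n A ≃ₐ[A] PS n A} {η : Fin r → A}
    {v : Fin r → Fin n → PS n k}
    (hσ : ∀ f, σ f = f + ∑ i, (∑ l, η l • const n A (v l i)) * MvPowerSeries.pderiv A i f)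
    (x : Mat d (PS n k)) :
    σ.mapMatrix ((const n A).mapMatrix x) =
      (const n A).mapMatrix x + ∑ l, η l • (const n A).mapMatrix (matD (v l) x) := by
  ext1 a c
  rw [Matrix.add_apply, Matrix.sum_apply]
  change σ (const n A (x a c)) = const n A (x a c) + ∑ l, η l • const n A (vf (v l) (x a c))
  rw [hσ]
  congr 1
  simp_rw [Finset.sum_mul, pderiv_const, vf_apply, map_sum, Finset.smul_sum, map_mul,
    smul_mul_assoc]
  rw [Finset.sum_comm]

/-- Trivial first order deformations along a small ideal are equivalences. -/
theorem equivalent_of_small [IsLocalRing A] [IsArtinianRing A] {J : Ideal A} (hJ : maximalIdeal A * J = ⊥)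
    (hJm : J ≤ maximalIdeal A) {η : Fin r → A} (hη : ∀ l, η l ∈ J) {y : Fin r → Mat d (PS n k)}
    (hy : ∀ l, y l ∈ tangentBoundaries M β) {N₁ N₂ : Deformation M β A}
    (h : N₂.Q = N₁.Q + ∑ l, η l • (const n A).mapMatrix (y l)) : N₁.Equivalent N₂ := by
  choose x hx hxy using hy
  have hηm : ∀ l, η l ∈ maximalIdeal A := fun l => hJm (hη l)
  -- As `J² = 0`, the infinitesimal transformations integrate to first order expressions: `1 + ∑ η
  -- v` on functions and `1 + G` on the module.
  obtain ⟨σ, hσ, hσ'⟩ := exists_firstOrder_auto hJ hJm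
    (fun i => ∑ l, η l • const n A ((x l).1 i))
    (fun i => sum_mem fun l _ => psIdeal_smul_mem (hη l) _)
  have hσc := fun X => firstOrder_auto_const (d := d) hσ' X
  set G : Mat d (PS n A) := ∑ l, η l • (const n A).mapMatrix (x l).2 with hG
  have hGJ : G ∈ matIdeal n d J := sum_smul_mem_matIdeal hη _
  have hGm := matIdeal_mono hJm hGJ
  have hGG := matrix_mul_eq_zero_of_small hJ hGm hGJ
  have hN₁m : N₁.Q - (const n A).mapMatrix M.Q ∈ matIdeal n d (maximalIdeal A) :=
    const_sub_mem_of_red N₁.red_eq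
  have hN₂m : N₂.Q - (const n A).mapMatrix M.Q ∈ matIdeal n d (maximalIdeal A) :=
    const_sub_mem_of_red N₂.red_eq
  refine ⟨σ, ⟨1 + G, 1 - G, ?_, ?_⟩, hσ, ?_, ?_, ?_, ?_⟩
  · have : (1 + G) * (1 - G) = 1 - G * G := by noncomm_ring
    rw [this, hGG, sub_zero]
  · have : (1 - G) * (1 + G) = 1 - G * G := by noncomm_ring
    rw [this, hGG, sub_zero]
  · refine add_mem one_mem_homDeg (sum_mem fun l _ => ?_)
    intro a c hac
    rw [Matrix.smul_apply, map_mem_homDeg (const n A) (hx l).1 a c hac, smul_zero]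
  · change (red n A).mapMatrix (1 + G) = 1
    rw [map_add, (mem_matIdeal_maximalIdeal G).1 hGm, add_zero, map_one]
  · intro b hb
    change (1 + G).transpose * (const n A).mapMatrix (b.form : Mat d (PS n k)) * (1 + G) =
      σ.mapMatrix ((const n A).mapMatrix (b.form : Mat d (PS n k)))
    set Bm := (const n A).mapMatrix (b.form : Mat d (PS n k)) with hBm
    have h1 : G.transpose * Bm * G = 0 :=
      matrix_mul_eq_zero_of_small hJ (matIdeal_mul_right _ (matIdeal_transpose hGm)) hGJ
    have h2 : (1 + G).transpose * Bm * (1 + G) = Bm + (G.transpose * Bm + Bm * G) := by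
      rw [Matrix.transpose_add, Matrix.transpose_one, add_mul, add_mul, mul_add, mul_add, h1]
      simp only [one_mul, mul_one]
      abel
    rw [h2, hσc]
    congr 1
    rw [hG, Matrix.transpose_sum, Finset.sum_mul, Finset.mul_sum, ← Finset.sum_add_distrib]
    refine Finset.sum_congr rfl fun l _ => ?_
    rw [Matrix.transpose_smul, smul_mul_assoc, mul_smul_comm, ← smul_add, ← (hx l).2 b hb, map_add,
      map_mul, map_mul]
    rfl
  · change (1 + G) * σ.mapMatrix N₁.Q = N₂.Q * (1 + G)
    -- `σ` sees only the constant part of `N₁.Q`: the derivatives of the rest have coefficients in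
    -- `𝔪`, and they are multiplied by elements of `J`.
    have h1 : σ.mapMatrix N₁.Q = N₁.Q + ∑ l, η l • (const n A).mapMatrix (matD (x l).1 M.Q) := by
      have h2 : σ.mapMatrix (N₁.Q - (const n A).mapMatrix M.Q) =
          N₁.Q - (const n A).mapMatrix M.Q := by
        ext1 a c
        change σ _ = _
        rw [hσ', add_eq_left]
        refine Finset.sum_eq_zero fun i _ => ?_
        rw [mul_comm]
        refine mul_mem_bot_of_small hJ ?_ (sum_mem fun l _ => psIdeal_smul_mem (hη l) _)
        intro m
        rw [MvPowerSeries.coeff_pderiv]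
        exact Ideal.mul_mem_right _ _ (hN₁m a c _)
      rw [map_sub, hσc, sub_eq_iff_eq_add] at h2
      rw [h2]
      abel
    have h3 : G * (N₁.Q - (const n A).mapMatrix M.Q) = 0 :=
      matrix_mul_eq_zero_of_small' hJ hGJ hN₁m
    have h4 : (N₂.Q - (const n A).mapMatrix M.Q) * G = 0 :=
      matrix_mul_eq_zero_of_small hJ hN₂m hGJ
    rw [mul_sub, sub_eq_zero] at h3
    rw [sub_mul, sub_eq_zero] at h4
    have h5 : G * ∑ l, η l • (const n A).mapMatrix (matD (x l).1 M.Q) = 0 :=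
      matrix_mul_eq_zero_of_small hJ hGm (sum_smul_mem_matIdeal hη _)
    have h6 : ∑ l, η l • (const n A).mapMatrix (y l) =
        ∑ l, η l • (const n A).mapMatrix (matD (x l).1 M.Q) +
          (G * (const n A).mapMatrix M.Q - (const n A).mapMatrix M.Q * G) := by
      rw [hG, Finset.sum_mul, Finset.mul_sum, ← Finset.sum_sub_distrib, ← Finset.sum_add_distrib]
      refine Finset.sum_congr rfl fun l _ => ?_
      rw [← hxy l]
      change η l • (const n A).mapMatrix (matD (x l).1 M.Q + ((x l).2 * M.Q - M.Q * (x l).2)) = _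
      rw [map_add, map_sub, map_mul, map_mul, smul_add, smul_sub, smul_mul_assoc, mul_smul_comm]
    have h7 : (1 + G) * σ.mapMatrix N₁.Q = σ.mapMatrix N₁.Q + G * σ.mapMatrix N₁.Q := by
      rw [add_mul, one_mul]
    have h8 : N₂.Q * (1 + G) = N₂.Q + N₂.Q * G := by rw [mul_add, mul_one]
    rw [h7, h8, h4, h, h1, mul_add, h3, h5, h6]
    abel

end general

/-! ### The tangent space -/

theorem dual_small : maximalIdeal (DualNumber k) * maximalIdeal (DualNumber k) = ⊥ := by
  rw [eq_bot_iff, Ideal.mul_le]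
  intro a ha b hb
  rw [mem_maximalIdeal_dual] at ha hb
  rw [Ideal.mem_bot]
  ext <;> simp [ha, hb]

instance : IsArtinianRing (DualNumber k) := by
  have : Module.Finite k (DualNumber k) :=
    Module.Finite.of_surjective (LinearMap.coprod (TrivSqZeroExt.inlAlgHom k k k).toLinearMap
      (TrivSqZeroExt.inrHom k k : k →ₗ[k] DualNumber k)) (fun x =>
        ⟨(x.fst, x.snd), TrivSqZeroExt.inl_fst_add_inr_snd_eq x⟩)
  exact IsArtinianRing.of_finite k _

theorem eps_mem : (DualNumber.eps : DualNumber k) ∈ maximalIdeal (DualNumber k) := by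
  rw [mem_maximalIdeal_dual]
  simp

theorem exists_eps_const {f : PS n (DualNumber k)}
    (hf : f ∈ psIdeal n (maximalIdeal (DualNumber k))) :
    ∃ g : PS n k, f = (DualNumber.eps : DualNumber k) • const n (DualNumber k) g := by
  let g : PS n k := fun m => (MvPowerSeries.coeff m f).snd
  refine ⟨g, ?_⟩
  ext1 m
  have h1 := (mem_maximalIdeal_dual _).1 (hf m)
  rw [map_smul, const, MvPowerSeries.coeff_map, smul_eq_mul]
  change _ = DualNumber.eps * TrivSqZeroExt.inl (MvPowerSeries.coeff m f).snd
  ext <;> simp [h1]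

theorem exists_eps_constMatrix {X : Mat d (PS n (DualNumber k))}
    (hX : X ∈ matIdeal n d (maximalIdeal (DualNumber k))) :
    ∃ x : Mat d (PS n k), X = (DualNumber.eps : DualNumber k) •
      (const n (DualNumber k)).mapMatrix x := by
  choose g hg using fun a b => exists_eps_const (hX a b)
  refine ⟨Matrix.of g, ?_⟩
  ext1 a b
  exact hg a b

theorem eps_const_injective {f g : PS n k} (h : (DualNumber.eps : DualNumber k) •
    const n (DualNumber k) f = (DualNumber.eps : DualNumber k) • const n (DualNumber k) g) :
    f = g := by
  ext m
  have := congrArg (fun x => (MvPowerSeries.coeff m x).snd) h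
  simp only [map_smul, const, MvPowerSeries.coeff_map, smul_eq_mul] at this
  change (DualNumber.eps * TrivSqZeroExt.inl (MvPowerSeries.coeff m f) : DualNumber k).snd =
    (DualNumber.eps * TrivSqZeroExt.inl (MvPowerSeries.coeff m g) : DualNumber k).snd at this
  simpa using this

theorem eps_constMatrix_injective {f g : Mat d (PS n k)} (h : (DualNumber.eps : DualNumber k) •
    (const n (DualNumber k)).mapMatrix f = (DualNumber.eps : DualNumber k) •
    (const n (DualNumber k)).mapMatrix g) : f = g :=
  Matrix.ext fun a b => eps_const_injective (congrFun (congrFun h a) b)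

theorem dual_sq_eq (f : Mat d (PS n k)) :
    (Q0 M + (DualNumber.eps : DualNumber k) • (const n (DualNumber k)).mapMatrix f) *
      (Q0 M + (DualNumber.eps : DualNumber k) • (const n (DualNumber k)).mapMatrix f) =
    const n (DualNumber k) (w : PS n k) • (1 : Mat d (PS n (DualNumber k))) +
      (DualNumber.eps : DualNumber k) •
        (const n (DualNumber k)).mapMatrix (M.Q * f + f * M.Q) := by
  have h1 : ((DualNumber.eps : DualNumber k) • (const n (DualNumber k)).mapMatrix f) *
      ((DualNumber.eps : DualNumber k) • (const n (DualNumber k)).mapMatrix f) = 0 := by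
    have hm : (DualNumber.eps : DualNumber k) • (const n (DualNumber k)).mapMatrix f ∈
        matIdeal n d (maximalIdeal (DualNumber k)) := matIdeal_smul_mem eps_mem _
    exact matrix_mul_eq_zero_of_small (dual_small (k := k)) hm hm
  rw [add_mul, mul_add, mul_add, h1, const_sq, map_add, map_mul, map_mul, matrix_mul_smul,
    smul_matrix_mul, smul_add, add_zero]
  abel

theorem dual_potential_eq_iff (f : Mat d (PS n k)) (h : PS n k) :
    (Q0 M + (DualNumber.eps : DualNumber k) • (const n (DualNumber k)).mapMatrix f) *
      (Q0 M + (DualNumber.eps : DualNumber k) • (const n (DualNumber k)).mapMatrix f) =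
      (const n (DualNumber k) (w : PS n k) + (DualNumber.eps : DualNumber k) •
        const n (DualNumber k) h) • (1 : Mat d (PS n (DualNumber k))) ↔
    M.Q * f + f * M.Q = h • 1 := by
  rw [dual_sq_eq, add_smul, add_right_inj, smul_assoc, ← const_smul_one]
  exact ⟨fun h => eps_constMatrix_injective h, fun h => by rw [h]⟩

/-- The first order deformation `Q + ε f`. -/
def Deformation.ofCocycle (f : tangentCocycles M β) : Deformation M β (DualNumber k) where
  Q := Q0 M + (DualNumber.eps : DualNumber k) • (const n (DualNumber k)).mapMatrix f.1
  odd := by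
    refine add_mem (Q0_odd M) ?_
    intro a b hab
    rw [Matrix.smul_apply, map_mem_homDeg (const n (DualNumber k)) f.2.1 a b hab, smul_zero]
  sq := by
    obtain ⟨h, hh⟩ := f.2.2.1
    exact ⟨_, (dual_potential_eq_iff f.1 h).2 hh⟩
  red_eq := by
    rw [map_add, (mem_matIdeal_maximalIdeal _).1 (matIdeal_smul_mem eps_mem _), add_zero]
  adj_eq b hb := by
    rw [adj_add', Q0_adj, adj_smul_const, f.2.2.2 b hb, map_zsmul, smul_add, smul_comm]

theorem Deformation.exists_ofCocycle (hd : 1 ≤ d) (N : Deformation M β (DualNumber k)) :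
    ∃ f : tangentCocycles M β, Deformation.ofCocycle f = N := by
  obtain ⟨f, hf⟩ := exists_eps_constMatrix (const_sub_mem_of_red N.red_eq)
  have hN : N.Q = Q0 M + (DualNumber.eps : DualNumber k) • (const n (DualNumber k)).mapMatrix f := by
    rw [← hf, add_sub_cancel]
  refine ⟨⟨f, ?_, ?_, ?_⟩, Deformation.ext hN.symm⟩
  · intro a b hab
    apply eps_const_injective
    have h1 := sub_mem N.odd (Q0_odd M) a b hab
    rw [hf] at h1
    rw [map_zero, smul_zero]
    exact h1
  · obtain ⟨ω, hω⟩ := N.sq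
    -- The square of the operator reduces to `w`, so its potential is `w` plus a multiple of `ε`.
    have h1 : ω - const n (DualNumber k) (w : PS n k) ∈ psIdeal n (maximalIdeal (DualNumber k)) := by
      rw [← smul_one_mem_matIdeal_iff hd, sub_smul, ← hω, hN, dual_sq_eq, add_sub_cancel_left]
      exact matIdeal_smul_mem eps_mem _
    obtain ⟨h, hh⟩ := exists_eps_const h1
    refine ⟨h, ?_⟩
    rw [← dual_potential_eq_iff, ← hN, hω, ← hh, add_sub_cancel]
  · intro b hb
    apply eps_constMatrix_injective
    have h1 := N.adj_eq b hb
    rw [hN, adj_add', Q0_adj, adj_smul_const, smul_add, add_right_inj] at h1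
    rw [h1, map_zsmul, smul_comm]

/-- Over the dual numbers a gauge transformation is `1 + ε v` followed by `1 + ε G`, and the
equivalence equation linearizes to `g - f = v(Q) + [G, Q]`. The converse is the integration of such
a pair. -/
theorem ofCocycle_equivalent_iff (f g : tangentCocycles M β) :
    (Deformation.ofCocycle f).Equivalent (Deformation.ofCocycle g) ↔
      (g : Mat d (PS n k)) - f ∈ tangentBoundaries M β := by
  constructor
  · intro h
    rw [equivalent_iff_linear] at h
    obtain ⟨σ, G, h1, h2, h3, h4, h5⟩ := h
    obtain ⟨g', rfl⟩ := exists_eps_constMatrix (X := G) ((mem_matIdeal_maximalIdeal G).2 h3)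
    have hσX : ∀ i, σ (MvPowerSeries.X i) - MvPowerSeries.X i ∈
        psIdeal n (maximalIdeal (DualNumber k)) := fun i => by
      rw [mem_psIdeal_maximalIdeal, map_sub, h1, sub_self]
    choose v hv using fun i => exists_eps_const (hσX i)
    have hσ := fun f => auto_eq_firstOrder (dual_small (k := k)) le_rfl σ hσX f
    have hσc : ∀ x : Mat d (PS n k), σ.mapMatrix ((const n (DualNumber k)).mapMatrix x) -
        (const n (DualNumber k)).mapMatrix x =
        (DualNumber.eps : DualNumber k) • (const n (DualNumber k)).mapMatrix (matD v x) := by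
      intro x
      have := firstOrder_auto_const (σ := σ) (r := 1) (η := fun _ => (DualNumber.eps : DualNumber k))
        (v := fun _ => v) (fun f => by
          rw [hσ f]
          simp only [hv, Finset.univ_unique, Finset.sum_singleton]) x
      rw [this]
      simp
    refine ⟨(v, g'), ⟨?_, ?_⟩, ?_⟩
    · intro a b hab
      apply eps_const_injective
      rw [map_zero, smul_zero]
      exact h2 a b hab
    · intro b hb
      have h6 := h4 b hb
      change _ * (const n (DualNumber k)).mapMatrix (b.form : Mat d (PS n k)) +
        (const n (DualNumber k)).mapMatrix (b.form : Mat d (PS n k)) * _ =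
        σ.mapMatrix ((const n (DualNumber k)).mapMatrix (b.form : Mat d (PS n k))) -
        (const n (DualNumber k)).mapMatrix (b.form : Mat d (PS n k)) at h6
      rw [hσc, Matrix.transpose_smul, smul_matrix_mul, matrix_mul_smul, ← smul_add] at h6
      apply eps_constMatrix_injective
      rw [← h6, map_add, map_mul, map_mul]
      rfl
    · rw [infAct_apply]
      apply eps_constMatrix_injective
      rw [map_add, map_sub, map_sub, map_mul, map_mul, smul_add, ← hσc, smul_sub, smul_sub]
      change Q0 M + _ + _ + _ = Q0 M + _ + _ at h5
      rw [smul_matrix_mul, matrix_mul_smul] at h5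
      rw [add_assoc, add_assoc, add_assoc, add_right_inj] at h5
      rw [← sub_eq_zero]
      rw [← sub_eq_zero] at h5
      rw [← h5]
      abel
  · intro h
    refine equivalent_of_small (r := 1) (dual_small (k := k)) le_rfl
      (η := fun _ => (DualNumber.eps : DualNumber k)) (fun _ => eps_mem)
      (y := fun _ => (g : Mat d (PS n k)) - (f : Mat d (PS n k))) (fun _ => h) ?_
    change Q0 M + _ = Q0 M + _ + _
    simp only [Finset.univ_unique, Finset.sum_singleton]
    rw [add_assoc, ← smul_add, ← map_add, add_sub_cancel]

/-- The class in the tangent space of a first order deformation. -/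
def tangentMk (M : MatrixFactorization w d) (β : Option (BilinearStructure M)) :
    tangentCocycles M β →ₗ[k] Tangent M β where
  toFun f := (Deformation.ofCocycle f).cls
  map_add' f g := by
    refine congrArg (Quotient.mk _) (Deformation.ext ?_)
    change Q0 M + _ = (Q0 M + _) + ((Q0 M + _) - Q0 M)
    rw [Submodule.coe_add, map_add, smul_add]
    abel
  map_smul' c f := by
    refine congrArg (Quotient.mk _) (Deformation.ext ?_)
    change Q0 M + _ = Q0 M + c • ((Q0 M + _) - Q0 M)
    rw [add_sub_cancel_left, Submodule.coe_smul, const_smul, smul_comm, algebraMap_smul]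

theorem tangentMk_surjective (hd : 1 ≤ d) : Function.Surjective (tangentMk M β) := by
  intro x
  induction x using Quotient.inductionOn with | _ N =>
  obtain ⟨f, rfl⟩ := N.exists_ofCocycle hd
  exact ⟨f, rfl⟩

theorem tangentMk_eq_iff (f g : tangentCocycles M β) :
    tangentMk M β f = tangentMk M β g ↔ (g : Mat d (PS n k)) - f ∈ tangentBoundaries M β := by
  rw [← ofCocycle_equivalent_iff]
  exact Quotient.eq

theorem tangentMk_eq_zero_iff (f : tangentCocycles M β) :
    tangentMk M β f = 0 ↔ (f : Mat d (PS n k)) ∈ tangentBoundaries M β := by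
  rw [eq_comm, ← map_zero (tangentMk M β), tangentMk_eq_iff, Submodule.coe_zero, sub_zero]

end infinitesimal

/-! ### The tangent space as a selfadjoint part -/

section selfadjoint
variable {k : Type u} [Field k] {n d : ℕ} {w : MvPolynomial (Fin n) k}
  {M : MatrixFactorization w d} (b : BilinearStructure M)

/-- The matrix `b⁻¹ v(b)`. -/
def logD (v : Fin n → PS n k) : Mat d (PS n k) :=
  ((b.form⁻¹ : (Mat d (PS n k))ˣ) : Mat d (PS n k)) * matD v (b.form : Mat d (PS n k))

theorem form_mul_logD (v : Fin n → PS n k) :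
    (b.form : Mat d (PS n k)) * logD b v = matD v (b.form : Mat d (PS n k)) := by
  rw [logD, ← mul_assoc, Units.mul_inv, one_mul]

theorem logD_even (v : Fin n → PS n k) : logD b v ∈ homDeg d (PS n k) 0 := by
  have := mul_mem_homDeg (inv_mem_homDeg b.homogeneous) (matD_mem_homDeg v b.homogeneous)
  have e : b.kind.degree + b.kind.degree = 0 := by
    generalize b.kind.degree = x
    revert x
    decide
  rwa [e] at this

theorem inv_transpose_mul_form : ((b.form⁻¹ : (Mat d (PS n k))ˣ) : Mat d (PS n k)).transpose *
    (b.form : Mat d (PS n k)) = (b.kind.sign * (b.ε : ℤ)) • 1 := by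
  have h2 : (b.form : Mat d (PS n k)) =
      (b.kind.sign * (b.ε : ℤ)) • (b.form : Mat d (PS n k)).transpose := by
    rw [b.symm, smul_smul, sign_sq, one_smul]
  rw [show ((b.form⁻¹ : (Mat d (PS n k))ˣ) : Mat d (PS n k)).transpose * (b.form : Mat d (PS n k)) =
    ((b.form⁻¹ : (Mat d (PS n k))ˣ) : Mat d (PS n k)).transpose *
      ((b.kind.sign * (b.ε : ℤ)) • (b.form : Mat d (PS n k)).transpose) by rw [← h2],
    mul_smul_comm, ← Matrix.transpose_mul, Units.mul_inv, Matrix.transpose_one]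

theorem adj_logD (v : Fin n → PS n k) : adj b.form (logD b v) = logD b v := by
  rw [adj, logD, Matrix.transpose_mul, ← matD_transpose, b.symm, map_zsmul, mul_assoc, mul_assoc,
    inv_transpose_mul_form]
  simp only [mul_smul_comm, mul_one]
  rw [smul_smul, sign_sq, one_smul]

/-- Differentiate `b⁻¹ ᵗX b` by the Leibniz rule: with `L = b⁻¹ v(b)`, the derivatives `v(b⁻¹) = -L
b⁻¹` and `v(b) = b L` contribute the commutator with `L`. -/
theorem adj_matD (v : Fin n → PS n k) (X : Mat d (PS n k)) :
    adj b.form (matD v X) = matD v (adj b.form X) + logD b v * adj b.form X -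
      adj b.form X * logD b v := by
  set B := (b.form : Mat d (PS n k))
  set Bi := ((b.form⁻¹ : (Mat d (PS n k))ˣ) : Mat d (PS n k))
  have hBiB : Bi * B = 1 := Units.inv_mul _
  have hBBi : B * Bi = 1 := Units.mul_inv _
  have h1 : matD v Bi = - (logD b v * Bi) := by
    have h2 := congrArg (matD v) hBiB
    rw [matD_mul, matD_one, add_eq_zero_iff_eq_neg] at h2
    calc matD v Bi = matD v Bi * B * Bi := by rw [mul_assoc, hBBi, mul_one]
      _ = _ := by rw [h2, neg_mul]; rfl
  have h2 : matD v (adj b.form X) = matD v Bi * X.transpose * B +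
      Bi * (matD v X).transpose * B + Bi * X.transpose * matD v B := by
    rw [adj, matD_mul, matD_mul, matD_transpose, add_mul]
  have h3 : Bi * X.transpose * matD v B = adj b.form X * logD b v := by
    rw [← form_mul_logD, adj]
    simp only [mul_assoc]
    rfl
  rw [h2, h1, h3, neg_mul, neg_mul, mul_assoc (logD b v), mul_assoc (logD b v)]
  change adj b.form (matD v X) = -(logD b v * adj b.form X) + adj b.form (matD v X) + _ + _ - _
  abel

/-- Dualizing a factorization turns the gauge pair `(v, G)` into `(v, b⁻¹ v(b) - G^adj)`. The
isometric pairs are those which this duality fixes. -/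
theorem adj_infAct (v : Fin n → PS n k) (G : Mat d (PS n k)) :
    b.kind.sign • adj b.form (infAct M (v, G)) =
      infAct M (v, logD b v - adj b.form G) := by
  rw [infAct_apply, infAct_apply, adj_add, adj_sub, adj_mul, adj_mul, adj_matD, b.adj_Q, map_zsmul]
  simp only [mul_smul_comm, smul_mul_assoc, ← smul_add, ← smul_sub, smul_smul,
    b.kind.sign_mul_self, one_smul]
  noncomm_ring

theorem mem_infGauge_some_iff (v : Fin n → PS n k) (G : Mat d (PS n k)) :
    (v, G) ∈ infGauge M (some b) ↔ G ∈ homDeg d (PS n k) 0 ∧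
      adj b.form G + G = logD b v := by
  refine and_congr_right fun _ => ?_
  have h : G.transpose * (b.form : Mat d (PS n k)) + (b.form : Mat d (PS n k)) * G =
      (b.form : Mat d (PS n k)) * (adj b.form G + G) := by
    rw [mul_add, ← (adj_eq_iff b.form G _).1 rfl]
  constructor
  · intro H
    have h1 := H b rfl
    rw [h, ← form_mul_logD] at h1
    exact (Units.mul_right_inj b.form).1 h1
  · rintro H b' hb'
    obtain rfl : b = b' := by simpa using hb'
    rw [h, H, form_mul_logD]

/-- The isometric part of an infinitesimal gauge transformation. -/
theorem average_mem_infGauge [CharZero k] (v : Fin n → PS n k) {G : Mat d (PS n k)}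
    (hG : G ∈ homDeg d (PS n k) 0) :
    (v, (2⁻¹ : k) • (G + (logD b v - adj b.form G))) ∈ infGauge M (some b) := by
  rw [mem_infGauge_some_iff]
  refine ⟨homDeg_smul_field_mem _ (add_mem hG (sub_mem (logD_even b v)
    (adj_mem_homDeg b.homogeneous hG))), ?_⟩
  rw [adj_smul_scalar, adj_add, adj_sub, adj_adj_form, adj_logD, ← smul_add]
  have : adj b.form G + (logD b v - G) + (G + (logD b v - adj b.form G)) =
      logD b v + logD b v := by abel
  rw [this, smul_add, half_add_half]

theorem infAct_average [CharZero k] (v : Fin n → PS n k) (G : Mat d (PS n k)) :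
    infAct M (v, (2⁻¹ : k) • (G + (logD b v - adj b.form G))) =
      (2⁻¹ : k) • (infAct M (v, G) + b.kind.sign • adj b.form (infAct M (v, G))) := by
  rw [adj_infAct, ← map_add, ← map_smul]
  congr 1
  ext1
  · change v = (2⁻¹ : k) • (v + v)
    rw [smul_add]
    funext i
    exact (half_add_half (k := k) (v i)).symm
  · rfl

/-- If a gauge pair produces `f` and `s f^adj = f`, then its dual also produces `f`, and so does
their average, which is isometric. This is why forgetting the form is injective on tangent spaces.
-/
theorem tangentBoundaries_some_of_none [CharZero k] {f : Mat d (PS n k)}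
    (hf : f ∈ tangentBoundaries M none) (hadj : adj b.form f = b.kind.sign • f) :
    f ∈ tangentBoundaries M (some b) := by
  obtain ⟨⟨v, G⟩, hG, rfl⟩ := hf
  refine ⟨_, average_mem_infGauge b v hG.1, ?_⟩
  rw [infAct_average, hadj, smul_smul, b.kind.sign_mul_self, one_smul, smul_add, half_add_half]

theorem tangentCocycles_le_none : tangentCocycles M (some b) ≤ tangentCocycles M none :=
  fun _ hf => ⟨hf.1, hf.2.1, by simp⟩

theorem tangentForget_mk (f : tangentCocycles M (some b)) :
    tangentForget b (tangentMk M (some b) f) =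
      tangentMk M none ⟨f, tangentCocycles_le_none b f.2⟩ := rfl

theorem adj_mem_tangentCocycles {f : Mat d (PS n k)} (hf : f ∈ tangentCocycles M none) :
    adj b.form f ∈ tangentCocycles M none := by
  obtain ⟨h1, ⟨h, hh⟩, -⟩ := hf
  refine ⟨adj_mem_homDeg b.homogeneous h1, ⟨b.kind.sign • h, ?_⟩, by simp⟩
  have h2 := congrArg (adj b.form) hh
  rw [adj_add, adj_mul, adj_mul, b.adj_Q, adj_smul_one, mul_smul_comm, smul_mul_assoc,
    ← smul_add] at h2
  rw [smul_assoc, ← h2, smul_smul, b.kind.sign_mul_self, one_smul, add_comm]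

theorem tangentAdj_mk (f : tangentCocycles M none) :
    tangentAdj b (tangentMk M none f) =
      tangentMk M none ⟨adj b.form f, adj_mem_tangentCocycles b f.2⟩ := by
  refine congrArg (Quotient.mk _) (Deformation.ext ?_)
  change ((Deformation.ofCocycle f).firstOrderAdj b).Q = Q0 M + _
  rw [Deformation.firstOrderAdj_Q, ← adj_smul_const]
  congr 2
  exact add_sub_cancel_left _ _

/-- Projection of matrices on the part where the adjunction is multiplication by `s`. -/
def symmetrize (s : ℤ) (X : Mat d (PS n k)) : Mat d (PS n k) :=
  (2⁻¹ : k) • (X + s • adj b.form X)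

theorem adj_symmetrize {s : ℤ} (hs : s * s = 1) (X : Mat d (PS n k)) :
    adj b.form (symmetrize b s X) = s • symmetrize b s X := by
  rw [symmetrize, adj_smul_scalar, adj_add, adj_zsmul, adj_adj_form, smul_comm s, smul_add s,
    smul_smul, hs, one_smul, add_comm]

theorem symmetrize_eq_self [CharZero k] {s : ℤ} (hs : s * s = 1) {X : Mat d (PS n k)}
    (hX : adj b.form X = s • X) : symmetrize b s X = X := by
  rw [symmetrize, hX, smul_smul, hs, one_smul, smul_add, half_add_half]

theorem symmetrize_homDeg (s : ℤ) {i : ZMod 2} {X : Mat d (PS n k)}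
    (hX : X ∈ homDeg d (PS n k) i) : symmetrize b s X ∈ homDeg d (PS n k) i :=
  homDeg_smul_field_mem _ (add_mem hX (zsmul_mem (adj_mem_homDeg b.homogeneous hX) _))

/-- Since `Q^adj = s Q`, the anticommutator with `Q` carries `s • adj` to `adj`. Consequently a
selfadjoint even coboundary has a primitive `z` with `z^adj = s z`. -/
theorem symmetrize_anticommutator (X : Mat d (PS n k)) :
    M.Q * symmetrize b b.kind.sign X + symmetrize b b.kind.sign X * M.Q =
      symmetrize b 1 (M.Q * X + X * M.Q) := by
  have h : adj b.form (M.Q * X + X * M.Q) =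
      b.kind.sign • (M.Q * adj b.form X + adj b.form X * M.Q) := by
    rw [adj_add, adj_mul, adj_mul, b.adj_Q, mul_smul_comm, smul_mul_assoc, ← smul_add, add_comm]
  rw [symmetrize, symmetrize, h, one_smul, mul_smul_comm, smul_mul_assoc, ← smul_add, mul_add,
    add_mul, mul_smul_comm, smul_mul_assoc]
  simp only [smul_add]
  abel

theorem tangentForget_injective [CharZero k] (hd : 1 ≤ d) : Function.Injective (tangentForget b) := by
  rw [injective_iff_map_eq_zero]
  intro x hx
  obtain ⟨f, rfl⟩ := tangentMk_surjective hd x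
  rw [tangentForget_mk, tangentMk_eq_zero_iff] at hx
  rw [tangentMk_eq_zero_iff]
  exact tangentBoundaries_some_of_none b hx (f.2.2.2 b rfl)

theorem range_tangentForget [CharZero k] (hd : 1 ≤ d) :
    LinearMap.range (tangentForget b) = tangentPart b b.kind.sign := by
  apply le_antisymm
  · rintro _ ⟨x, rfl⟩
    obtain ⟨f, rfl⟩ := tangentMk_surjective hd x
    rw [tangentPart, LinearMap.mem_ker, LinearMap.sub_apply, tangentForget_mk, tangentAdj_mk,
      sub_eq_zero]
    change tangentMk M none _ = b.kind.sign • tangentMk M none _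
    rw [← map_zsmul]
    congr 1
    exact Subtype.ext (f.2.2.2 b rfl)
  · intro x hx
    obtain ⟨f, rfl⟩ := tangentMk_surjective hd x
    rw [tangentPart, LinearMap.mem_ker, LinearMap.sub_apply, tangentAdj_mk, sub_eq_zero] at hx
    set g : tangentCocycles M none := ⟨adj b.form f, adj_mem_tangentCocycles b f.2⟩ with hg
    have h1 : ((2⁻¹ : k) • (f + b.kind.sign • g) : tangentCocycles M none).1 ∈
        tangentCocycles M none := Subtype.property _
    have h2 : ((2⁻¹ : k) • (f + b.kind.sign • g) : tangentCocycles M none).1 =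
      symmetrize b b.kind.sign f := rfl
    have h3 : symmetrize b b.kind.sign f ∈ tangentCocycles M (some b) := by
      rw [h2] at h1
      refine ⟨h1.1, h1.2.1, ?_⟩
      rintro b' hb'
      obtain rfl : b = b' := by simpa using hb'
      exact adj_symmetrize b b.kind.sign_mul_self _
    refine ⟨tangentMk M (some b) ⟨_, h3⟩, ?_⟩
    rw [tangentForget_mk]
    -- The adjunction multiplies the class of `f` by `s`, so symmetrizing `f` does not change its
    -- class.
    have h4 : tangentMk M none ((2⁻¹ : k) • (f + b.kind.sign • g)) = tangentMk M none f := by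
      rw [map_smul, map_add, map_zsmul, hx]
      change (2⁻¹ : k) • (tangentMk M none f +
        b.kind.sign • (b.kind.sign • tangentMk M none f)) = _
      rw [smul_smul, b.kind.sign_mul_self, one_smul, smul_add, half_add_half]
    exact h4

end selfadjoint

/-! ### Finiteness of the Milnor algebra -/

open scoped IntermediateField.algebraAdjoinAdjoin in
/-- In characteristic zero, there is a derivation not vanishing at a given transcendental
element. -/
theorem exists_derivation_eq_one {k K : Type*} [Field k] [CharZero k] [Field K] [Algebra k K]
    {x : K} (hx : Transcendental k x) : ∃ δ : Derivation k K K, δ x = 1 := by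
  classical
  -- `x` is completed to a transcendence basis `s`, so that the derivation sought can extend the
  -- partial derivative with respect to `x` on the polynomial ring `k[s]`.
  obtain ⟨s, hxs, hs⟩ := exists_isTranscendenceBasis_superset (R := k) (A := K) (s := {x})
    (by
      rw [AlgebraicIndepOn, algebraicIndependent_singleton_iff (⟨x, rfl⟩ : ({x} : Set K))]
      exact hx)
  let i : s := ⟨x, hxs rfl⟩
  let A := Algebra.adjoin k (Set.range ((↑) : s → K))
  have : Algebra.IsAlgebraic (IntermediateField.adjoin k (Set.range ((↑) : s → K))) K :=
    hs.isAlgebraic_field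
  have : Algebra.FormallyEtale (IntermediateField.adjoin k (Set.range ((↑) : s → K))) K :=
    Algebra.FormallyEtale.of_isSeparable _ K
  have : Algebra.FormallyEtale A (IntermediateField.adjoin k (Set.range ((↑) : s → K))) :=
    .of_isLocalization (nonZeroDivisors _)
  -- `K` is algebraic over `k(s)`, hence separable in characteristic zero, and `k(s)` is a
  -- localization of `k[s]`. So `k[s] → K` is formally étale and derivations extend along it.
  have : Algebra.FormallyEtale A K :=
    .comp _ (IntermediateField.adjoin k (Set.range ((↑) : s → K))) _
  let e : MvPolynomial s k ≃ₐ[k] A := hs.1.aevalEquiv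
  -- The partial derivative with respect to `x`, transported to the subalgebra generated by `s`.
  let δA : Derivation k A A := Derivation.mk'
    (e.toLinearMap ∘ₗ (MvPolynomial.pderiv i).toLinearMap ∘ₗ e.symm.toLinearMap) (by
      intro a b
      simp only [LinearMap.comp_apply, AlgEquiv.toLinearMap_apply, Derivation.coeFn_coe, map_mul,
        Derivation.leibniz, smul_eq_mul, map_add, AlgEquiv.apply_symm_apply])
  let δ' : Derivation k A K := (Algebra.linearMap A K).compDer δA
  let φ : K ⊗[A] (Ω[A⁄k]) →ₗ[K] K := δ'.liftKaehlerDifferential.liftBaseChange K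
  let ψ : Ω[K⁄k] →ₗ[K] K :=
    φ ∘ₗ (KaehlerDifferential.tensorKaehlerEquivOfFormallyEtale k A K).symm.toLinearMap
  refine ⟨ψ.compDer (KaehlerDifferential.D k K), ?_⟩
  have hx' : x = algebraMap A K (e (MvPolynomial.X i)) := by
    change x = (hs.1.aevalEquiv (MvPolynomial.X i) : K)
    simp [i]
  change φ ((KaehlerDifferential.tensorKaehlerEquivOfFormallyEtale k A K).symm
    (KaehlerDifferential.D k K x)) = 1
  rw [hx', KaehlerDifferential.tensorKaehlerEquivOfFormallyEtale_symm_D_algebraMap]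
  have hδA : δA (e (MvPolynomial.X i)) = 1 := by
    change e (MvPolynomial.pderiv i (e.symm (e (MvPolynomial.X i)))) = 1
    rw [AlgEquiv.symm_apply_apply, MvPolynomial.pderiv_X_self, map_one]
  simp [φ, δ', hδA]

theorem derivation_aeval {k K : Type*} [CommRing k] [CommRing K] [Algebra k K] {ι : Type*}
    [Fintype ι] (δ : Derivation k K K) (x : ι → K) (p : MvPolynomial ι k) :
    δ (MvPolynomial.aeval x p) =
      ∑ i, MvPolynomial.aeval x (MvPolynomial.pderiv i p) * δ (x i) := by
  classical
  induction p using MvPolynomial.induction_on with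
  | C a => simp
  | add p q hp hq => simp only [map_add, hp, hq, add_mul, Finset.sum_add_distrib]
  | mul_X p j hp =>
    simp only [map_mul, Derivation.leibniz, hp, MvPolynomial.aeval_X, smul_eq_mul, map_add,
      MvPolynomial.pderiv_X, add_mul, Finset.sum_add_distrib]
    congr 1
    · rw [Finset.sum_eq_single j]
      · simp
      · intro i _ hij
        simp [hij.symm]
      · simp
    · rw [Finset.mul_sum]
      refine Finset.sum_congr rfl fun i _ => ?_
      ring

section milnor
variable {k : Type u} [Field k] [IsAlgClosed k] [CharZero k] {n : ℕ} {w : MvPolynomial (Fin n) k}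

/-- In the fraction field of `R/P` the chain rule makes every `k`-derivation vanish on `w`. In
characteristic zero this makes `w` algebraic over `k`, that is, a constant of `k`, and `w(0) = 0`
makes the constant zero. -/
theorem mem_prime_of_jacobianIdeal_le (hw : MvPolynomial.constantCoeff w = 0)
    {P : Ideal (PS n k)} [P.IsPrime] (hP : jacobianIdeal w ≤ P) : (w : PS n k) ∈ P := by
  let K := FractionRing (PS n k ⧸ P)
  let u : PS n k →ₐ[k] K :=
    (IsScalarTower.toAlgHom k (PS n k ⧸ P) K).comp (Ideal.Quotient.mkₐ k P)
  have hu : ∀ f, u f = 0 ↔ f ∈ P := by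
    intro f
    rw [← Ideal.Quotient.eq_zero_iff_mem]
    exact map_eq_zero_iff _ (IsFractionRing.injective (PS n k ⧸ P) K)
  have hcoe : ∀ p : MvPolynomial (Fin n) k,
      u (p : PS n k) = MvPolynomial.aeval (fun i => u (MvPowerSeries.X i)) p := by
    intro p
    have : (u.comp (MvPolynomial.coeToMvPowerSeries.algHom k)) =
        MvPolynomial.aeval (fun i => u (MvPowerSeries.X i)) := by
      ext i
      simp
    rw [← this]
    simp
  -- The chain rule applies because `w` is a polynomial: an arbitrary derivation of `K` need not be
  -- compatible with infinite sums.
  have hder : ∀ δ : Derivation k K K, δ (u (w : PS n k)) = 0 := by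
    intro δ
    rw [hcoe, derivation_aeval]
    refine Finset.sum_eq_zero fun i _ => ?_
    rw [← hcoe, (hu _).2 (hP (Ideal.subset_span ⟨i, rfl⟩)), zero_mul]
  by_cases htr : Transcendental k (u (w : PS n k))
  · obtain ⟨δ, hδ⟩ := exists_derivation_eq_one htr
    exact absurd ((hder δ).symm.trans hδ) zero_ne_one
  · rw [Transcendental, not_not] at htr
    obtain ⟨c, hc⟩ : ∃ c : k, algebraMap k K c = u (w : PS n k) := by
      have := IntermediateField.isAlgebraic_adjoin_simple htr.isIntegral
      have h2 := IntermediateField.eq_bot_of_isAlgClosed_of_isAlgebraic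
        (IntermediateField.adjoin k {u (w : PS n k)})
      exact IntermediateField.mem_bot.1
        (h2 ▸ IntermediateField.mem_adjoin_simple_self k (u (w : PS n k)))
    have h1 : (w : PS n k) - algebraMap k _ c ∈ P := by
      rw [← hu, map_sub, AlgHom.commutes, hc, sub_self]
    by_cases h0 : c = 0
    · simpa [h0] using h1
    -- For `c ≠ 0` the element `w - c` of `P` would be a unit, as its constant term is `-c`.
    · refine absurd (Ideal.eq_top_of_isUnit_mem _ h1 ?_) (Ideal.IsPrime.ne_top ‹_›)
      rw [MvPowerSeries.isUnit_iff_constantCoeff]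
      have : MvPowerSeries.constantCoeff (w : PS n k) = 0 := by
        rw [← MvPowerSeries.coeff_zero_eq_constantCoeff_apply, MvPolynomial.coeff_coe, ← hw]
        rfl
      rw [map_sub, this, zero_sub, MvPowerSeries.algebraMap_apply]
      simpa using h0

theorem exists_pow_mem_jacobianIdeal (hw : MvPolynomial.constantCoeff w = 0) :
    ∃ N, (w : PS n k) ^ N ∈ jacobianIdeal w := by
  change (w : PS n k) ∈ (jacobianIdeal w).radical
  rw [Ideal.radical_eq_sInf, Submodule.mem_sInf]
  rintro P ⟨hP, hP'⟩
  exact mem_prime_of_jacobianIdeal_le hw hP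

/-- `w` is nilpotent modulo `(∂w)`, so the Tjurina and Jacobian ideals have the same radical; primes
over the Tjurina ideal are maximal because its quotient is Artinian. -/
theorem exists_X_pow_mem_jacobianIdeal (hw : MvPolynomial.constantCoeff w = 0)
    (hiso : IsolatedSingularity w) :
    ∃ N, ∀ i : Fin n, (MvPowerSeries.X i : PS n k) ^ N ∈ jacobianIdeal w := by
  have : Module.Finite k (PS n k ⧸ tjurinaIdeal w) := hiso
  have h1 : ∀ i : Fin n, (MvPowerSeries.X i : PS n k) ∈ (tjurinaIdeal w).radical := by
    intro i
    rw [Ideal.radical_eq_sInf, Submodule.mem_sInf]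
    rintro P ⟨hP, hP'⟩
    have : IsArtinianRing (PS n k ⧸ tjurinaIdeal w) := IsArtinianRing.of_finite k _
    have : IsArtinianRing (PS n k ⧸ P) :=
      (Ideal.Quotient.factor_surjective hP).isArtinianRing
    have hmax : Ideal.IsMaximal P := Ideal.Quotient.maximal_of_isField _ (IsArtinianRing.isField_of_isDomain _)
    rw [IsLocalRing.eq_maximalIdeal hmax, mem_maximalIdeal, mem_nonunits_iff,
      MvPowerSeries.isUnit_iff_constantCoeff]
    simp
  obtain ⟨M, hM⟩ := exists_pow_mem_jacobianIdeal hw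
  have h2 : ∀ i : Fin n, (MvPowerSeries.X i : PS n k) ∈ (jacobianIdeal w).radical := by
    intro i
    refine Ideal.radical_le_radical_iff.2 ?_ (h1 i)
    exact sup_le (Ideal.span_singleton_le_iff_mem _ |>.2 ⟨M, hM⟩) Ideal.le_radical
  choose N hN using h2
  -- The sum of the exponents is a common exponent for all variables.
  refine ⟨∑ i, N i, fun i => ?_⟩
  rw [← Finset.add_sum_erase _ _ (Finset.mem_univ i), pow_add]
  exact Ideal.mul_mem_right _ _ (hN i)

end milnor

/-! ### Koszul syzygies -/

section koszul
variable {R : Type*} [CommRing R] {n : ℕ}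

/-- The linear form `e_i ↦ f_i`. -/
def koszulForm (f : Fin n → R) : Module.Dual R (Fin n → R) := Fintype.linearCombination R f

theorem koszulForm_apply (f v : Fin n → R) : koszulForm f v = ∑ i, v i * f i := by
  simp [koszulForm, Fintype.linearCombination_apply]

/-- The module of trivial relations between the `f_i`. -/
def koszulRel (f : Fin n → R) : Submodule R (Fin n → R) :=
  Submodule.span R (Set.range fun x : (Fin n → R) × (Fin n → R) =>
    koszulForm f x.1 • x.2 - koszulForm f x.2 • x.1)

/-- The Koszul differential on the exterior algebra. -/
def koszulD (f : Fin n → R) :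
    ExteriorAlgebra R (Fin n → R) →ₗ[R] ExteriorAlgebra R (Fin n → R) :=
  CliffordAlgebra.contractLeft (Q := (0 : QuadraticForm R (Fin n → R))) (koszulForm f)

theorem koszulD_ι_mul (f v : Fin n → R) (z : ExteriorAlgebra R (Fin n → R)) :
    koszulD f (ExteriorAlgebra.ι R v * z) =
      koszulForm f v • z - ExteriorAlgebra.ι R v * koszulD f z :=
  CliffordAlgebra.contractLeft_ι_mul _ _ _

theorem koszulD_koszulD (f : Fin n → R) (z : ExteriorAlgebra R (Fin n → R)) :
    koszulD f (koszulD f z) = 0 := CliffordAlgebra.contractLeft_contractLeft _ _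

theorem koszulD_ι (f v : Fin n → R) :
    koszulD f (ExteriorAlgebra.ι R v) = algebraMap R _ (koszulForm f v) :=
  CliffordAlgebra.contractLeft_ι _ _ _

/-- `ExteriorAlgebra.toTrivSqZeroExt` keeps the components of degrees 0 and 1. From `d(m ∧ x) = f(m)
x - m ∧ dx`, the degree 1 part of a boundary is `f(m) x₁ - (dx)₀ m`. The second claim, `(dx)₀ =
f(x₁)`, is carried through the induction to recognize this as a trivial relation. -/
theorem snd_koszulD_mem (f : Fin n → R) (z : ExteriorAlgebra R (Fin n → R)) :
    (ExteriorAlgebra.toTrivSqZeroExt (koszulD f z)).snd ∈ koszulRel f ∧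
    (ExteriorAlgebra.toTrivSqZeroExt (koszulD f z)).fst =
      koszulForm f (ExteriorAlgebra.toTrivSqZeroExt z).snd := by
  induction z using CliffordAlgebra.left_induction with
  | algebraMap r =>
    have : koszulD f (algebraMap R (CliffordAlgebra (0 : QuadraticForm R (Fin n → R))) r) = 0 :=
      CliffordAlgebra.contractLeft_algebraMap _ _ _
    rw [this, map_zero, AlgHom.commutes]
    simp [TrivSqZeroExt.algebraMap_eq_inl]
  | add x y hx hy =>
    simp only [map_add, TrivSqZeroExt.snd_add, TrivSqZeroExt.fst_add, hx.2, hy.2, and_true]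
    exact add_mem hx.1 hy.1
  | ι_mul x m hx =>
    change (ExteriorAlgebra.toTrivSqZeroExt (koszulD f (ExteriorAlgebra.ι R m * x))).snd ∈ _ ∧
      (ExteriorAlgebra.toTrivSqZeroExt (koszulD f (ExteriorAlgebra.ι R m * x))).fst =
      koszulForm f (ExteriorAlgebra.toTrivSqZeroExt (ExteriorAlgebra.ι R m * x)).snd
    rw [koszulD_ι_mul, map_sub, map_smul, map_mul, map_mul, ExteriorAlgebra.toTrivSqZeroExt_ι]
    simp only [TrivSqZeroExt.snd_sub, TrivSqZeroExt.snd_smul, TrivSqZeroExt.snd_mul,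
      TrivSqZeroExt.fst_inr, TrivSqZeroExt.snd_inr, zero_smul, zero_add, op_smul_eq_smul,
      TrivSqZeroExt.fst_sub, TrivSqZeroExt.fst_smul, TrivSqZeroExt.fst_mul, zero_mul, sub_zero,
      hx.2, map_smul, smul_eq_mul]
    exact ⟨Submodule.subset_span ⟨(m, _), rfl⟩, mul_comm _ _⟩

end koszul

theorem mem_smul_top_iff_repr {R E ι : Type*} [CommRing R] [AddCommGroup E] [Module R E]
    (B : Module.Basis ι R E) (I : Ideal R) (z : E) :
    z ∈ I • (⊤ : Submodule R E) ↔ ∀ i, B.repr z i ∈ I := by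
  constructor
  · intro hz i
    refine Submodule.smul_induction_on hz (fun r hr m _ => ?_) fun x y hx hy => ?_
    · simpa using I.mul_mem_right _ hr
    · simpa using I.add_mem hx hy
  · intro h
    rw [← B.linearCombination_repr z, Finsupp.linearCombination_apply]
    exact sum_mem fun i _ => Submodule.smul_mem_smul (h i) trivial

/-! ### Powers of the variables as a regular sequence, and relations between the generators -/

section syzygies
open scoped Pointwise
variable {k : Type*} [Field k] {n : ℕ}

/-- The ideal of the power series divisible by `(x_0 ^ N, …, x_{r-1} ^ N)`. -/
def boxIdeal (k : Type*) [Field k] (n N r : ℕ) : Ideal (PS n k) where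
  carrier := {f | ∀ e : Fin n →₀ ℕ, (∀ j : Fin n, (j : ℕ) < r → e j < N) →
    MvPowerSeries.coeff e f = 0}
  add_mem' := by
    intro f g hf hg e he
    rw [map_add, hf e he, hg e he, add_zero]
  zero_mem' := fun e _ => map_zero _
  smul_mem' := by
    intro c f hf e he
    rw [smul_eq_mul, MvPowerSeries.coeff_mul]
    refine Finset.sum_eq_zero fun x hx => ?_
    rw [hf x.2, mul_zero]
    intro j hj
    refine lt_of_le_of_lt ?_ (he j hj)
    rw [← Finset.HasAntidiagonal.mem_antidiagonal.1 hx]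
    simp

theorem boxIdeal_zero (N : ℕ) : boxIdeal k n N 0 = ⊥ := by
  rw [eq_bot_iff]
  intro f hf
  rw [Ideal.mem_bot]
  ext e
  exact hf e (fun j hj => absurd hj (Nat.not_lt_zero _))

theorem X_pow_mem_boxIdeal {N r : ℕ} (j : Fin n) (hj : (j : ℕ) < r) :
    (MvPowerSeries.X j : PS n k) ^ N ∈ boxIdeal k n N r := by
  intro e he
  exact MvPowerSeries.X_pow_dvd_iff.1 dvd_rfl e (he j hj)

theorem boxIdeal_mono {N r s : ℕ} (h : r ≤ s) : boxIdeal k n N r ≤ boxIdeal k n N s :=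
  fun _ hf e he => hf e fun j hj => he j (hj.trans_le h)

theorem boxIdeal_succ {N : ℕ} (j : Fin n) :
    boxIdeal k n N (j + 1) =
      boxIdeal k n N j ⊔ Ideal.span {(MvPowerSeries.X j : PS n k) ^ N} := by
  apply le_antisymm
  · intro f hf
    classical
    -- `g` collects the monomials divisible by `X j ^ N`; in the remaining part the exponent of `X
    -- j` is below `N`, so the condition for `j + 1` reduces to the one for `j`.
    let g : PS n k := fun e => if e j < N then 0 else MvPowerSeries.coeff e f
    have hg : ∀ e, MvPowerSeries.coeff e g = if e j < N then 0 else MvPowerSeries.coeff e f :=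
      fun e => rfl
    have h1 : f - g ∈ boxIdeal k n N j := by
      intro e he
      rw [map_sub, hg]
      split_ifs with h
      · rw [sub_zero]
        refine hf e fun i hi => ?_
        rcases Nat.lt_succ_iff_lt_or_eq.1 hi with h' | h'
        · exact he i h'
        · rwa [Fin.ext h']
      · rw [sub_self]
    have h2 : g ∈ Ideal.span {(MvPowerSeries.X j : PS n k) ^ N} := by
      rw [Ideal.mem_span_singleton, MvPowerSeries.X_pow_dvd_iff]
      intro m hm
      rw [hg, if_pos hm]
    rw [← sub_add_cancel f g]
    exact Submodule.add_mem_sup h1 h2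
  · refine sup_le (boxIdeal_mono (Nat.le_succ _)) ?_
    rw [Ideal.span_singleton_le_iff_mem]
    exact X_pow_mem_boxIdeal j (Nat.lt_succ_self _)

/-- Shifting exponents in the direction `j` leaves the conditions on the earlier variables
untouched. Thus `X j ^ N` is a nonzerodivisor modulo the powers of the earlier variables. -/
theorem mem_boxIdeal_of_X_pow_mul {N : ℕ} (j : Fin n) {f : PS n k}
    (h : (MvPowerSeries.X j : PS n k) ^ N * f ∈ boxIdeal k n N j) : f ∈ boxIdeal k n N j := by
  classical
  intro e he
  have := h (Finsupp.single j N + e) (by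
    intro i hi
    have : i ≠ j := by
      rintro rfl
      exact lt_irrefl _ hi
    simpa [Finsupp.single_apply, this.symm] using he i hi)
  rwa [MvPowerSeries.X_pow_eq, MvPowerSeries.coeff_add_monomial_mul, one_mul] at this

theorem boxIdeal_le {N r : ℕ} (hr : r ≤ n) {I : Ideal (PS n k)}
    (hI : ∀ i : Fin n, (MvPowerSeries.X i : PS n k) ^ N ∈ I) : boxIdeal k n N r ≤ I := by
  induction r with
  | zero => rw [boxIdeal_zero]; exact bot_le
  | succ r ih =>
    rw [boxIdeal_succ (⟨r, hr⟩ : Fin n)]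
    refine sup_le (ih (Nat.le_of_succ_le hr)) ?_
    rw [Ideal.span_singleton_le_iff_mem]
    exact hI _

theorem finite_quotient_of_X_pow_mem {N : ℕ} {I : Ideal (PS n k)}
    (hI : ∀ i : Fin n, (MvPowerSeries.X i : PS n k) ^ N ∈ I) : Module.Finite k (PS n k ⧸ I) := by
  -- `φ` records the coefficients with all exponents below `N`; a series where these vanish lies in
  -- the ideal of the `N`-th powers of the variables.
  let φ : PS n k →ₗ[k] ((Fin n → Fin N) → k) := LinearMap.pi fun e =>
    MvPowerSeries.coeff (Finsupp.equivFunOnFinite.symm fun i => (e i : ℕ))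
  have h1 : LinearMap.ker φ ≤ I.restrictScalars k := by
    intro f hf
    refine boxIdeal_le le_rfl hI ?_
    intro e he
    have := congrFun (LinearMap.mem_ker.1 hf) fun i => ⟨e i, he i i.2⟩
    change MvPowerSeries.coeff (Finsupp.equivFunOnFinite.symm fun i => e i) f = 0 at this
    convert this
    ext i
    rfl
  have h2 : Module.Finite k (PS n k ⧸ LinearMap.ker φ) :=
    Module.Finite.equiv φ.quotKerEquivRange.symm
  exact Module.Finite.of_surjective (Submodule.mapQ _ (I.restrictScalars k) LinearMap.id h1)
    (fun x => by
      obtain ⟨f, rfl⟩ := Ideal.Quotient.mk_surjective x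
      exact ⟨Submodule.Quotient.mk f, rfl⟩)

/-- If powers of all variables lie in `(f_1, …, f_n)`, all relations between the `f_i` are
trivial. -/
theorem mem_koszulRel {f : Fin n → PS n k} {N : ℕ}
    (hf : ∀ i : Fin n, (MvPowerSeries.X i : PS n k) ^ N ∈ Ideal.span (Set.range f))
    {v : Fin n → PS n k} (hv : ∑ i, v i * f i = 0) : v ∈ koszulRel f := by
  choose c hc using fun i => Ideal.mem_span_range_iff_exists_fun.1 (hf i)
  set E := ExteriorAlgebra (PS n k) (Fin n → PS n k)
  let B : Module.Basis (Finset (Fin n)) (PS n k) E := (Pi.basisFun (PS n k) (Fin n)).ExteriorAlgebra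
  have hmap : ∀ (I : Ideal (PS n k)) (φ : E →ₗ[PS n k] E) (z : E), z ∈ I • (⊤ : Submodule (PS n k) E) →
      φ z ∈ I • (⊤ : Submodule (PS n k) E) := by
    intro I φ z hz
    have := Submodule.mem_map_of_mem (f := φ) hz
    rw [Submodule.map_smul''] at this
    exact Submodule.smul_mono (le_refl I) le_top this
  -- Descending induction on `r`: modulo the first `r` powers `X i ^ N`, a cycle of degree `r + 1`
  -- is a boundary. At `r = n` there is nothing in degree `n + 1`; the case `r = 0` is the claim.
  have key : ∀ m r, r + m = n → ∀ z : E, z ∈ ⋀[PS n k]^(r + 1) (Fin n → PS n k) →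
      koszulD f z ∈ boxIdeal k n N r • (⊤ : Submodule (PS n k) E) →
      ∃ y, z - koszulD f y ∈ boxIdeal k n N r • (⊤ : Submodule (PS n k) E) := by
    intro m
    induction m with
    | zero =>
      rintro r rfl z hz -
      refine ⟨0, ?_⟩
      have hb := (Pi.basisFun (PS r k) (Fin r)).exteriorPower (r + 1)
      have : IsEmpty (Set.powersetCard (Fin r) (r + 1)) := by
        refine ⟨fun s => ?_⟩
        have h1 := Finset.card_le_univ (s : Finset (Fin r))
        rw [Set.powersetCard.card_eq s, Fintype.card_fin] at h1
        omega
      have : Subsingleton (⋀[PS r k]^(r + 1) (Fin r → PS r k)) := hb.repr.toEquiv.subsingleton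
      have hz0 : z = 0 := congrArg Subtype.val (Subsingleton.elim (⟨z, hz⟩ : ⋀[PS r k]^(r + 1) (Fin r → PS r k)) 0)
      rw [hz0, map_zero, sub_zero]
      exact zero_mem _
    | succ m ih =>
      rintro r hr z hz hdz
      let j : Fin n := ⟨r, by omega⟩
      have hcz : koszulForm f (c j) = (MvPowerSeries.X j : PS n k) ^ N := by
        rw [koszulForm_apply, hc]
      -- Wedging with `c j`, on which the Koszul form takes the value `X j ^ N`, raises the degree
      -- by one and gives a cycle modulo one more power.
      have h1 : koszulD f (ExteriorAlgebra.ι _ (c j) * z) =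
          (MvPowerSeries.X j : PS n k) ^ N • z - ExteriorAlgebra.ι _ (c j) * koszulD f z := by
        rw [koszulD_ι_mul, hcz]
      have h2 : ExteriorAlgebra.ι _ (c j) * koszulD f z ∈
          boxIdeal k n N r • (⊤ : Submodule (PS n k) E) := hmap _ (LinearMap.mulLeft _ _) _ hdz
      have h3 : boxIdeal k n N (r + 1) • (⊤ : Submodule (PS n k) E) =
          boxIdeal k n N r • (⊤ : Submodule (PS n k) E) ⊔
            (MvPowerSeries.X j : PS n k) ^ N • (⊤ : Submodule (PS n k) E) := by
        rw [← Submodule.ideal_span_singleton_smul, ← Submodule.sup_smul, ← boxIdeal_succ j]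
      obtain ⟨y, hy⟩ := ih (r + 1) (by omega) (ExteriorAlgebra.ι _ (c j) * z) (by
          rw [show r + 1 + 1 = 1 + (r + 1) by ring]
          refine SetLike.mul_mem_graded ?_ hz
          simp) (by
          rw [h1, h3]
          refine sub_mem (Submodule.mem_sup_right ?_) (Submodule.mem_sup_left h2)
          exact Submodule.smul_mem_pointwise_smul _ _ _ Submodule.mem_top)
      rw [h3, Submodule.mem_sup] at hy
      obtain ⟨u₁, hu₁, u₂, hu₂, hu⟩ := hy
      obtain ⟨u, -, rfl⟩ := hu₂
      refine ⟨u, ?_⟩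
      -- Applying the differential to the relation `c j ∧ z - dy = u₁ + X j ^ N u` shows that `X j ^
      -- N (z - du)` vanishes modulo the first `r` powers; the nonzerodivisor is then cancelled in
      -- coordinates.
      have h4 : (MvPowerSeries.X j : PS n k) ^ N • (z - koszulD f u) =
          koszulD f u₁ + ExteriorAlgebra.ι _ (c j) * koszulD f z := by
        have h5 := congrArg (koszulD f) hu
        rw [map_sub, koszulD_koszulD, sub_zero, h1, map_add] at h5
        change _ + koszulD f ((MvPowerSeries.X j : PS n k) ^ N • u) = _ at h5
        rw [map_smul] at h5
        rw [smul_sub, sub_eq_iff_eq_add]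
        rw [eq_sub_iff_add_eq] at h5
        rw [← h5]
        abel
      have h6 : (MvPowerSeries.X j : PS n k) ^ N • (z - koszulD f u) ∈
          boxIdeal k n N r • (⊤ : Submodule (PS n k) E) := by
        rw [h4]
        exact add_mem (hmap _ _ _ hu₁) h2
      rw [mem_smul_top_iff_repr B] at h6 ⊢
      intro s
      have := h6 s
      rw [map_smul, Finsupp.smul_apply, smul_eq_mul] at this
      exact mem_boxIdeal_of_X_pow_mul j this
  obtain ⟨y, hy⟩ := key n 0 (zero_add n) (ExteriorAlgebra.ι _ v) (by simp) (by
    rw [koszulD_ι, koszulForm_apply, hv, map_zero]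
    exact zero_mem _)
  rw [boxIdeal_zero, Submodule.bot_smul, Submodule.mem_bot, sub_eq_zero] at hy
  have h7 := (snd_koszulD_mem f y).1
  rwa [← hy, ExteriorAlgebra.toTrivSqZeroExt_ι] at h7

end syzygies

/-! ### Annihilators and finiteness of `Ext` -/

section ext
variable {k : Type u} [Field k] {n d : ℕ} {w : MvPolynomial (Fin n) k}
  (M : MatrixFactorization w d)

theorem sgn_zero : sgn 0 = 1 := rfl

theorem sgn_one : sgn 1 = -1 := rfl

theorem sgn_succ (i : ZMod 2) : sgn (i + 1) = - sgn i := by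
  revert i
  decide

theorem MatrixFactorization.mem_Z_zero {f : Mat d (PS n k)} :
    f ∈ M.Z 0 ↔ f ∈ homDeg d (PS n k) 0 ∧ M.Q * f - f * M.Q = 0 := by
  refine and_congr_right fun _ => ?_
  change M.Q * f - sgn 0 • (f * M.Q) = 0 ↔ _
  rw [sgn_zero, one_smul]

theorem MatrixFactorization.mem_Z_one {f : Mat d (PS n k)} :
    f ∈ M.Z 1 ↔ f ∈ homDeg d (PS n k) 1 ∧ M.Q * f + f * M.Q = 0 := by
  refine and_congr_right fun _ => ?_
  change M.Q * f - sgn 1 • (f * M.Q) = 0 ↔ _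
  rw [sgn_one, neg_smul, one_smul, sub_neg_eq_add]

theorem MatrixFactorization.mem_B_zero {f : Mat d (PS n k)} :
    f ∈ M.B 0 ↔ ∃ g ∈ homDeg d (PS n k) 1, M.Q * g + g * M.Q = f := by
  have h : ∀ g, M.D (0 + 1) g = M.Q * g + g * M.Q := by
    intro g
    change M.Q * g - sgn (0 + 1) • (g * M.Q) = _
    rw [zero_add, sgn_one, neg_smul, one_smul, sub_neg_eq_add]
  constructor
  · rintro ⟨g, hg, rfl⟩
    exact ⟨g, hg, (h g).symm⟩
  · rintro ⟨g, hg, rfl⟩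
    exact ⟨g, hg, h g⟩

theorem MatrixFactorization.mem_B_one {f : Mat d (PS n k)} :
    f ∈ M.B 1 ↔ ∃ g ∈ homDeg d (PS n k) 0, M.Q * g - g * M.Q = f := by
  have h : ∀ g, M.D (1 + 1) g = M.Q * g - g * M.Q := by
    intro g
    change M.Q * g - sgn (1 + 1) • (g * M.Q) = _
    rw [show sgn (1 + 1) = 1 from rfl, one_smul]
  constructor
  · rintro ⟨g, hg, rfl⟩
    exact ⟨g, hg, (h g).symm⟩
  · rintro ⟨g, hg, rfl⟩
    exact ⟨g, hg, h g⟩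

theorem MatrixFactorization.mem_exactIdeal {h : PS n k} :
    h ∈ M.exactIdeal ↔ ∃ g ∈ homDeg d (PS n k) 1, M.Q * g + g * M.Q = h • 1 := by
  rw [← M.mem_B_zero]
  rfl

/-- Differentiate `Q² = w` along `v`. -/
theorem matD_Q (v : Fin n → PS n k) :
    M.Q * matD v M.Q + matD v M.Q * M.Q = vf v (w : PS n k) • 1 := by
  rw [← matD_smul_one, ← M.sq, matD_mul, add_comm]

/-- The commutator `[G, Q]` anticommutes with `Q` because `Q²` is central, so a gauge direction
changes the potential only through `v(w)`. -/
theorem infAct_anticommutator (v : Fin n → PS n k) (G : Mat d (PS n k)) :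
    M.Q * infAct M (v, G) + infAct M (v, G) * M.Q = vf v (w : PS n k) • 1 := by
  rw [infAct_apply, ← matD_Q]
  have h : G * (M.Q * M.Q) = (M.Q * M.Q) * G := by
    rw [M.sq, mul_smul_comm, smul_mul_assoc, mul_one, one_mul]
  have : M.Q * (matD v M.Q + (G * M.Q - M.Q * G)) + (matD v M.Q + (G * M.Q - M.Q * G)) * M.Q =
      M.Q * matD v M.Q + matD v M.Q * M.Q + (G * (M.Q * M.Q) - M.Q * M.Q * G) := by
    noncomm_ring
  rw [this, h, sub_self, add_zero]

theorem vf_potential (v : Fin n → PS n k) :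
    vf v (w : PS n k) = ∑ i, v i * (MvPolynomial.pderiv i w : PS n k) := by
  rw [vf_apply]
  refine Finset.sum_congr rfl fun i _ => ?_
  rw [MvPowerSeries.pderiv_coe]

theorem mem_jacobianIdeal_iff {h : PS n k} :
    h ∈ jacobianIdeal w ↔ ∃ v : Fin n → PS n k, vf v (w : PS n k) = h := by
  simp_rw [vf_potential]
  exact Ideal.mem_span_range_iff_exists_fun

theorem jacobianIdeal_le_exactIdeal : jacobianIdeal w ≤ M.exactIdeal := by
  intro h hh
  obtain ⟨v, rfl⟩ := mem_jacobianIdeal_iff.1 hh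
  exact M.mem_exactIdeal.2 ⟨_, matD_mem_homDeg v M.odd, matD_Q M v⟩

/-- The potential itself is exact, with primitive `Q / 2`; the `∂ᵢw` have the primitives `∂ᵢQ`. -/
theorem tjurinaIdeal_le_exactIdeal [CharZero k] : tjurinaIdeal w ≤ M.exactIdeal := by
  refine sup_le ?_ (jacobianIdeal_le_exactIdeal M)
  rw [Ideal.span_singleton_le_iff_mem, M.mem_exactIdeal]
  refine ⟨(2⁻¹ : k) • M.Q, homDeg_smul_field_mem _ M.odd, ?_⟩
  rw [mul_smul_comm, smul_mul_assoc, half_add_half, M.sq]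

/-- A primitive `g` of `h` is a homotopy between multiplication by `h` and zero: `D(g f) = h f` for
every cocycle `f`. -/
theorem exactIdeal_smul_mem_B {i : ZMod 2} {h : PS n k} (hh : h ∈ M.exactIdeal)
    {f : Mat d (PS n k)} (hf : f ∈ M.Z i) : h • f ∈ M.B i := by
  obtain ⟨g, hg, hgh⟩ := M.mem_exactIdeal.1 hh
  refine ⟨g * f, ?_, ?_⟩
  · rw [add_comm]
    exact mul_mem_homDeg hg hf.1
  · have h1 : M.Q * f - sgn i • (f * M.Q) = 0 := hf.2
    have h2 : M.D (i + 1) (g * f) = M.Q * (g * f) - sgn (i + 1) • (g * f * M.Q) := rfl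
    rw [h2, sgn_succ, neg_smul, sub_neg_eq_add, mul_assoc, ← mul_smul_comm, ← sub_eq_zero.1 h1,
      ← mul_assoc, ← mul_assoc, ← add_mul, hgh, smul_mul_assoc, one_mul]

theorem finite_of_annihilated {R E : Type*} [CommRing R] [AddCommGroup E] [Module R E]
    [Algebra k R] [Module k E] [IsScalarTower k R E] [Module.Finite R E] (I : Ideal R)
    [Module.Finite k (R ⧸ I)] (h : ∀ r ∈ I, ∀ x : E, r • x = 0) : Module.Finite k E := by
  have ht : Module.IsTorsionBySet R E I := fun x a => h a a.2 x
  let _ := ht.module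
  have : IsScalarTower R (R ⧸ I) E := ht.isScalarTower
  have : IsScalarTower k (R ⧸ I) E := ht.isScalarTower
  have : Module.Finite (R ⧸ I) E := Module.Finite.of_restrictScalars_finite R _ _
  exact Module.Finite.trans (R ⧸ I) E

/-- `Ext` is a finitely generated module annihilated by exact functions, in particular by the
Tjurina ideal, whose quotient is finite dimensional. -/
theorem finite_ext [CharZero k] (hiso : IsolatedSingularity w) (i : ZMod 2) :
    Module.Finite k (M.Ext i) := by
  have : Module.Finite k (PS n k ⧸ tjurinaIdeal w) := hiso
  refine finite_of_annihilated (tjurinaIdeal w) fun r hr x => ?_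
  obtain ⟨f, rfl⟩ := Submodule.Quotient.mk_surjective _ x
  rw [← Submodule.Quotient.mk_smul, Submodule.Quotient.mk_eq_zero]
  exact exactIdeal_smul_mem_B M (tjurinaIdeal_le_exactIdeal M hr) f.2

variable {M} in
theorem finite_extPart [CharZero k] (hiso : IsolatedSingularity w) (b : BilinearStructure M)
    (i : ZMod 2) (s : ℤ) : Module.Finite k (b.extPart i s) := by
  have := finite_ext M hiso i
  exact Module.Finite.of_injective ((b.extPart i s).subtype.restrictScalars k)
    Subtype.val_injective

theorem matD_smul_ring (c : PS n k) (v : Fin n → PS n k) (X : Mat d (PS n k)) :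
    matD (c • v) X = c • matD v X := by
  ext1 a b
  simp only [Matrix.smul_apply, matD_apply, vf_apply, Pi.smul_apply, smul_eq_mul, mul_assoc,
    Finset.mul_sum]

/-- A vector field annihilating the potential acts on `Q` by a coboundary. -/
theorem exists_matD_eq_commutator {N : ℕ}
    (hN : ∀ i : Fin n, (MvPowerSeries.X i : PS n k) ^ N ∈ jacobianIdeal w)
    {v : Fin n → PS n k} (hv : vf v (w : PS n k) = 0) : matD v M.Q ∈ M.B 1 := by
  have h1 : v ∈ koszulRel fun i => (MvPolynomial.pderiv i w : PS n k) := by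
    rw [vf_potential] at hv
    exact mem_koszulRel hN hv
  have h2 : ∀ v, koszulForm (fun i => (MvPolynomial.pderiv i w : PS n k)) v =
      vf v (w : PS n k) := fun v => by rw [koszulForm_apply, vf_potential]
  refine Submodule.span_induction (p := fun v _ => matD v M.Q ∈ M.B 1) ?_ ?_ ?_ ?_ h1
  · rintro _ ⟨⟨x, y⟩, rfl⟩
    rw [M.mem_B_one]
    -- The commutator of `Q` with `x(Q) y(Q)` is `{Q, x(Q)} y(Q) - x(Q) {Q, y(Q)} = x(w) y(Q) - y(w)
    -- x(Q)`.
    refine ⟨matD x M.Q * matD y M.Q, ?_, ?_⟩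
    · exact mul_mem_homDeg (matD_mem_homDeg x M.odd) (matD_mem_homDeg y M.odd)
    · have h3 : matD (koszulForm (fun i => (MvPolynomial.pderiv i w : PS n k)) x • y -
          koszulForm (fun i => (MvPolynomial.pderiv i w : PS n k)) y • x) M.Q =
          vf x (w : PS n k) • (matD y M.Q) - vf y (w : PS n k) • matD x M.Q := by
        rw [h2, h2, sub_eq_add_neg, ← neg_smul, matD_add_left, matD_smul_ring, matD_smul_ring,
          neg_smul, ← sub_eq_add_neg]
      have h4 : M.Q * (matD x M.Q * matD y M.Q) - matD x M.Q * matD y M.Q * M.Q =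
          (M.Q * matD x M.Q + matD x M.Q * M.Q) * matD y M.Q -
            matD x M.Q * (M.Q * matD y M.Q + matD y M.Q * M.Q) := by noncomm_ring
      rw [h3, h4, matD_Q, matD_Q, smul_mul_assoc, one_mul, mul_smul_comm, mul_one]
  · have := matD_smul_left (0 : k) (0 : Fin n → PS n k) M.Q
    rw [zero_smul, zero_smul] at this
    rw [this]
    exact zero_mem _
  · intro x y _ _ hx hy
    rw [matD_add_left]
    exact add_mem hx hy
  · intro c x _ hx
    rw [matD_smul_ring]
    exact Submodule.smul_mem _ _ hx

end ext

/-! ### The exact sequence of the tangent space -/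

theorem exists_descend {k V W U : Type*} [Field k] [AddCommGroup V] [AddCommGroup W]
    [AddCommGroup U] [Module k V] [Module k W] [Module k U] (p : V →ₗ[k] W)
    (hp : Function.Surjective p) (f : V →ₗ[k] U) (h : ∀ v, p v = 0 → f v = 0) :
    ∃ g : W →ₗ[k] U, ∀ v, g (p v) = f v := by
  refine ⟨(LinearMap.ker p).liftQ f (fun v hv => h v hv) ∘ₗ
    (p.quotKerEquivOfSurjective hp).symm.toLinearMap, fun v => ?_⟩
  have : (p.quotKerEquivOfSurjective hp).symm (p v) = Submodule.Quotient.mk v := by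
    rw [LinearEquiv.symm_apply_eq]
    rfl
  rw [LinearMap.comp_apply, LinearEquiv.coe_toLinearMap, this]
  rfl

/-- The quotient is by an `R`-submodule while `f` is only `k`-linear; the descended map is built
from representatives. -/
theorem exists_descend_quotient {k R Z U : Type*} [Field k] [CommRing R] [Algebra k R]
    [AddCommGroup Z] [AddCommGroup U] [Module k Z] [Module R Z] [IsScalarTower k R Z] [Module k U]
    (B : Submodule R Z) (f : Z →ₗ[k] U) (h : ∀ v ∈ B, f v = 0) :
    ∃ g : (Z ⧸ B) →ₗ[k] U, ∀ v : Z, g (Submodule.Quotient.mk v) = f v := by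
  have hs : ∀ x : Z ⧸ B, Submodule.Quotient.mk (Function.surjInv
      (Submodule.Quotient.mk_surjective B) x) = x := Function.surjInv_eq _
  have hf : ∀ u v : Z, (Submodule.Quotient.mk u : Z ⧸ B) = Submodule.Quotient.mk v → f u = f v := by
    intro u v huv
    rw [← sub_eq_zero, ← map_sub]
    exact h _ ((Submodule.Quotient.eq B).1 huv)
  refine ⟨
    { toFun := fun x => f (Function.surjInv (Submodule.Quotient.mk_surjective B) x)
      map_add' := fun x y => ?_
      map_smul' := fun c x => ?_ }, fun v => hf _ _ (hs _)⟩
  · rw [← map_add]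
    apply hf
    rw [hs, Submodule.Quotient.mk_add, hs, hs]
  · rw [RingHom.id_apply, ← map_smul]
    apply hf
    rw [hs, Submodule.Quotient.mk_smul, hs]

section sequence
variable {k : Type u} [Field k] {n d : ℕ}
  {w : MvPolynomial (Fin n) k} {M : MatrixFactorization w d} (b : BilinearStructure M)

/-- `symmetrize` as a linear map. -/
def symmetrizeL (s : ℤ) : Mat d (PS n k) →ₗ[k] Mat d (PS n k) :=
  (2⁻¹ : k) • (LinearMap.id + s • (adjL b.form).restrictScalars k)

theorem symmetrize_mem_tangentCocycles [CharZero k] {f : Mat d (PS n k)} {h : PS n k}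
    (hf : f ∈ homDeg d (PS n k) 1) (hh : M.Q * f + f * M.Q = h • 1) :
    symmetrize b b.kind.sign f ∈ tangentCocycles M (some b) ∧
      M.Q * symmetrize b b.kind.sign f + symmetrize b b.kind.sign f * M.Q = h • 1 := by
  have h1 : M.Q * symmetrize b b.kind.sign f + symmetrize b b.kind.sign f * M.Q = h • 1 := by
    rw [symmetrize_anticommutator, hh]
    exact symmetrize_eq_self b (one_mul 1) (by rw [adj_smul_one, one_smul])
  refine ⟨⟨symmetrize_homDeg b _ hf, ⟨h, h1⟩, ?_⟩, h1⟩
  rintro b' hb'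
  obtain rfl : b = b' := by simpa using hb'
  exact adj_symmetrize b b.kind.sign_mul_self _

theorem cls_mem_extPart {i : ZMod 2} {s : ℤ} (f : M.Z i) (h : adj b.form f = s • (f : Mat d (PS n k))) :
    M.cls f ∈ b.extPart i s := by
  change b.adjExt i (M.cls f) - s • M.cls f = 0
  rw [sub_eq_zero]
  have : b.adjZ i f = s • f := Subtype.ext h
  change M.cls (b.adjZ i f) = _
  rw [this]
  rfl

/-- Elements of the selfadjoint part are represented by symmetrized cocycles. -/
theorem cls_symmetrize [CharZero k] {i : ZMod 2} {s : ℤ} (hs : s * s = 1) (f : M.Z i)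
    (h : M.cls f ∈ b.extPart i s) :
    ∃ hf : symmetrize b s f ∈ M.Z i, M.cls ⟨symmetrize b s f, hf⟩ = M.cls f := by
  have h1 : symmetrize b s f = ((2⁻¹ : k) • (f + s • b.adjZ i f) : M.Z i) := rfl
  refine ⟨h1 ▸ Subtype.property _, ?_⟩
  have h2 : b.adjExt i (M.cls f) - s • M.cls f = 0 := h
  have h3 : M.cls (b.adjZ i f) = s • M.cls f := sub_eq_zero.1 h2
  change M.cls ((2⁻¹ : k) • (f + s • b.adjZ i f) : M.Z i) = _
  change (2⁻¹ : k) • (M.cls f + s • M.cls (b.adjZ i f)) = _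
  rw [h3, smul_smul, hs, one_smul, smul_add, half_add_half]

theorem mem_tangentBoundaries_of_mem_B {f : Mat d (PS n k)} (hf : f ∈ M.B 1)
    : f ∈ tangentBoundaries M none := by
  obtain ⟨g, hg, rfl⟩ := M.mem_B_one.1 hf
  refine ⟨(0, -g), ⟨neg_mem hg, by simp⟩, ?_⟩
  have := matD_smul_left (0 : k) (0 : Fin n → PS n k) M.Q
  rw [zero_smul, zero_smul] at this
  rw [infAct_apply, this]
  noncomm_ring

/-- If `v(Q) + [G, Q]` anticommutes with `Q` then `v(w) = 0`, so `v` is a combination of Koszul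
relations and `v(Q)` is already a coboundary. This gives injectivity of `Ext¹` into the tangent
space. -/
theorem mem_B_of_mem_tangentBoundaries {N : ℕ} {β : Option (BilinearStructure M)}
    (hN : ∀ i : Fin n, (MvPowerSeries.X i : PS n k) ^ N ∈ jacobianIdeal w)
    (hd : 1 ≤ d) {f : Mat d (PS n k)}
    (hf : f ∈ tangentBoundaries M β) (h : M.Q * f + f * M.Q = 0) : f ∈ M.B 1 := by
  obtain ⟨⟨v, G⟩, hG, rfl⟩ := hf
  rw [infAct_anticommutator] at h
  have hv : vf v (w : PS n k) = 0 := by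
    have := congrFun (congrFun h (Sum.inl ⟨0, hd⟩)) (Sum.inl ⟨0, hd⟩)
    simpa using this
  rw [infAct_apply]
  refine add_mem (exists_matD_eq_commutator M hN hv) (M.mem_B_one.2 ⟨-G, neg_mem hG.1, ?_⟩)
  noncomm_ring

/-- The map from `Ext` to the tangent space, `f ↦ (f + s f^adj) / 2`. -/
theorem exists_extToTangent [CharZero k] : ∃ ι : M.Ext 1 →ₗ[k] Tangent M (some b),
    ∀ f : M.Z 1, ∃ hf : symmetrize b b.kind.sign f ∈ tangentCocycles M (some b),
      ι (M.cls f) = tangentMk M (some b) ⟨_, hf⟩ := by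
  have hz : ∀ f : M.Z 1, M.Q * (f : Mat d (PS n k)) + (f : Mat d (PS n k)) * M.Q =
      (0 : PS n k) • 1 := fun f => by
    rw [zero_smul]
    exact (M.mem_Z_one.1 f.2).2
  have hα := fun f : M.Z 1 => (symmetrize_mem_tangentCocycles b f.2.1 (hz f)).1
  let α : M.Z 1 →ₗ[k] tangentCocycles M (some b) :=
    ((symmetrizeL b b.kind.sign) ∘ₗ (M.Z 1).subtype.restrictScalars k).codRestrict _ hα
  have hB : ∀ f ∈ (M.B 1).submoduleOf (M.Z 1), (tangentMk M (some b) ∘ₗ α) f = 0 := by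
    intro f hf
    have hf' : (f : Mat d (PS n k)) ∈ M.B 1 := hf
    rw [LinearMap.comp_apply, tangentMk_eq_zero_iff]
    refine tangentBoundaries_some_of_none b (mem_tangentBoundaries_of_mem_B ?_)
      ((α f).2.2.2 b rfl)
    change symmetrize b b.kind.sign f ∈ M.B 1
    exact Submodule.smul_of_tower_mem _ _ (add_mem hf' (zsmul_mem (b.adj_mem_B hf') _))
  obtain ⟨ι', hι'⟩ := exists_descend_quotient _ (tangentMk M (some b) ∘ₗ α) hB
  exact ⟨ι', fun f => ⟨hα f, hι' f⟩⟩

/-- The map from the tangent space to the classes of exact functions. -/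
theorem exists_tangentPotential (hd : 1 ≤ d) :
    ∃ π : Tangent M (some b) →ₗ[k] M.exactClasses,
      ∀ (f : tangentCocycles M (some b)) (h : PS n k),
        M.Q * (f : Mat d (PS n k)) + (f : Mat d (PS n k)) * M.Q = h • 1 →
        (π (tangentMk M (some b) f) : PS n k ⧸ jacobianIdeal w) =
          Ideal.Quotient.mk (jacobianIdeal w) h := by
  let p : Fin d ⊕ Fin d := Sum.inl ⟨0, hd⟩
  have hpot : ∀ {X : Mat d (PS n k)} {h : PS n k}, X = h • 1 → X p p = h := by
    rintro X h rfl
    simp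
  let pot : tangentCocycles M (some b) →ₗ[k] PS n k :=
    (Matrix.entryLinearMap k (PS n k) p p) ∘ₗ
      (LinearMap.mulLeft k M.Q + LinearMap.mulRight k M.Q) ∘ₗ
      (tangentCocycles M (some b)).subtype
  have hpot' : ∀ (f : tangentCocycles M (some b)) (h : PS n k),
      M.Q * (f : Mat d (PS n k)) + (f : Mat d (PS n k)) * M.Q = h • 1 → pot f = h :=
    fun f h hh => hpot hh
  have hmem : ∀ f, Ideal.Quotient.mkₐ k (jacobianIdeal w) (pot f) ∈
      M.exactClasses.restrictScalars k := fun f => by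
    obtain ⟨h, hh⟩ := f.2.2.1
    refine Ideal.mem_map_of_mem _ (M.mem_exactIdeal.2 ⟨f, f.2.1, ?_⟩)
    rw [hpot' f h hh, hh]
  let pot' : tangentCocycles M (some b) →ₗ[k] M.exactClasses.restrictScalars k :=
    ((Ideal.Quotient.mkₐ k (jacobianIdeal w)).toLinearMap ∘ₗ pot).codRestrict _ hmem
  have hpot'' : ∀ f, (pot' f : PS n k ⧸ jacobianIdeal w) =
    Ideal.Quotient.mk (jacobianIdeal w) (pot f) := fun f => rfl
  obtain ⟨π, hπ⟩ := exists_descend (tangentMk M (some b)) (tangentMk_surjective hd) pot' (by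
      intro f hf
      rw [tangentMk_eq_zero_iff] at hf
      obtain ⟨⟨v, G⟩, hG, hf⟩ := hf
      apply Subtype.ext
      rw [hpot'', Submodule.coe_zero, Ideal.Quotient.eq_zero_iff_mem,
        hpot' f (vf v (w : PS n k))]
      · exact mem_jacobianIdeal_iff.2 ⟨v, rfl⟩
      · rw [← hf, infAct_anticommutator])
  refine ⟨π, fun f h hh => ?_⟩
  rw [← hpot' f h hh, ← hpot'', ← hπ]
  rfl

/-- The pair `(v, 0)` averaged with its dual is isometric and still has vector field `v`. It serves
to remove potentials lying in the Jacobian ideal. -/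
theorem exists_boundary_of_potential [CharZero k] {h : PS n k} (hh : h ∈ jacobianIdeal w) :
    ∃ y ∈ tangentBoundaries M (some b), y ∈ homDeg d (PS n k) 1 ∧
      adj b.form y = b.kind.sign • y ∧ M.Q * y + y * M.Q = h • 1 := by
  obtain ⟨v, hv⟩ := mem_jacobianIdeal_iff.1 hh
  have hg := average_mem_infGauge b v (zero_mem (homDeg d (PS n k) 0))
  set G := (2⁻¹ : k) • ((0 : Mat d (PS n k)) + (logD b v - adj b.form 0)) with hG
  refine ⟨infAct M (v, G), ⟨_, hg, rfl⟩, ?_, ?_, ?_⟩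
  · rw [infAct_apply]
    refine add_mem (matD_mem_homDeg v M.odd) (sub_mem ?_ ?_)
    · exact mul_mem_homDeg hg.1 M.odd
    · exact mul_mem_homDeg M.odd hg.1
  · rw [hG, infAct_average]
    exact adj_symmetrize b b.kind.sign_mul_self _
  · rw [infAct_anticommutator, hv]

theorem exists_tangent_sequence [IsAlgClosed k] [CharZero k] (hd : 1 ≤ d) (hw : MvPolynomial.constantCoeff w = 0)
    (hiso : IsolatedSingularity w) :
    ∃ (ι : b.extPart 1 b.kind.sign →ₗ[k] Tangent M (some b))
      (π : Tangent M (some b) →ₗ[k] M.exactClasses),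
      (∀ (f : M.Z 1) (e : b.extPart 1 b.kind.sign) (N : Deformation M (some b) (DualNumber k)),
        (e : M.Ext 1) = M.cls f →
        N.Q = (const n (DualNumber k)).mapMatrix M.Q +
          (DualNumber.eps : DualNumber k) •
            (const n (DualNumber k)).mapMatrix (f : Mat d (PS n k)) →
        ι e = N.cls) ∧
      (∀ (N : Deformation M (some b) (DualNumber k)) (h : PS n k),
        N.Q * N.Q = (const n (DualNumber k) (w : PS n k) +
          (DualNumber.eps : DualNumber k) • const n (DualNumber k) h) •
            (1 : Mat d (PS n (DualNumber k))) →
        (π N.cls : PS n k ⧸ jacobianIdeal w) = Ideal.Quotient.mk (jacobianIdeal w) h) ∧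
      Function.Injective ι ∧ Function.Exact ι π ∧ Function.Surjective π := by
  obtain ⟨N, hN⟩ := exists_X_pow_mem_jacobianIdeal hw hiso
  have hs := b.kind.sign_mul_self
  obtain ⟨ι', hι⟩ := exists_extToTangent b
  obtain ⟨π, hπ⟩ := exists_tangentPotential b hd
  have hz : ∀ f : M.Z 1, M.Q * symmetrize b b.kind.sign f + symmetrize b b.kind.sign f * M.Q =
      0 := fun f => by
    have h1 : M.Q * (f : Mat d (PS n k)) + (f : Mat d (PS n k)) * M.Q = (0 : PS n k) • 1 := by
      rw [zero_smul]
      exact (M.mem_Z_one.1 f.2).2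
    rw [(symmetrize_mem_tangentCocycles b f.2.1 h1).2, zero_smul]
  refine ⟨ι' ∘ₗ (b.extPart 1 b.kind.sign).subtype.restrictScalars k, π, ?_, ?_, ?_, ?_, ?_⟩
  · intro f e N he hNQ
    obtain ⟨g, rfl⟩ := N.exists_ofCocycle hd
    change ι' (e : M.Ext 1) = tangentMk M (some b) g
    have hfg : (f : Mat d (PS n k)) = g := by
      apply eps_constMatrix_injective
      exact (add_left_cancel hNQ).symm
    obtain ⟨h1, h2⟩ := hι f
    rw [he, h2]
    congr 1
    apply Subtype.ext
    change symmetrize b b.kind.sign f = g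
    rw [hfg]
    exact symmetrize_eq_self b hs (g.2.2.2 b rfl)
  · intro N h hNh
    obtain ⟨g, rfl⟩ := N.exists_ofCocycle hd
    exact hπ g h ((dual_potential_eq_iff _ _).1 hNh)
  · rw [injective_iff_map_eq_zero]
    rintro ⟨e, he⟩ h0
    obtain ⟨f, rfl⟩ := Submodule.Quotient.mk_surjective _ e
    obtain ⟨h3, h4⟩ := hι f
    change ι' (M.cls f) = 0 at h0
    rw [h4, tangentMk_eq_zero_iff] at h0
    obtain ⟨h1, h2⟩ := cls_symmetrize b hs f he
    apply Subtype.ext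
    change M.cls f = 0
    rw [← h2, Submodule.Quotient.mk_eq_zero]
    exact mem_B_of_mem_tangentBoundaries hN hd h0 (hz f)
  · intro x
    obtain ⟨f, rfl⟩ := tangentMk_surjective hd x
    constructor
    · intro hx
      obtain ⟨h, hh⟩ := f.2.2.1
      have hx' : h ∈ jacobianIdeal w := by
        rw [← Ideal.Quotient.eq_zero_iff_mem, ← hπ f h hh, hx]
        rfl
      -- Subtracting an isometric gauge direction with the same potential turns `f` into a genuine
      -- cocycle without changing its class.
      obtain ⟨y, hy1, hyo, hya, hya0⟩ := exists_boundary_of_potential b hx'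
      have hfy0 : M.Q * ((f : Mat d (PS n k)) - y) + ((f : Mat d (PS n k)) - y) * M.Q = 0 := by
        have : M.Q * ((f : Mat d (PS n k)) - y) + ((f : Mat d (PS n k)) - y) * M.Q =
          (M.Q * (f : Mat d (PS n k)) + (f : Mat d (PS n k)) * M.Q) - (M.Q * y + y * M.Q) := by
          noncomm_ring
        rw [this, hh, hya0, sub_self]
      have hfa : adj b.form ((f : Mat d (PS n k)) - y) =
          b.kind.sign • ((f : Mat d (PS n k)) - y) := by
        rw [adj_sub, f.2.2.2 b rfl, hya, smul_sub]
      let z : M.Z 1 := ⟨(f : Mat d (PS n k)) - y, M.mem_Z_one.2 ⟨sub_mem f.2.1 hyo, hfy0⟩⟩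
      refine ⟨⟨M.cls z, cls_mem_extPart b z hfa⟩, ?_⟩
      obtain ⟨h1, h2⟩ := hι z
      refine h2.trans ?_
      rw [tangentMk_eq_iff]
      change (f : Mat d (PS n k)) - symmetrize b b.kind.sign ((f : Mat d (PS n k)) - y) ∈ _
      rw [symmetrize_eq_self b hs hfa]
      rwa [sub_sub_cancel]
    · rintro ⟨⟨e, he⟩, hx⟩
      obtain ⟨g, rfl⟩ := Submodule.Quotient.mk_surjective _ e
      obtain ⟨h1, h2⟩ := hι g
      rw [← hx]
      apply Subtype.ext
      change (π (ι' (M.cls g)) : PS n k ⧸ jacobianIdeal w) = 0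
      rw [h2, hπ ⟨_, h1⟩ 0 (by rw [zero_smul]; exact hz g), map_zero]
  · rintro ⟨x, hx⟩
    obtain ⟨h, hh, rfl⟩ := (Ideal.mem_map_iff_of_surjective _ Ideal.Quotient.mk_surjective).1 hx
    obtain ⟨g, hg, hgh⟩ := M.mem_exactIdeal.1 hh
    obtain ⟨h1, h2⟩ := symmetrize_mem_tangentCocycles b hg hgh
    exact ⟨tangentMk M (some b) ⟨_, h1⟩, Subtype.ext (hπ ⟨_, h1⟩ h h2)⟩

end sequence

/-! ### Obstructions -/

section sums
variable {k A : Type*} [Field k] [CommRing A] [Algebra k A] {n d : ℕ}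

theorem const_mul_sum {r : ℕ} (η : Fin r → A) (x : Mat d (PS n k)) (z : Fin r → Mat d (PS n k)) :
    (const n A).mapMatrix x * ∑ l, η l • (const n A).mapMatrix (z l) =
      ∑ l, η l • (const n A).mapMatrix (x * z l) := by
  rw [Finset.mul_sum]
  exact Finset.sum_congr rfl fun l _ => by rw [matrix_mul_smul, map_mul]

theorem sum_mul_const {r : ℕ} (η : Fin r → A) (x : Mat d (PS n k)) (z : Fin r → Mat d (PS n k)) :
    (∑ l, η l • (const n A).mapMatrix (z l)) * (const n A).mapMatrix x =
      ∑ l, η l • (const n A).mapMatrix (z l * x) := by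
  rw [Finset.sum_mul]
  exact Finset.sum_congr rfl fun l _ => by rw [smul_matrix_mul, map_mul]

end sums

section small
variable {k : Type u} [Field k] {n d : ℕ} {w : MvPolynomial (Fin n) k}
  {M : MatrixFactorization w d} {A : Type*} [CommRing A] [Algebra k A] {J : Ideal A}
  [IsLocalRing A] (hJ : maximalIdeal A * J = ⊥)

include hJ in
-- `X` differs from the constant operator `Q` by a matrix with coefficients in `𝔪`, which kills `J`.
theorem mul_small {X Z : Mat d (PS n A)}
    (hX : X - (const n A).mapMatrix M.Q ∈ matIdeal n d (maximalIdeal A))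
    (hZ : Z ∈ matIdeal n d J) : X * Z = (const n A).mapMatrix M.Q * Z := by
  rw [← sub_eq_zero, ← sub_mul]
  exact matrix_mul_eq_zero_of_small hJ hX hZ

include hJ in
theorem small_mul {X Z : Mat d (PS n A)}
    (hX : X - (const n A).mapMatrix M.Q ∈ matIdeal n d (maximalIdeal A))
    (hZ : Z ∈ matIdeal n d J) : Z * X = Z * (const n A).mapMatrix M.Q := by
  rw [← sub_eq_zero, ← mul_sub]
  exact matrix_mul_eq_zero_of_small' hJ hZ hX

include hJ in
theorem anticommutator_small {r : ℕ} {η : Fin r → A} (hη : ∀ l, η l ∈ J) {X : Mat d (PS n A)}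
    (hX : X - (const n A).mapMatrix M.Q ∈ matIdeal n d (maximalIdeal A))
    (z : Fin r → Mat d (PS n k)) :
    X * (∑ l, η l • (const n A).mapMatrix (z l)) + (∑ l, η l • (const n A).mapMatrix (z l)) * X =
      ∑ l, η l • (const n A).mapMatrix (M.Q * z l + z l * M.Q) := by
  have hZ := sum_smul_mem_matIdeal hη fun l => (const n A).mapMatrix (z l)
  rw [mul_small hJ hX hZ, small_mul hJ hX hZ, const_mul_sum, sum_mul_const,
    ← Finset.sum_add_distrib]
  exact Finset.sum_congr rfl fun l _ => by rw [map_add, smul_add]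

include hJ in
/-- The square of a small perturbation. -/
theorem sq_add_small (hJm : J ≤ maximalIdeal A) {r : ℕ} {η : Fin r → A} (hη : ∀ l, η l ∈ J)
    {X : Mat d (PS n A)}
    (hX : X - (const n A).mapMatrix M.Q ∈ matIdeal n d (maximalIdeal A))
    (z : Fin r → Mat d (PS n k)) :
    (X + ∑ l, η l • (const n A).mapMatrix (z l)) * (X + ∑ l, η l • (const n A).mapMatrix (z l)) =
      X * X + ∑ l, η l • (const n A).mapMatrix (M.Q * z l + z l * M.Q) := by
  have hZ := sum_smul_mem_matIdeal hη fun l => (const n A).mapMatrix (z l)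
  rw [← anticommutator_small hJ hη hX, add_mul, mul_add, mul_add,
    matrix_mul_eq_zero_of_small hJ (matIdeal_mono hJm hZ) hZ]
  abel

theorem lift_sub_mem {A' : Type*} [CommRing A'] [Algebra k A'] [IsLocalRing A'] 
    {p : A' →ₐ[k] A} (hp : Function.Surjective p)
    {β : Option (BilinearStructure M)} (N : Deformation M β A) {X : Mat d (PS n A')}
    (hX : (MvPowerSeries.map (p : A' →+* A)).mapMatrix X = N.Q) :
    X - (const n A').mapMatrix M.Q ∈ matIdeal n d (maximalIdeal A') := by
  apply const_sub_mem_of_red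
  ext1 a c
  have : IsLocalHom (p : A' →+* A) := hp.isLocalHom (f := (p : A' →+* A))
  refine red_eq_of_map (p := (p : A' →+* A)) ?_
  have h1 := congrFun (congrFun N.red_eq a) c
  rw [← hX, ← map_constMatrix p] at h1
  exact h1

end small

section obstruction
variable {k : Type u} [Field k] {n d : ℕ} {w : MvPolynomial (Fin n) k}
  {M : MatrixFactorization w d} (b : BilinearStructure M)
  {A : Type*} [CommRing A] [Algebra k A] {J : Ideal A} {r : ℕ} (η : Module.Basis (Fin r) k J)

/-- `t` is the class in `C ⊗ J` of the matrix `E` with entries in `J`. -/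
def Represents (E : Mat d (PS n A)) (t : b.ObstructionSpace ⊗[k] J) : Prop :=
  ∃ (f : Fin r → M.Z 0) (e : Fin r → b.extPart 0 1), (∀ l, (e l : M.Ext 0) = M.cls (f l)) ∧
    E = ∑ l, (η l : A) • (const n A).mapMatrix (f l : Mat d (PS n k)) ∧
    t = ∑ l, Submodule.Quotient.mk (e l) ⊗ₜ[k] η l

variable {b η}

/-- Any presentation of a defect can be rewritten in the basis of `J`: the matrix and the tensor are
both bilinear in the functions and the elements of `J`, so the change of presentation acts on them
in the same way. -/
theorem represents_of_sum {m : ℕ} (ξ : Fin m → J) (f : Fin m → M.Z 0) (e : Fin m → b.extPart 0 1)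
    (he : ∀ i, (e i : M.Ext 0) = M.cls (f i)) :
    Represents b η (∑ i, (ξ i : A) • (const n A).mapMatrix (f i : Mat d (PS n k)))
      (∑ i, Submodule.Quotient.mk (e i) ⊗ₜ[k] ξ i) := by
  refine ⟨fun l => ∑ i, η.repr (ξ i) l • f i, fun l => ∑ i, η.repr (ξ i) l • e i, ?_, ?_, ?_⟩
  · intro l
    have h1 : M.cls (∑ i, η.repr (ξ i) l • f i) = ∑ i, η.repr (ξ i) l • M.cls (f i) :=
      map_sum (((M.B 0).submoduleOf (M.Z 0)).mkQ.restrictScalars k) _ _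
    rw [h1, AddSubmonoidClass.coe_finsetSum]
    exact Finset.sum_congr rfl fun i _ => by rw [← he i]; rfl
  · have h1 : ∀ i, (ξ i : A) = ∑ l, algebraMap k A (η.repr (ξ i) l) * (η l : A) := by
      intro i
      have h := congrArg Subtype.val (η.sum_repr (ξ i))
      rw [AddSubmonoidClass.coe_finsetSum] at h
      rw [← h]
      exact Finset.sum_congr rfl fun l _ => by rw [← Algebra.smul_def]; rfl
    simp_rw [AddSubmonoidClass.coe_finsetSum, map_sum, Finset.smul_sum]
    rw [Finset.sum_comm]
    refine Finset.sum_congr rfl fun i _ => ?_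
    rw [h1 i, Finset.sum_smul]
    refine Finset.sum_congr rfl fun l _ => ?_
    change _ = (η l : A) • (const n A).mapMatrix (η.repr (ξ i) l • (f i : Mat d (PS n k)))
    rw [const_smul, smul_smul, mul_comm]
  · have h1 : ∀ i, (Submodule.Quotient.mk (e i) : b.ObstructionSpace) ⊗ₜ[k] ξ i =
        ∑ l, (η.repr (ξ i) l • (Submodule.Quotient.mk (e i) : b.ObstructionSpace)) ⊗ₜ[k] η l := by
      intro i
      conv_lhs => rw [← η.sum_repr (ξ i)]
      rw [TensorProduct.tmul_sum]
      exact Finset.sum_congr rfl fun l _ => by rw [TensorProduct.tmul_smul, TensorProduct.smul_tmul']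
    rw [Finset.sum_congr rfl fun i _ => h1 i, Finset.sum_comm]
    refine Finset.sum_congr rfl fun l _ => ?_
    rw [← TensorProduct.sum_tmul]
    congr 1
    exact (map_sum ((LinearMap.range b.scalarMap).mkQ.restrictScalars k) _ _).symm

theorem Represents.sub {E E' : Mat d (PS n A)} {t t' : b.ObstructionSpace ⊗[k] J}
    (h : Represents b η E t) (h' : Represents b η E' t') : Represents b η (E - E') (t - t') := by
  obtain ⟨f, e, h1, rfl, rfl⟩ := h
  obtain ⟨f', e', h1', rfl, rfl⟩ := h'
  refine ⟨f - f', e - e', fun l => ?_, ?_, ?_⟩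
  · change (e l : M.Ext 0) - (e' l : M.Ext 0) = M.cls (f l) - M.cls (f' l)
    rw [h1, h1']
  · rw [← Finset.sum_sub_distrib]
    refine Finset.sum_congr rfl fun l _ => ?_
    rw [← smul_sub, ← map_sub]
    rfl
  · rw [← Finset.sum_sub_distrib]
    refine Finset.sum_congr rfl fun l _ => ?_
    rw [← TensorProduct.sub_tmul]
    rfl

/-- The trivial obstructions. -/
theorem Represents.eq_zero {E : Mat d (PS n A)} {t : b.ObstructionSpace ⊗[k] J}
    (h : Represents b η E t) {g : Fin r → PS n k} {z : Fin r → Mat d (PS n k)}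
    (hz : ∀ l, z l ∈ homDeg d (PS n k) 1)
    (hE : E = ∑ l, (η l : A) • (const n A).mapMatrix (g l • 1 + (M.Q * z l + z l * M.Q))) :
    t = 0 := by
  obtain ⟨f, e, h1, rfl, rfl⟩ := h
  refine Finset.sum_eq_zero fun l _ => ?_
  have h2 := matrix_coord_eq η hE l
  have h3 : (Submodule.Quotient.mk (e l) : b.ObstructionSpace) = 0 := by
    rw [Submodule.Quotient.mk_eq_zero]
    refine ⟨Submodule.Quotient.mk (g l), Subtype.ext ?_⟩
    rw [h1]
    change M.cls (g l • BilinearStructure.oneZ M) = M.cls (f l)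
    rw [← sub_eq_zero, ← Submodule.Quotient.mk_sub, Submodule.Quotient.mk_eq_zero]
    change g l • (1 : Mat d (PS n k)) - (f l : Mat d (PS n k)) ∈ M.B 0
    rw [h2, M.mem_B_zero]
    refine ⟨-z l, neg_mem (hz l), ?_⟩
    noncomm_ring
  rw [h3, TensorProduct.zero_tmul]

/-- A tensor expanded in a basis of `J` vanishes only if each coefficient vanishes in the cokernel,
that is, each cocycle is a scalar plus a coboundary. -/
theorem Represents.exists_of_eq_zero {E : Mat d (PS n A)} (h : Represents b η E 0) :
    ∃ (g : Fin r → PS n k) (z : Fin r → Mat d (PS n k)), (∀ l, z l ∈ homDeg d (PS n k) 1) ∧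
      E = ∑ l, (η l : A) • (const n A).mapMatrix (g l • 1 + (M.Q * z l + z l * M.Q)) := by
  obtain ⟨f, e, h1, rfl, h2⟩ := h
  have h3 : ∀ l, (Submodule.Quotient.mk (e l) : b.ObstructionSpace) = 0 := by
    let x : Fin r →₀ b.ObstructionSpace :=
      Finsupp.equivFunOnFinite.symm fun l => Submodule.Quotient.mk (e l)
    have h3 : (x.sum fun l m => m ⊗ₜ[k] η l) = 0 := by
      rw [Finsupp.sum_fintype x (fun l m => m ⊗ₜ[k] η l)
        fun l => TensorProduct.zero_tmul _ (η l)]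
      exact h2.symm
    have h4 := TensorProduct.sum_tmul_basis_right_eq_zero η x h3
    exact fun l => DFunLike.congr_fun h4 l
  have h4 : ∀ l, ∃ (g : PS n k) (z : Mat d (PS n k)), z ∈ homDeg d (PS n k) 1 ∧
      (f l : Mat d (PS n k)) = g • 1 + (M.Q * z + z * M.Q) := by
    intro l
    obtain ⟨x, hx⟩ := (Submodule.Quotient.mk_eq_zero _).1 (h3 l)
    obtain ⟨g, rfl⟩ := Submodule.Quotient.mk_surjective _ x
    have h5 := congrArg Subtype.val hx
    rw [h1] at h5
    change M.cls (g • BilinearStructure.oneZ M) = M.cls (f l) at h5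
    rw [eq_comm, ← sub_eq_zero, ← Submodule.Quotient.mk_sub, Submodule.Quotient.mk_eq_zero] at h5
    change (f l : Mat d (PS n k)) - g • (1 : Mat d (PS n k)) ∈ M.B 0 at h5
    obtain ⟨z, hz, h6⟩ := M.mem_B_zero.1 h5
    exact ⟨g, z, hz, by rw [h6, add_sub_cancel]⟩
  choose g z hz hf using h4
  exact ⟨g, z, hz, Finset.sum_congr rfl fun l _ => by rw [hf l]⟩

theorem represents_zero : Represents b η (0 : Mat d (PS n A)) 0 :=
  ⟨0, 0, fun _ => rfl, by simp, by
    refine (Finset.sum_eq_zero fun l _ => ?_).symm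
    change (0 : b.ObstructionSpace) ⊗ₜ[k] η l = 0
    rw [TensorProduct.zero_tmul]⟩

section defect
variable {A' A : Type u} [CommRing A'] [CommRing A] [Algebra k A'] [Algebra k A]
  {p : A' →ₐ[k] A} {ηp : Module.Basis (Fin r) k (RingHom.ker p)}

theorem IsDefect.represents [IsLocalRing A] {N : Deformation M (some b) A} {Q' : Mat d (PS n A')} {ω : PS n A'}
    {m : ℕ} {ξ : Fin m → RingHom.ker p} {f : Fin m → M.Z 0} {e : Fin m → b.extPart 0 1}
    (h : IsDefect b p N Q' ω ξ f e) :
    Represents b ηp (Q' * Q' - ω • 1) (∑ i, Submodule.Quotient.mk (e i) ⊗ₜ[k] ξ i) := by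
  rw [h.defect]
  exact represents_of_sum ξ f e h.class_eq

theorem matIdeal_ker_iff {X : Mat d (PS n A')} : X ∈ matIdeal n d (RingHom.ker p) ↔
    (MvPowerSeries.map (p : A' →+* A)).mapMatrix X = 0 := mem_matIdeal_ker _ _

theorem map_smul_one' (ω : PS n A') : (MvPowerSeries.map (p : A' →+* A)).mapMatrix
    (ω • (1 : Mat d (PS n A'))) = MvPowerSeries.map (p : A' →+* A) ω • (1 : Mat d (PS n A)) := by
  ext1 a c
  simp only [RingHom.mapMatrix_apply, Matrix.map_apply, Matrix.smul_apply, smul_eq_mul, map_mul]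
  congr 1
  by_cases h : a = c <;> simp [h, Matrix.one_apply]

variable (hp : Function.Surjective p)

include hp in
/-- Operators lift compatibly with the form. -/
theorem exists_selfadjoint_lift [CharZero k] (b : BilinearStructure M) {X : Mat d (PS n A)}
    {i : ZMod 2} (hX : X ∈ homDeg d (PS n A) i)
    (hXa : adj (b.formOver A) X = b.kind.sign • X) :
    ∃ X' ∈ homDeg d (PS n A') i, adj (b.formOver A') X' = b.kind.sign • X' ∧
      (MvPowerSeries.map (p : A' →+* A)).mapMatrix X' = X := by
  obtain ⟨Y, hY, hYX⟩ := exists_lift_homDeg (p := (p : A' →+* A)) hp hX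
  have hs := b.kind.sign_mul_self
  -- An arbitrary lift is averaged with its adjoint; the average still lifts `X`, which already has
  -- the right symmetry.
  refine ⟨(2⁻¹ : k) • (Y + b.kind.sign • adj (b.formOver A') Y),
    homDeg_smul_scalar_mem _ (add_mem hY (zsmul_mem (adj_mem_homDeg (formOver_mem b) hY) _)), ?_, ?_⟩
  · rw [adj_smul_scalar, adj_add, adj_zsmul, adj_adj_formOver, smul_comm b.kind.sign,
      smul_add b.kind.sign, smul_smul, hs, one_smul, add_comm]
  · have h1 : ∀ (c : k) (Z : Mat d (PS n A')), (MvPowerSeries.map (p : A' →+* A)).mapMatrix (c • Z) =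
        c • (MvPowerSeries.map (p : A' →+* A)).mapMatrix Z := by
      intro c Z
      ext a e m
      change p (MvPowerSeries.coeff m (c • Z a e)) = c • p (MvPowerSeries.coeff m (Z a e))
      rw [← map_smul]
      rfl
    rw [h1, map_add, map_zsmul, map_adj, hYX, hXa, smul_smul, hs, one_smul, smul_add, half_add_half]

variable [IsCoeffRing k A'] [IsCoeffRing k A] (hJ : maximalIdeal A' * RingHom.ker p = ⊥)

include hp hJ in
/-- Equivalent deformations have the same obstructions. -/
theorem represents_eq_of_equivalent [IsArtinianRing A'] [IsArtinianRing A] [CharZero k] (hd : 1 ≤ d) {N₁ N₂ : Deformation M (some b) A}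
    (hN : N₁.Equivalent N₂) {Q₁ Q₂ : Mat d (PS n A')} {ω₁ ω₂ : PS n A'}
    (ho₁ : Q₁ ∈ homDeg d (PS n A') 1) (ho₂ : Q₂ ∈ homDeg d (PS n A') 1)
    (hQ₁ : (MvPowerSeries.map (p : A' →+* A)).mapMatrix Q₁ = N₁.Q)
    (hQ₂ : (MvPowerSeries.map (p : A' →+* A)).mapMatrix Q₂ = N₂.Q)
    (hω₁ : N₁.Q * N₁.Q = MvPowerSeries.map (p : A' →+* A) ω₁ • (1 : Mat d (PS n A)))
    (hω₂ : N₂.Q * N₂.Q = MvPowerSeries.map (p : A' →+* A) ω₂ • (1 : Mat d (PS n A)))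
    {t₁ t₂ : b.ObstructionSpace ⊗[k] RingHom.ker p}
    (h₁ : Represents b ηp (Q₁ * Q₁ - ω₁ • 1) t₁) (h₂ : Represents b ηp (Q₂ * Q₂ - ω₂ • 1) t₂) :
    t₂ = t₁ := by
  have hJm : RingHom.ker p ≤ maximalIdeal A' := ker_le_maximalIdeal p
  obtain ⟨σ, F, hg, hgN⟩ := (equivalent_iff_gauge b _ _).1 hN
  obtain ⟨σ', F', hg', hgp⟩ := IsGauge.exists_lift b hp hJ hg
  -- Transporting `Q₁` by a lifted gauge transformation reduces the comparison to two lifts of the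
  -- same operator `N₂.Q`.
  set P := gaugeAct σ' F' Q₁ with hP
  have hPp : (MvPowerSeries.map (p : A' →+* A)).mapMatrix P = N₂.Q := by rw [hP, hgp, hQ₁, hgN]
  have hPo : P ∈ homDeg d (PS n A') 1 := hg'.act_homDeg ho₁
  have hPm := lift_sub_mem hp N₂ hPp
  -- The defect has entries in the kernel, where gauge transformations act trivially, so the
  -- transport leaves it unchanged.
  have hE₁ : P * P - σ' ω₁ • 1 = Q₁ * Q₁ - ω₁ • 1 := by
    rw [← gaugeAct_smul_one (F := F'), hP, ← gaugeAct_mul, ← gaugeAct_sub]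
    refine hg'.act_of_small hJ ?_
    rw [matIdeal_ker_iff, map_sub, map_mul, hQ₁, map_smul_one', hω₁, sub_self]
  obtain ⟨z, hz⟩ := exists_matrix_coord ηp (X := Q₂ - P) (by
    rw [matIdeal_ker_iff, map_sub, hQ₂, hPp, sub_self])
  have hzo : ∀ l, z l ∈ homDeg d (PS n k) 1 :=
    coord_homDeg ηp (by rw [← hz]; exact sub_mem ho₂ hPo)
  obtain ⟨g, hgz⟩ := exists_coord ηp (f := σ' ω₁ - ω₂) (by
    rw [← smul_one_mem_matIdeal_iff hd, sub_smul, ← gaugeAct_smul_one (F := F'), matIdeal_ker_iff,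
      map_sub, hgp, map_smul_one', map_smul_one', ← hω₁, ← hω₂, gaugeAct_mul, hgN, sub_self])
  have hQ₂' : Q₂ = P + ∑ l, (ηp l : A') • (const n A').mapMatrix (z l) := by
    rw [← hz, add_sub_cancel]
  have hsq := sq_add_small hJ hJm (fun l => (ηp l).2) hPm z
  rw [← hQ₂'] at hsq
  have h := h₂.sub h₁
  rw [← sub_eq_zero]
  refine h.eq_zero hzo (g := g) ?_
  rw [← hE₁, hsq]
  have hgz' : σ' ω₁ • (1 : Mat d (PS n A')) - ω₂ • 1 =
      ∑ l, (ηp l : A') • (const n A').mapMatrix (g l • (1 : Mat d (PS n k))) := by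
    rw [← sub_smul, hgz, Finset.sum_smul]
    refine Finset.sum_congr rfl fun l _ => ?_
    rw [smul_assoc, const_smul_one]
  simp_rw [map_add, smul_add, Finset.sum_add_distrib, ← hgz']
  abel

include hp hJ in
-- The defect is selfadjoint because `s² = 1`, and it commutes with `Q'` because both `Q'²` and
-- scalars do. On the kernel `Q'` acts as `Q`, so the coordinates of the defect are selfadjoint even
-- cocycles.
theorem exists_defect_coord [CharZero k] (ηp : Module.Basis (Fin r) k (RingHom.ker p))
    (N : Deformation M (some b) A) :
    ∃ (Q' : Mat d (PS n A')) (ω : PS n A') (f : Fin r → M.Z 0) (e : Fin r → b.extPart 0 1),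
      IsDefect b p N Q' ω ηp f e ∧ ∀ l, adj b.form (f l) = (f l : Mat d (PS n k)) := by
  obtain ⟨Q', ho, ha, hQ⟩ := exists_selfadjoint_lift hp b N.odd (N.adj_eq b rfl)
  obtain ⟨ω₀, hω₀⟩ := N.sq
  obtain ⟨ω, rfl⟩ := powerSeries_map_surjective (p := (p : A' →+* A)) hp ω₀
  have hm := lift_sub_mem hp N hQ
  obtain ⟨f, hf⟩ := exists_matrix_coord ηp (X := Q' * Q' - ω • 1) (by
    rw [matIdeal_ker_iff, map_sub, map_mul, hQ, map_smul_one', hω₀, sub_self])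
  have hE0 : Q' * Q' - ω • 1 ∈ homDeg d (PS n A') 0 := by
    refine sub_mem (mul_mem_homDeg ho ho) ?_
    intro a c hac
    rw [Matrix.smul_apply, one_mem_homDeg a c hac, smul_zero]
  have hEa : adj (b.formOver A') (Q' * Q' - ω • 1) = (1 : ℤ) • (Q' * Q' - ω • 1) := by
    rw [adj_sub, adj_mul, ha, adj_smul_one, smul_mul_smul_comm, b.kind.sign_mul_self, one_smul,
      one_smul]
  have hf0 : ∀ l, f l ∈ homDeg d (PS n k) 0 := coord_homDeg ηp (by rw [← hf]; exact hE0)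
  have hfa : ∀ l, adj b.form (f l) = f l := fun l => by
    have := coord_adj b ηp (by rw [← hf]; exact hEa) l
    rwa [one_smul] at this
  have hfc : ∀ l, M.Q * f l - f l * M.Q = 0 := by
    apply matrix_coord_unique ηp
    have h1 : Q' * (Q' * Q' - ω • 1) - (Q' * Q' - ω • 1) * Q' = 0 := by
      rw [mul_sub, sub_mul, mul_smul_comm, smul_mul_assoc, mul_one, one_mul, mul_assoc]
      abel
    have hZ : Q' * Q' - ω • 1 ∈ matIdeal n d (RingHom.ker p) := by
      rw [hf]
      exact sum_smul_mem_matIdeal (fun l => (ηp l).2) _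
    rw [mul_small hJ hm hZ, small_mul hJ hm hZ, hf, const_mul_sum, sum_mul_const,
      ← Finset.sum_sub_distrib] at h1
    rw [← h1]
    exact Finset.sum_congr rfl fun l _ => by rw [map_sub, smul_sub]
  let f' : Fin r → M.Z 0 := fun l => ⟨f l, M.mem_Z_zero.2 ⟨hf0 l, hfc l⟩⟩
  exact ⟨Q', ω, f', fun l => ⟨M.cls (f' l), cls_mem_extPart b (f' l) (by rw [one_smul]; exact hfa l)⟩,
    ⟨ho, ha, hQ, hω₀, hf, fun l => rfl⟩, hfa⟩

include hp hJ in
/-- Unobstructed deformations lift. -/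
theorem exists_lift_of_represents_zero [CharZero k] {N : Deformation M (some b) A}
    {Q' : Mat d (PS n A')} {ω : PS n A'} {f : Fin r → M.Z 0} {e : Fin r → b.extPart 0 1}
    (h : IsDefect b p N Q' ω ηp f e) (hfa : ∀ l, adj b.form (f l) = (f l : Mat d (PS n k)))
    (h0 : Represents b ηp (Q' * Q' - ω • 1) 0) :
    ∃ N' : Deformation M (some b) A', N'.map p = N := by
  have hJm : RingHom.ker p ≤ maximalIdeal A' := ker_le_maximalIdeal p
  obtain ⟨g, z, hz, hE⟩ := h0.exists_of_eq_zero
  have hfz : ∀ l, (f l : Mat d (PS n k)) = g l • 1 + (M.Q * z l + z l * M.Q) :=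
    matrix_coord_eq ηp (h.defect.symm.trans hE)
  -- The primitives `z l` need not be compatible with the form. Since `f l - g l` is selfadjoint,
  -- symmetrizing them preserves their anticommutator with `Q`; the minus sign makes `y l` cancel
  -- the defect up to the scalar `g l`.
  set y : Fin r → Mat d (PS n k) := fun l => - symmetrize b b.kind.sign (z l) with hy
  have hyo : ∀ l, y l ∈ homDeg d (PS n k) 1 := fun l => neg_mem (symmetrize_homDeg b _ (hz l))
  have hya : ∀ l, adj b.form (y l) = b.kind.sign • y l := fun l => by
    have : adj b.form (y l) = - adj b.form (symmetrize b b.kind.sign (z l)) :=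
      map_neg (adjL b.form) _
    rw [this, adj_symmetrize b b.kind.sign_mul_self, hy, smul_neg]
  have hyQ : ∀ l, M.Q * y l + y l * M.Q = g l • 1 - f l := fun l => by
    have h1 := symmetrize_anticommutator b (z l)
    have h2 : M.Q * z l + z l * M.Q = f l - g l • 1 := by rw [hfz, add_sub_cancel_left]
    rw [h2, symmetrize_eq_self b (one_mul 1)
      (by rw [adj_sub, hfa, adj_smul_one, one_smul])] at h1
    rw [hy, mul_neg, neg_mul, ← neg_add, h1, neg_sub]
  have hm := lift_sub_mem hp N h.lift_Q
  have hsq := sq_add_small hJ hJm (fun l => (ηp l).2) hm y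
  have hYJ := sum_smul_mem_matIdeal (fun l => (ηp l).2) fun l => (const n A').mapMatrix (y l)
  have hpY := matIdeal_ker_iff.1 hYJ
  refine ⟨⟨Q' + ∑ l, (ηp l : A') • (const n A').mapMatrix (y l), ?_, ?_, ?_, ?_⟩,
    Deformation.ext ?_⟩
  · refine add_mem h.odd (sum_mem fun l _ => ?_)
    intro a c hac
    rw [Matrix.smul_apply, map_mem_homDeg (const n A') (hyo l) a c hac, smul_zero]
  · refine ⟨ω + ∑ l, (ηp l : A') • const n A' (g l), ?_⟩
    have h1 : Q' * Q' = ω • 1 + ∑ l, (ηp l : A') • (const n A').mapMatrix (f l : Mat d (PS n k)) := by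
      rw [← h.defect, add_sub_cancel]
    rw [hsq, h1, add_assoc, ← Finset.sum_add_distrib, add_smul, Finset.sum_smul]
    congr 1
    refine Finset.sum_congr rfl fun l _ => ?_
    rw [← smul_add, ← map_add, hyQ, add_sub_cancel, const_smul_one, smul_assoc]
  · rw [map_add, (mem_matIdeal_maximalIdeal _).1 (matIdeal_mono hJm hYJ), add_zero]
    have := (mem_matIdeal_maximalIdeal _).1 hm
    rwa [map_sub, sub_eq_zero] at this
  · rintro b' hb'
    obtain rfl : b = b' := by simpa using hb'
    rw [adj_add, h.adj_eq, adj_sum_smul_const, smul_add, Finset.smul_sum]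
    congr 1
    refine Finset.sum_congr rfl fun l _ => ?_
    rw [hya, map_zsmul, smul_comm]
  · change (MvPowerSeries.map (p : A' →+* A)).mapMatrix (Q' + _) = N.Q
    rw [map_add, hpY, add_zero, h.lift_Q]

include hp hJ in
-- The value on a class is computed from one chosen lift. Comparing defects of equivalent
-- deformations shows both that this descends to classes and, applied to `N` and itself, that every
-- other choice of lift gives the same value.
theorem exists_obstructionMap [IsArtinianRing A'] [IsArtinianRing A] [CharZero k] (hd : 1 ≤ d) (b : BilinearStructure M) :
    ∃ ob : Def M (some b) A → b.ObstructionSpace ⊗[k] RingHom.ker p,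
      IsObstructionMap b p ob := by
  have : Module.Finite k (RingHom.ker p) := finite_of_small hJ
  let ηp := Module.finBasis k (RingHom.ker p)
  choose Q' ω f e h hfa using fun N : Deformation M (some b) A => exists_defect_coord hp hJ ηp N
  let ob' : Deformation M (some b) A → b.ObstructionSpace ⊗[k] RingHom.ker p :=
    fun N => ∑ i, Submodule.Quotient.mk (e N i) ⊗ₜ[k] ηp i
  have hob' : ∀ N₁ N₂, N₁.Equivalent N₂ → ob' N₁ = ob' N₂ := fun N₁ N₂ hN =>
    (represents_eq_of_equivalent hp hJ hd hN (h N₁).odd (h N₂).odd (h N₁).lift_Q (h N₂).lift_Q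
      (h N₁).lift_potential (h N₂).lift_potential ((h N₁).represents (ηp := ηp))
      (h N₂).represents).symm
  refine ⟨Quotient.lift ob' hob', fun N => ⟨⟨_, _, _, _, _, _, h N⟩, ?_, ?_⟩⟩
  · intro Q ω' m ξ g c hdef
    exact represents_eq_of_equivalent hp hJ hd (Deformation.Equivalent.refl N) hdef.odd (h N).odd
      hdef.lift_Q (h N).lift_Q hdef.lift_potential (h N).lift_potential
      (hdef.represents (ηp := ηp)) (h N).represents
  · change ob' N = 0 ↔ _
    constructor
    · intro h0
      have h1 := (h N).represents (ηp := ηp)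
      change Represents b ηp _ (ob' N) at h1
      rw [h0] at h1
      obtain ⟨N', hN'⟩ := exists_lift_of_represents_zero hp hJ (h N) (hfa N) h1
      exact ⟨N', by rw [hN']⟩
    · rintro ⟨N', hN'⟩
      obtain ⟨ω', hω'⟩ := N'.sq
      -- A deformation over `A'` is its own lift, with zero defect. It reduces to `N` only up to
      -- equivalence, which invariance of the obstruction allows.
      have h1 : Represents b ηp (N'.Q * N'.Q - ω' • 1) 0 := by
        rw [hω', sub_self]
        exact represents_zero
      refine represents_eq_of_equivalent hp hJ hd (Quotient.exact hN') N'.odd (h N).odd rfl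
        (h N).lift_Q ?_ (h N).lift_potential h1 (h N).represents
      change (MvPowerSeries.map (p : A' →+* A)).mapMatrix N'.Q *
        (MvPowerSeries.map (p : A' →+* A)).mapMatrix N'.Q = _
      rw [← map_mul, hω', map_smul_one']

end defect

end obstruction

/-! ### Coefficients with respect to the parameters -/

/-- A map of families indexed by a well-founded order, each value of which only depends on the
earlier ones, has a fixed point. -/
theorem exists_fixedPoint_of_lt {ι α : Type*} [Preorder ι] [WellFoundedLT ι] [Zero α]
    (Φ : (ι → α) → ι → α) (hΦ : ∀ f g m, (∀ m' < m, f m' = g m') → Φ f m = Φ g m) :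
    ∃ f, Φ f = f := by
  classical
  -- Values not below `m` are filled in by `0`; this is harmless because `Φ` at `m` ignores them.
  let F : ∀ m : ι, (∀ m', m' < m → α) → α := fun m rec =>
    Φ (fun m' => if h : m' < m then rec m' h else 0) m
  let f : ι → α := wellFounded_lt.fix F
  refine ⟨f, funext fun m => ?_⟩
  have h : f m = F m fun m' _ => f m' := wellFounded_lt.fix_eq F m
  rw [h]
  refine hΦ _ _ _ fun m' hm' => ?_
  rw [dif_pos hm']

section slices
variable {k : Type*} [Field k] {n d r : ℕ}

/-- The coefficient of the monomial `t ^ m` in the parameters. -/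
def slice (m : Fin r →₀ ℕ) : Mat d (PS n (MvPowerSeries (Fin r) k)) →+ Mat d (PS n k) where
  toFun X := Matrix.of fun a b e => MvPowerSeries.coeff m (MvPowerSeries.coeff e (X a b))
  map_zero' := by
    ext a b e
    change MvPowerSeries.coeff m (MvPowerSeries.coeff e (0 : PS n (MvPowerSeries (Fin r) k))) = 0
    rw [map_zero, map_zero]
  map_add' X Y := by
    ext a b e
    change MvPowerSeries.coeff m (MvPowerSeries.coeff e (X a b + Y a b)) = _
    rw [map_add, map_add]
    rfl

theorem coeff_slice (m : Fin r →₀ ℕ) (X : Mat d (PS n (MvPowerSeries (Fin r) k)))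
    (a b : Fin d ⊕ Fin d) (e : Fin n →₀ ℕ) : MvPowerSeries.coeff e (slice m X a b) =
      MvPowerSeries.coeff m (MvPowerSeries.coeff e (X a b)) := rfl

/-- The matrix with given coefficients with respect to the parameters. -/
def ofSlices (f : (Fin r →₀ ℕ) → Mat d (PS n k)) : Mat d (PS n (MvPowerSeries (Fin r) k)) :=
  Matrix.of fun a b e m => MvPowerSeries.coeff e (f m a b)

theorem slice_ofSlices (f : (Fin r →₀ ℕ) → Mat d (PS n k)) (m : Fin r →₀ ℕ) :
    slice m (ofSlices f) = f m := rfl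

theorem slice_ext {X Y : Mat d (PS n (MvPowerSeries (Fin r) k))}
    (h : ∀ m, slice m X = slice m Y) : X = Y := by
  ext a b e m
  rw [← coeff_slice, ← coeff_slice, h]

theorem slice_mul (m : Fin r →₀ ℕ) (X Y : Mat d (PS n (MvPowerSeries (Fin r) k))) :
    slice m (X * Y) = ∑ x ∈ Finset.HasAntidiagonal.antidiagonal m, slice x.1 X * slice x.2 Y := by
  classical
  ext a b e
  rw [coeff_slice, Matrix.sum_apply, map_sum, Matrix.mul_apply, map_sum, map_sum]
  simp_rw [Matrix.mul_apply, map_sum, MvPowerSeries.coeff_mul, map_sum, MvPowerSeries.coeff_mul,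
    coeff_slice]
  rw [Finset.sum_comm, Finset.sum_congr rfl fun c _ => Finset.sum_comm, Finset.sum_comm]
  exact Finset.sum_congr rfl fun c _ => Finset.sum_comm

theorem slice_const (m : Fin r →₀ ℕ) (x : Mat d (PS n k)) :
    slice m ((const n (MvPowerSeries (Fin r) k)).mapMatrix x) = if m = 0 then x else 0 := by
  classical
  ext a b e
  rw [coeff_slice]
  change MvPowerSeries.coeff m (MvPowerSeries.coeff e (const n _ (x a b))) = _
  rw [const, MvPowerSeries.coeff_map, MvPowerSeries.algebraMap_apply, MvPowerSeries.coeff_C]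
  split_ifs <;> simp

theorem slice_smul (m : Fin r →₀ ℕ) (c : MvPowerSeries (Fin r) k)
    (X : Mat d (PS n (MvPowerSeries (Fin r) k))) :
    slice m (c • X) = ∑ x ∈ Finset.HasAntidiagonal.antidiagonal m, MvPowerSeries.coeff x.1 c • slice x.2 X := by
  classical
  ext a b e
  rw [coeff_slice, Matrix.sum_apply, map_sum]
  change MvPowerSeries.coeff m (MvPowerSeries.coeff e (c • X a b)) = _
  rw [map_smul, smul_eq_mul, MvPowerSeries.coeff_mul]
  refine Finset.sum_congr rfl fun x _ => ?_
  rw [Matrix.smul_apply, map_smul, smul_eq_mul, coeff_slice]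

theorem slice_smul_const (m : Fin r →₀ ℕ) (c : MvPowerSeries (Fin r) k) (x : Mat d (PS n k)) :
    slice m (c • (const n (MvPowerSeries (Fin r) k)).mapMatrix x) =
      MvPowerSeries.coeff m c • x := by
  classical
  rw [slice_smul, Finset.sum_eq_single (m, 0)]
  · rw [slice_const, if_pos rfl]
  · rintro ⟨i, j⟩ h1 h2
    rw [slice_const, if_neg, smul_zero]
    rintro rfl
    rw [Finset.HasAntidiagonal.mem_antidiagonal, add_zero] at h1
    exact h2 (by rw [← h1])
  · intro h
    exact absurd (Finset.HasAntidiagonal.mem_antidiagonal.2 (add_zero m)) h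

theorem slice_const_mul (m : Fin r →₀ ℕ) (x : Mat d (PS n k))
    (X : Mat d (PS n (MvPowerSeries (Fin r) k))) :
    slice m ((const n (MvPowerSeries (Fin r) k)).mapMatrix x * X) = x * slice m X := by
  classical
  rw [slice_mul, Finset.sum_eq_single (0, m)]
  · rw [slice_const, if_pos rfl]
  · rintro ⟨i, j⟩ h1 h2
    rw [slice_const, if_neg, zero_mul]
    rintro rfl
    rw [Finset.HasAntidiagonal.mem_antidiagonal, zero_add] at h1
    exact h2 (by rw [← h1])
  · intro h
    exact absurd (Finset.HasAntidiagonal.mem_antidiagonal.2 (zero_add m)) h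

theorem slice_mul_const (m : Fin r →₀ ℕ) (x : Mat d (PS n k))
    (X : Mat d (PS n (MvPowerSeries (Fin r) k))) :
    slice m (X * (const n (MvPowerSeries (Fin r) k)).mapMatrix x) = slice m X * x := by
  classical
  rw [slice_mul, Finset.sum_eq_single (m, 0)]
  · rw [slice_const, if_pos rfl]
  · rintro ⟨i, j⟩ h1 h2
    rw [slice_const, if_neg, mul_zero]
    rintro rfl
    rw [Finset.HasAntidiagonal.mem_antidiagonal, add_zero] at h1
    exact h2 (by rw [← h1])
  · intro h
    exact absurd (Finset.HasAntidiagonal.mem_antidiagonal.2 (add_zero m)) h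

theorem mem_homDeg_iff_slice {i : ZMod 2} {X : Mat d (PS n (MvPowerSeries (Fin r) k))} :
    X ∈ homDeg d (PS n (MvPowerSeries (Fin r) k)) i ↔
      ∀ m, slice m X ∈ homDeg d (PS n k) i := by
  constructor
  · intro h m a b hab
    ext e
    rw [coeff_slice, h a b hab, map_zero, map_zero, map_zero]
  · intro h a b hab
    ext e m
    rw [← coeff_slice, h m a b hab, map_zero, map_zero, map_zero]

theorem slice_transpose (m : Fin r →₀ ℕ) (X : Mat d (PS n (MvPowerSeries (Fin r) k))) :
    slice m X.transpose = (slice m X).transpose := rfl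

theorem mem_matIdeal_maximalIdeal_iff_slice {X : Mat d (PS n (MvPowerSeries (Fin r) k))} :
    X ∈ matIdeal n d (maximalIdeal (MvPowerSeries (Fin r) k)) ↔ slice 0 X = 0 := by
  have h : ∀ c : MvPowerSeries (Fin r) k, c ∈ maximalIdeal (MvPowerSeries (Fin r) k) ↔
      MvPowerSeries.coeff 0 c = 0 := fun c => by
    rw [mem_maximalIdeal, mem_nonunits_iff, MvPowerSeries.isUnit_iff_constantCoeff,
      isUnit_iff_ne_zero, not_not, MvPowerSeries.coeff_zero_eq_constantCoeff_apply]
  constructor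
  · intro hX
    ext a b e
    exact (h _).1 (hX a b e)
  · intro hX a b e
    rw [h, ← coeff_slice, hX]
    exact map_zero _

/-- A series in the parameters as a scalar: the function with given coefficients. -/
def ofScalarSlices (f : (Fin r →₀ ℕ) → PS n k) : PS n (MvPowerSeries (Fin r) k) :=
  fun e m => MvPowerSeries.coeff e (f m)

theorem slice_ofScalarSlices_smul_one (f : (Fin r →₀ ℕ) → PS n k) (m : Fin r →₀ ℕ) :
    slice m (ofScalarSlices f • (1 : Mat d (PS n (MvPowerSeries (Fin r) k)))) = f m • 1 := by
  classical
  ext a b e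
  rw [coeff_slice]
  by_cases h : a = b
  · subst h
    rw [Matrix.smul_apply, Matrix.smul_apply, Matrix.one_apply_eq, Matrix.one_apply_eq,
      smul_eq_mul, smul_eq_mul, mul_one, mul_one]
    rfl
  · rw [Matrix.smul_apply, Matrix.smul_apply, Matrix.one_apply_ne h, Matrix.one_apply_ne h,
      smul_zero, smul_zero, map_zero, map_zero, map_zero]

/-- The extension of a `k`-linear endomorphism to power series in the parameters. -/
def extendEnd (L : Mat d (PS n k) →ₗ[k] Mat d (PS n k)) :
    Mat d (PS n (MvPowerSeries (Fin r) k)) →ₗ[MvPowerSeries (Fin r) k]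
      Mat d (PS n (MvPowerSeries (Fin r) k)) where
  toFun X := ofSlices fun m => L (slice m X)
  map_add' X Y := by
    refine slice_ext fun m => ?_
    rw [map_add, slice_ofSlices, slice_ofSlices, slice_ofSlices, map_add, map_add]
  map_smul' c X := by
    refine slice_ext fun m => ?_
    rw [RingHom.id_apply, slice_smul, slice_ofSlices, slice_smul, map_sum]
    refine Finset.sum_congr rfl fun x _ => ?_
    rw [map_smul, slice_ofSlices]

theorem slice_extendEnd (L : Mat d (PS n k) →ₗ[k] Mat d (PS n k)) (m : Fin r →₀ ℕ)
    (X : Mat d (PS n (MvPowerSeries (Fin r) k))) : slice m (extendEnd L X) = L (slice m X) := rfl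

/-- The series of the values of a linear form on the coefficients. -/
def formSeries (L : Mat d (PS n k) →ₗ[k] k) (X : Mat d (PS n (MvPowerSeries (Fin r) k))) :
    MvPowerSeries (Fin r) k := fun m => L (slice m X)

theorem coeff_formSeries (L : Mat d (PS n k) →ₗ[k] k) (m : Fin r →₀ ℕ)
    (X : Mat d (PS n (MvPowerSeries (Fin r) k))) :
    MvPowerSeries.coeff m (formSeries L X) = L (slice m X) := rfl

/-- The extension of a `k`-linear form to power series in the parameters. -/
def extendForm (L : Mat d (PS n k) →ₗ[k] k) :
    Mat d (PS n (MvPowerSeries (Fin r) k)) →ₗ[MvPowerSeries (Fin r) k]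
      MvPowerSeries (Fin r) k where
  toFun X := formSeries L X
  map_add' X Y := by
    ext m
    rw [map_add, coeff_formSeries, coeff_formSeries, coeff_formSeries, map_add, map_add]
  map_smul' c X := by
    classical
    ext m
    rw [RingHom.id_apply, smul_eq_mul, MvPowerSeries.coeff_mul, coeff_formSeries, slice_smul,
      map_sum]
    refine Finset.sum_congr rfl fun x _ => ?_
    rw [map_smul, smul_eq_mul, coeff_formSeries]

theorem exists_sum_of_mem_matIdeal {A : Type*} [CommRing A] [IsNoetherianRing A] {𝔞 : Ideal A}
    {X : Mat d (PS n A)} (hX : X ∈ matIdeal n d 𝔞) :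
    ∃ (N : ℕ) (η : Fin N → A) (Y : Fin N → Mat d (PS n A)),
      (∀ l, η l ∈ 𝔞) ∧ X = ∑ l, η l • Y l := by
  obtain ⟨N, η, h⟩ := exists_fin_span_eq 𝔞
  rw [← h] at hX
  obtain ⟨Y, hY⟩ := exists_of_mem_matIdeal_span hX
  exact ⟨N, η, Y, fun l => h ▸ Ideal.subset_span ⟨l, rfl⟩, hY⟩

/-- A matrix with coefficients in a finitely generated ideal is a finite combination of generators
times matrices, so linearity over the parameter ring suffices. -/
theorem linearMap_mem_matIdeal {A : Type*} [CommRing A] [IsNoetherianRing A] {𝔞 : Ideal A}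
    (L : Mat d (PS n A) →ₗ[A] Mat d (PS n A)) {X : Mat d (PS n A)} (hX : X ∈ matIdeal n d 𝔞) :
    L X ∈ matIdeal n d 𝔞 := by
  obtain ⟨N, η, Y, hη, rfl⟩ := exists_sum_of_mem_matIdeal hX
  rw [map_sum]
  refine sum_mem fun l _ => ?_
  rw [map_smul]
  exact matIdeal_smul_mem (hη l) _

theorem linearForm_mem_of_mem_matIdeal {A : Type*} [CommRing A] [IsNoetherianRing A]
    {𝔞 : Ideal A} (L : Mat d (PS n A) →ₗ[A] A) {X : Mat d (PS n A)}
    (hX : X ∈ matIdeal n d 𝔞) : L X ∈ 𝔞 := by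
  obtain ⟨N, η, Y, hη, rfl⟩ := exists_sum_of_mem_matIdeal hX
  rw [map_sum]
  refine sum_mem fun l _ => ?_
  rw [map_smul]
  exact Ideal.mul_mem_right _ _ (hη l)

end slices

/-! ### Splittings -/

section splitting
variable {k U V V' : Type*} [Field k] [AddCommGroup U] [Module k U] [AddCommGroup V] [Module k V]
  [AddCommGroup V'] [Module k V']

/-- A right inverse of `T` onto its range, extended arbitrarily to all of `V`, so that it can later
be applied to every coefficient of a series. -/
theorem exists_section_of_range (T : U →ₗ[k] V) :
    ∃ σ : V →ₗ[k] U, ∀ y ∈ LinearMap.range T, T (σ y) = y := by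
  obtain ⟨r, hr⟩ := T.rangeRestrict.exists_rightInverse_of_surjective T.range_rangeRestrict
  obtain ⟨σ, hσ⟩ := r.exists_extend
  refine ⟨σ, fun y hy => ?_⟩
  have h1 : σ y = r ⟨y, hy⟩ := LinearMap.congr_fun hσ ⟨y, hy⟩
  rw [h1]
  exact congrArg Subtype.val (LinearMap.congr_fun hr ⟨y, hy⟩)

/-- A subspace `E` decomposes as the kernel of `D`, parametrized by `T`, and a complement. -/
theorem exists_splitting (T : U →ₗ[k] V) (D : V →ₗ[k] V') (E : Submodule k V)
    (h : LinearMap.range T = E ⊓ LinearMap.ker D) :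
    ∃ (σ : V →ₗ[k] U) (θ : V' →ₗ[k] V), ∀ y ∈ E, y = T (σ y) + θ (D y) := by
  obtain ⟨σ, hσ⟩ := exists_section_of_range T
  -- `τ` inverts `D` on the image of `E`; `y - τ (D y)` then lies in `E` and in the kernel of `D`,
  -- hence in the range of `T`.
  obtain ⟨τ, hτ⟩ := exists_section_of_range (D.comp E.subtype)
  refine ⟨σ.comp (LinearMap.id - (E.subtype.comp τ).comp D), E.subtype.comp τ, fun y hy => ?_⟩
  have h1 : D (τ (D y)) = D y := hτ (D y) ⟨⟨y, hy⟩, rfl⟩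
  have h2 : y - (τ (D y) : V) ∈ LinearMap.range T := by
    rw [h]
    refine ⟨sub_mem hy (τ (D y)).2, ?_⟩
    change D _ = 0
    rw [map_sub, h1, sub_self]
  have h3 := hσ _ h2
  change y = T (σ (y - (τ (D y) : V))) + (τ (D y) : V)
  rw [h3, sub_add_cancel]

/-- Since the kernel of `Φ` is contained in `W`, the space `Z / (W ∩ Z)` is a quotient of the finite
dimensional image of `Φ`; the `c j` represent a basis of it. -/
theorem exists_basis_of_quotient (W Z : Submodule k V) (Φ : Z →ₗ[k] V') [Module.Finite k V']
    (hΦ : ∀ y, Φ y = 0 → (y : V) ∈ W) :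
    ∃ (m : ℕ) (c : Fin m → V), (∀ j, c j ∈ Z) ∧
      (∀ y ∈ Z, ∃ a : Fin m → k, y - ∑ j, a j • c j ∈ W) ∧
      ∀ a : Fin m → k, ∑ j, a j • c j ∈ W → a = 0 := by
  have hker : LinearMap.ker Φ ≤ W.submoduleOf Z := fun y hy => hΦ y hy
  have : Module.Finite k (Z ⧸ LinearMap.ker Φ) :=
    Module.Finite.equiv Φ.quotKerEquivRange.symm
  have : Module.Finite k (Z ⧸ W.submoduleOf Z) :=
    Module.Finite.of_surjective (Submodule.factor hker) (Submodule.factor_surjective hker)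
  let B := Module.finBasis k (Z ⧸ W.submoduleOf Z)
  choose c hc using fun j => Submodule.Quotient.mk_surjective _ (B j)
  have hsum : ∀ a : Fin (Module.finrank k (Z ⧸ W.submoduleOf Z)) → k,
      (Submodule.Quotient.mk (∑ j, a j • c j) : Z ⧸ W.submoduleOf Z) = ∑ j, a j • B j := fun a => by
    change (W.submoduleOf Z).mkQ _ = _
    rw [map_sum]
    refine Finset.sum_congr rfl fun j _ => ?_
    rw [map_smul]
    exact congrArg _ (hc j)
  have hcoe : ∀ a : Fin (Module.finrank k (Z ⧸ W.submoduleOf Z)) → k,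
      ((∑ j, a j • c j : Z) : V) = ∑ j, a j • (c j : V) := fun a => by
    rw [AddSubmonoidClass.coe_finsetSum]
    rfl
  refine ⟨_, fun j => c j, fun j => (c j).2, fun y hy => ?_, fun a ha => ?_⟩
  · refine ⟨fun j => B.repr (Submodule.Quotient.mk ⟨y, hy⟩) j, ?_⟩
    rw [← hcoe]
    have h1 := hsum (fun j => B.repr (Submodule.Quotient.mk ⟨y, hy⟩) j)
    rw [B.sum_repr, eq_comm, Submodule.Quotient.eq] at h1
    exact h1
  · rw [← hcoe] at ha
    have h1 : (Submodule.Quotient.mk (∑ j, a j • c j) : Z ⧸ W.submoduleOf Z) = 0 :=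
      (Submodule.Quotient.mk_eq_zero _).2 ha
    rw [hsum] at h1
    funext j
    exact Fintype.linearIndependent_iff.1 B.linearIndependent a h1 j

end splitting

/-! ### Splitting of even selfadjoint matrices -/

section decomposition
variable {k : Type u} [Field k] {n d : ℕ} {w : MvPolynomial (Fin n) k}
  {M : MatrixFactorization w d}

/-- The matrices of degree `i` with `f^adj = s f`. -/
def adjPart (b : BilinearStructure M) (i : ZMod 2) (s : ℤ) : Submodule k (Mat d (PS n k)) where
  carrier := {f | f ∈ homDeg d (PS n k) i ∧ adj b.form f = s • f}
  add_mem' := by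
    rintro f g ⟨hf, hf'⟩ ⟨hg, hg'⟩
    exact ⟨add_mem hf hg, by rw [adj_add, hf', hg', smul_add]⟩
  zero_mem' := ⟨zero_mem _, by simp [adj]⟩
  smul_mem' := by
    rintro c f ⟨hf, hf'⟩
    exact ⟨homDeg_smul_field_mem c hf, by rw [adj_smul_scalar, hf', smul_comm]⟩

/-- `f ↦ Q f + f Q`. -/
def anticommutator (M : MatrixFactorization w d) : Mat d (PS n k) →ₗ[k] Mat d (PS n k) where
  toFun f := M.Q * f + f * M.Q
  map_add' f g := by noncomm_ring
  map_smul' c f := by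
    rw [RingHom.id_apply, mul_smul_comm, smul_mul_assoc, smul_add]

/-- `f ↦ Q f - f Q`. -/
def commutator (M : MatrixFactorization w d) : Mat d (PS n k) →ₗ[k] Mat d (PS n k) where
  toFun f := M.Q * f - f * M.Q
  map_add' f g := by noncomm_ring
  map_smul' c f := by
    rw [RingHom.id_apply, mul_smul_comm, smul_mul_assoc, smul_sub]

/-- The scalar matrices. -/
def scalarL (d n : ℕ) (k : Type*) [Field k] : PS n k →ₗ[k] Mat d (PS n k) where
  toFun g := g • 1
  map_add' f g := add_smul f g 1
  map_smul' c f := smul_assoc c f 1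

theorem anticommutator_mem (b : BilinearStructure M) {z : Mat d (PS n k)}
    (hz : z ∈ adjPart b 1 b.kind.sign) : anticommutator M z ∈ adjPart b 0 1 := by
  refine ⟨add_mem (mul_mem_homDeg M.odd hz.1) (mul_mem_homDeg hz.1 M.odd), ?_⟩
  change adj b.form (M.Q * z + z * M.Q) = (1 : ℤ) • (M.Q * z + z * M.Q)
  rw [adj_add, adj_mul, adj_mul, hz.2, b.adj_Q, smul_mul_smul_comm, smul_mul_smul_comm,
    b.kind.sign_mul_self, one_smul, one_smul, one_smul, add_comm]

theorem commutator_anticommutator (M : MatrixFactorization w d) (z : Mat d (PS n k)) :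
    commutator M (anticommutator M z) = 0 := by
  change M.Q * (M.Q * z + z * M.Q) - (M.Q * z + z * M.Q) * M.Q = 0
  have h : M.Q * (M.Q * z + z * M.Q) - (M.Q * z + z * M.Q) * M.Q =
      (M.Q * M.Q) * z - z * (M.Q * M.Q) := by noncomm_ring
  rw [h, M.sq, smul_mul_assoc, mul_smul_comm, one_mul, mul_one, sub_self]

theorem commutator_scalar (M : MatrixFactorization w d) (g : PS n k) :
    commutator M (g • 1) = 0 := by
  change M.Q * (g • 1) - (g • 1) * M.Q = 0
  rw [smul_mul_assoc, mul_smul_comm, one_mul, mul_one, sub_self]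

theorem smul_one_mem_adjPart (b : BilinearStructure M) (g : PS n k) :
    (g • 1 : Mat d (PS n k)) ∈ adjPart b 0 1 :=
  ⟨Submodule.smul_mem _ _ one_mem_homDeg, by rw [adj_smul_one, one_smul]⟩

/-- The class in `Ext⁰` of a selfadjoint cocycle. -/
def selfadjointClass (b : BilinearStructure M) :
    (adjPart b 0 1 ⊓ LinearMap.ker (commutator M) : Submodule k (Mat d (PS n k))) →ₗ[k]
      M.Ext 0 where
  toFun f := M.cls ⟨f.1, M.mem_Z_zero.2 ⟨f.2.1.1, f.2.2⟩⟩
  map_add' _ _ := rfl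
  map_smul' _ _ := rfl

/-- Even selfadjoint matrices decompose into coboundaries, scalars, a finite dimensional space
of cocycles, and a complement determined by the commutator with `Q`. -/
theorem exists_decomposition [CharZero k] (hiso : IsolatedSingularity w)
    (b : BilinearStructure M) :
    ∃ (m : ℕ) (c : Fin m → Mat d (PS n k)) (H : Mat d (PS n k) →ₗ[k] Mat d (PS n k))
      (ρ : Mat d (PS n k) →ₗ[k] PS n k) (l : Fin m → Mat d (PS n k) →ₗ[k] k)
      (θ : Mat d (PS n k) →ₗ[k] Mat d (PS n k)),
      (∀ y, H y ∈ adjPart b 1 b.kind.sign) ∧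
      (∀ y ∈ adjPart b 0 1, y = anticommutator M (H y) + ρ y • 1 + ∑ j, l j y • c j +
        θ (commutator M y)) ∧
      ∀ (a : Fin m → k) (z : Mat d (PS n k)) (g : PS n k), z ∈ adjPart b 1 b.kind.sign →
        ∑ j, a j • c j = anticommutator M z + g • 1 → a = 0 := by
  have hs := b.kind.sign_mul_self
  let Z : Submodule k (Mat d (PS n k)) := adjPart b 0 1 ⊓ LinearMap.ker (commutator M)
  -- The trivial obstructions: coboundaries of matrices compatible with the form, and scalars.
  let T₀ : (adjPart b 1 b.kind.sign × PS n k) →ₗ[k] Mat d (PS n k) :=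
    ((anticommutator M).comp (adjPart b 1 b.kind.sign).subtype).coprod (scalarL d n k)
  have hfin := finite_ext M hiso 0
  have hT₀ : LinearMap.range T₀ ≤ Z := by
    rintro _ ⟨⟨z, g⟩, rfl⟩
    refine add_mem ⟨anticommutator_mem b z.2, commutator_anticommutator M z⟩
      ⟨smul_one_mem_adjPart b g, commutator_scalar M g⟩
  -- Finiteness comes from `Ext⁰`: a selfadjoint cocycle of zero class is the coboundary of a
  -- symmetrized primitive, hence a trivial obstruction.
  obtain ⟨m, c, hc, hspan, hind⟩ := exists_basis_of_quotient (LinearMap.range T₀) Z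
    (selfadjointClass b) (by
      intro y hy
      have h1 : M.cls ⟨y.1, M.mem_Z_zero.2 ⟨y.2.1.1, y.2.2⟩⟩ = 0 := hy
      rw [Submodule.Quotient.mk_eq_zero] at h1
      obtain ⟨g, hg, hgy⟩ := M.mem_B_zero.1 h1
      refine ⟨(⟨symmetrize b b.kind.sign g, symmetrize_homDeg b _ hg, adj_symmetrize b hs g⟩, 0),
        ?_⟩
      change M.Q * symmetrize b b.kind.sign g + symmetrize b b.kind.sign g * M.Q +
        (0 : PS n k) • 1 = y.1
      have h2 : adj b.form y.1 = (1 : ℤ) • y.1 := y.2.1.2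
      rw [zero_smul, add_zero, symmetrize_anticommutator, hgy]
      exact symmetrize_eq_self b (one_mul 1) h2)
  let T : ((adjPart b 1 b.kind.sign × PS n k) × (Fin m → k)) →ₗ[k] Mat d (PS n k) :=
    T₀.coprod (Fintype.linearCombination k c)
  have hTa : ∀ x, T x = M.Q * x.1.1.1 + x.1.1.1 * M.Q + x.1.2 • 1 + ∑ j, x.2 j • c j := fun x => rfl
  obtain ⟨σ, θ, hσ⟩ := exists_splitting T (commutator M) (adjPart b 0 1) (by
    apply le_antisymm
    · rintro _ ⟨x, rfl⟩
      have h1 : ∑ j, x.2 j • c j ∈ Z := sum_mem fun j _ => Submodule.smul_mem Z _ (hc j)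
      exact add_mem (hT₀ ⟨x.1, rfl⟩) h1
    · intro y hy
      obtain ⟨a, x, hx⟩ := hspan y hy
      refine ⟨(x, a), ?_⟩
      change T₀ x + ∑ j, a j • c j = y
      rw [hx, sub_add_cancel])
  refine ⟨m, c, (adjPart b 1 b.kind.sign).subtype.comp
    ((LinearMap.fst k _ _).comp ((LinearMap.fst k _ _).comp σ)),
    (LinearMap.snd k _ _).comp ((LinearMap.fst k _ _).comp σ),
    fun j => (LinearMap.proj j).comp ((LinearMap.snd k _ _).comp σ), θ,
    fun y => (σ y).1.1.2, fun y hy => ?_, fun a z g hz h => hind a ⟨(⟨z, hz⟩, g), h.symm⟩⟩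
  have := hσ y hy
  rw [hTa] at this
  exact this

variable (b : BilinearStructure M)

/-- In the exact sequence the left term is part of a finite dimensional `Ext`, and the right term is
an ideal of the finite dimensional Milnor algebra. -/
theorem finite_tangent [IsAlgClosed k] [CharZero k] (hd : 1 ≤ d)
    (hw : MvPolynomial.constantCoeff w = 0) (hiso : IsolatedSingularity w) :
    Module.Finite k (Tangent M (some b)) := by
  obtain ⟨ι, π, -, -, -, h2, hπ⟩ := exists_tangent_sequence b hd hw hiso
  obtain ⟨N, hN⟩ := exists_X_pow_mem_jacobianIdeal hw hiso
  have h3 : Module.Finite k (PS n k ⧸ jacobianIdeal w) := finite_quotient_of_X_pow_mem hN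
  have h4 := finite_extPart hiso b 1 b.kind.sign
  have h5 : Module.Finite k M.exactClasses :=
    Module.Finite.of_injective (M.exactClasses.subtype.restrictScalars k) Subtype.val_injective
  exact Module.Finite.of_exact h2 hπ

end decomposition

/-! ### The formal solution of the deformation equation -/

section kuranishi

/-- Krull's intersection theorem for the quotient by `I`. -/
theorem mem_of_forall_mem_sup_pow {A : Type*} [CommRing A] [IsNoetherianRing A] [IsLocalRing A]
    {I : Ideal A} {a : A} (h : ∀ N : ℕ, a ∈ I ⊔ maximalIdeal A ^ N) : a ∈ I := by
  have : IsHausdorff (maximalIdeal A) (A ⧸ I) := inferInstance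
  rw [← Ideal.Quotient.eq_zero_iff_mem]
  refine IsHausdorff.haus (I := maximalIdeal A) (M := A ⧸ I) inferInstance _ fun N => ?_
  rw [SModEq.zero]
  obtain ⟨x, hx, y, hy, rfl⟩ := Submodule.mem_sup.1 (h N)
  rw [map_add, Ideal.Quotient.eq_zero_iff_mem.2 hx, zero_add]
  have := Submodule.smul_mem_smul hy (Submodule.mem_top (x := (1 : A ⧸ I)))
  rwa [Algebra.smul_def, mul_one] at this

variable {k : Type u} [Field k] {n d r : ℕ} {w : MvPolynomial (Fin n) k}
  {M : MatrixFactorization w d} (b : BilinearStructure M)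

theorem slice_adj (m : Fin r →₀ ℕ) (X : Mat d (PS n (MvPowerSeries (Fin r) k))) :
    slice m (adj (b.formOver (MvPowerSeries (Fin r) k)) X) = adj b.form (slice m X) := by
  rw [adj, adj, ← slice_transpose, ← slice_const_mul, ← slice_mul_const]
  rfl

/-- The recursion for the coefficients of the formal solution. -/
def solutionStep (φ : Fin r → Mat d (PS n k)) (H : Mat d (PS n k) →ₗ[k] Mat d (PS n k))
    (f : (Fin r →₀ ℕ) → Mat d (PS n k)) (m : Fin r →₀ ℕ) : Mat d (PS n k) :=
  ∑ i, MvPowerSeries.coeff m (MvPowerSeries.X i : MvPowerSeries (Fin r) k) • φ i -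
    H (∑ x ∈ Finset.HasAntidiagonal.antidiagonal m,
      (if x.1 = 0 then 0 else f x.1) * (if x.2 = 0 then 0 else f x.2))

/-- The guards discard the pairs containing the exponent `0`, so in each remaining product both
exponents are strictly below `m`. -/
theorem solutionStep_congr (φ : Fin r → Mat d (PS n k))
    (H : Mat d (PS n k) →ₗ[k] Mat d (PS n k)) (f f' : (Fin r →₀ ℕ) → Mat d (PS n k))
    (m : Fin r →₀ ℕ) (hm : ∀ m' < m, f m' = f' m') :
    solutionStep φ H f m = solutionStep φ H f' m := by
  unfold solutionStep
  congr 2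
  refine Finset.sum_congr rfl fun x hx => ?_
  rw [Finset.HasAntidiagonal.mem_antidiagonal] at hx
  by_cases h1 : x.1 = 0
  · rw [if_pos h1, if_pos h1, zero_mul, zero_mul]
  by_cases h2 : x.2 = 0
  · rw [if_pos h2, if_pos h2, mul_zero, mul_zero]
  have l1 : x.1 < m := by
    rw [← hx]
    exact lt_add_of_pos_right _ (pos_iff_ne_zero.2 h2)
  have l2 : x.2 < m := by
    rw [← hx]
    exact lt_add_of_pos_left _ (pos_iff_ne_zero.2 h1)
  rw [if_neg h1, if_neg h1, if_neg h2, if_neg h2, hm _ l1, hm _ l2]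

theorem solutionStep_zero (φ : Fin r → Mat d (PS n k))
    (H : Mat d (PS n k) →ₗ[k] Mat d (PS n k)) (f : (Fin r →₀ ℕ) → Mat d (PS n k)) :
    solutionStep φ H f 0 = 0 := by
  unfold solutionStep
  rw [Finset.sum_eq_zero, Finset.sum_eq_zero, map_zero, sub_zero]
  · intro x hx
    rw [Finset.HasAntidiagonal.mem_antidiagonal] at hx
    rw [if_pos (add_eq_zero.1 hx).1, zero_mul]
  · intro i _
    rw [MvPowerSeries.coeff_zero_X, zero_smul]

/-- The recursion forces `f 0 = 0`, so the guards in `solutionStep` are redundant for its fixed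
point and the sum over the antidiagonal is the full coefficient of `Γ²`. -/
theorem exists_recursive_solution (φ : Fin r → Mat d (PS n k))
    (H : Mat d (PS n k) →ₗ[k] Mat d (PS n k)) :
    ∃ Γ : Mat d (PS n (MvPowerSeries (Fin r) k)),
      Γ = ∑ i, (MvPowerSeries.X i : MvPowerSeries (Fin r) k) •
        (const n (MvPowerSeries (Fin r) k)).mapMatrix (φ i) - extendEnd H (Γ * Γ) ∧
      Γ ∈ matIdeal n d (maximalIdeal (MvPowerSeries (Fin r) k)) := by
  obtain ⟨f, hf⟩ := exists_fixedPoint_of_lt (solutionStep φ H) (solutionStep_congr φ H)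
  have hf0 : f 0 = 0 := by
    rw [← hf, solutionStep_zero]
  have hg : ∀ m, (if m = 0 then 0 else f m) = f m := fun m => by
    split_ifs with h
    · rw [h, hf0]
    · rfl
  have hstep : ∀ m, f m = ∑ i, MvPowerSeries.coeff m
      (MvPowerSeries.X i : MvPowerSeries (Fin r) k) • φ i -
      H (∑ x ∈ Finset.HasAntidiagonal.antidiagonal m, f x.1 * f x.2) := fun m => by
    conv_lhs => rw [← hf]
    unfold solutionStep
    simp_rw [hg]
  refine ⟨ofSlices f, slice_ext fun m => ?_, mem_matIdeal_maximalIdeal_iff_slice.2 hf0⟩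
  rw [map_sub, map_sum, slice_extendEnd, slice_mul]
  simp_rw [slice_smul_const, slice_ofSlices]
  exact hstep m

/-- A formal perturbation `Γ` of `Q`, solving the equation `(Q + Γ) ^ 2 = ω + ∑ g_j c_j` up to
products of parameters with the `g_j`. -/
structure IsFormalSolution (φ : Fin r → tangentCocycles M (some b)) {m : ℕ}
    (c : Fin m → Mat d (PS n k)) (Γ : Mat d (PS n (MvPowerSeries (Fin r) k)))
    (ω : PS n (MvPowerSeries (Fin r) k)) (g : Fin m → MvPowerSeries (Fin r) k) : Prop where
  odd : Γ ∈ homDeg d (PS n (MvPowerSeries (Fin r) k)) 1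
  adj_eq : adj (b.formOver (MvPowerSeries (Fin r) k)) Γ = b.kind.sign • Γ
  mem : Γ ∈ matIdeal n d (maximalIdeal (MvPowerSeries (Fin r) k))
  linear : Γ - ∑ i, (MvPowerSeries.X i : MvPowerSeries (Fin r) k) •
      (const n (MvPowerSeries (Fin r) k)).mapMatrix (φ i : Mat d (PS n k)) ∈
    matIdeal n d (maximalIdeal (MvPowerSeries (Fin r) k) * maximalIdeal (MvPowerSeries (Fin r) k))
  obstruction_mem : ∀ j, g j ∈ maximalIdeal (MvPowerSeries (Fin r) k) *
    maximalIdeal (MvPowerSeries (Fin r) k)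
  defect : ((const n (MvPowerSeries (Fin r) k)).mapMatrix M.Q + Γ) *
      ((const n (MvPowerSeries (Fin r) k)).mapMatrix M.Q + Γ) - ω • 1 -
      ∑ j, g j • (const n (MvPowerSeries (Fin r) k)).mapMatrix (c j) ∈
    matIdeal n d (maximalIdeal (MvPowerSeries (Fin r) k) * Ideal.span (Set.range g))

/-- Kuranishi's method: the choice `Γ = ∑ tᵢ φᵢ - H(Γ²)` cancels the coboundary part of `Γ²`, the
scalar part goes into the potential and the `c j` part into `g`. What is left is `θ` of the
commutator of `Q` with `Γ²`, which turns out to be a product of `Γ` with the defect itself. -/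
theorem exists_formalSolution (φ : Fin r → tangentCocycles M (some b)) {m : ℕ}
    (c : Fin m → Mat d (PS n k)) (H : Mat d (PS n k) →ₗ[k] Mat d (PS n k))
    (ρ : Mat d (PS n k) →ₗ[k] PS n k) (l : Fin m → Mat d (PS n k) →ₗ[k] k)
    (θ : Mat d (PS n k) →ₗ[k] Mat d (PS n k))
    (hH : ∀ y, H y ∈ adjPart b 1 b.kind.sign)
    (hdec : ∀ y ∈ adjPart b 0 1, y = anticommutator M (H y) + ρ y • 1 + ∑ j, l j y • c j +
        θ (commutator M y)) :
    ∃ Γ ω g, IsFormalSolution b φ c Γ ω g := by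
  obtain ⟨Γ, hΓ, hΓm⟩ := exists_recursive_solution (fun i => (φ i : Mat d (PS n k))) H
  have hslice : ∀ e, slice e Γ = ∑ i, MvPowerSeries.coeff e (MvPowerSeries.X i : (MvPowerSeries (Fin r) k)) •
      (φ i : Mat d (PS n k)) - H (slice e (Γ * Γ)) := fun e => by
    conv_lhs => rw [hΓ]
    rw [map_sub, map_sum, slice_extendEnd]
    simp_rw [slice_smul_const]
  have hφ : ∀ i, (φ i : Mat d (PS n k)) ∈ adjPart b 1 b.kind.sign := fun i =>
    ⟨(φ i).2.1, (φ i).2.2.2 b rfl⟩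
  have hΓs : ∀ e, slice e Γ ∈ adjPart b 1 b.kind.sign := fun e => by
    rw [hslice]
    exact sub_mem (sum_mem fun i _ => Submodule.smul_mem _ _ (hφ i)) (hH _)
  have hΓodd : Γ ∈ homDeg d (PS n (MvPowerSeries (Fin r) k)) 1 := mem_homDeg_iff_slice.2 fun e => (hΓs e).1
  have hΓadj : adj (b.formOver (MvPowerSeries (Fin r) k)) Γ = b.kind.sign • Γ := slice_ext fun e => by
    rw [slice_adj, (hΓs e).2, map_zsmul]
  have hΓ2 := matIdeal_mul_mem hΓm hΓm
  have hΓ2s : ∀ e, slice e (Γ * Γ) ∈ adjPart b 0 1 := fun e => by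
    refine ⟨mem_homDeg_iff_slice.1 (mul_mem_homDeg hΓodd hΓodd) e, ?_⟩
    rw [← slice_adj, adj_mul, hΓadj, smul_mul_smul_comm, b.kind.sign_mul_self, one_smul, one_smul]
  choose h hh using fun i => (φ i).2.2.1
  let q : Mat d (PS n (MvPowerSeries (Fin r) k)) := (const n (MvPowerSeries (Fin r) k)).mapMatrix M.Q
  -- The potential collects the first order potentials `h i` of the `φ i` and the scalar part of
  -- `Γ²`.
  let ω : PS n (MvPowerSeries (Fin r) k) := const n (MvPowerSeries (Fin r) k) (w : PS n k) + ofScalarSlices fun e =>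
    ∑ i, MvPowerSeries.coeff e (MvPowerSeries.X i : (MvPowerSeries (Fin r) k)) • h i + ρ (slice e (Γ * Γ))
  let g : Fin m → (MvPowerSeries (Fin r) k) := fun j => extendForm (l j) (Γ * Γ)
  let F : Mat d (PS n (MvPowerSeries (Fin r) k)) := (q + Γ) * (q + Γ) - ω • 1
  have hF : F = ∑ j, g j • (const n (MvPowerSeries (Fin r) k)).mapMatrix (c j) + extendEnd θ (q * (Γ * Γ) - (Γ * Γ) * q) := by
    have h1 : F = (q * Γ + Γ * q) + Γ * Γ - (ofScalarSlices fun e =>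
        ∑ i, MvPowerSeries.coeff e (MvPowerSeries.X i : (MvPowerSeries (Fin r) k)) • h i + ρ (slice e (Γ * Γ))) •
        (1 : Mat d (PS n (MvPowerSeries (Fin r) k))) := by
      change (q + Γ) * (q + Γ) - (_ + _) • 1 = _
      rw [add_smul, ← const_sq, add_mul, mul_add, mul_add]
      abel
    refine slice_ext fun e => ?_
    rw [h1, map_sub, map_add, map_add, map_add, map_sum, slice_ofScalarSlices_smul_one,
      slice_const_mul, slice_mul_const, slice_extendEnd, map_sub, slice_const_mul, slice_mul_const]
    rw [Finset.sum_congr rfl fun j _ => slice_smul_const e (g j) (c j)]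
    have h2 : M.Q * slice e Γ + slice e Γ * M.Q = (∑ i, MvPowerSeries.coeff e
        (MvPowerSeries.X i : (MvPowerSeries (Fin r) k)) • h i) • 1 - anticommutator M (H (slice e (Γ * Γ))) := by
      change anticommutator M (slice e Γ) = _
      rw [hslice, map_sub, map_sum, Finset.sum_smul]
      congr 1
      refine Finset.sum_congr rfl fun i _ => ?_
      rw [map_smul, smul_assoc, ← hh]
      rfl
    have h3 := hdec _ (hΓ2s e)
    rw [h2, add_smul]
    change _ = ∑ j, l j (slice e (Γ * Γ)) • c j + θ (commutator M (slice e (Γ * Γ)))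
    generalize slice e (Γ * Γ) = y at h3 ⊢
    rw [← sub_eq_zero] at h3 ⊢
    refine Eq.trans ?_ h3
    abel
  -- A Bianchi identity: `q + Γ` commutes with its square, hence with `F`; and `q` commutes with `qΓ
  -- + Γq`, since `q²` is scalar, so `[q, F] = [q, Γ²]`.
  have hcomm : q * (Γ * Γ) - (Γ * Γ) * q = -(Γ * F - F * Γ) := by
    have h1 : q * q = const n (MvPowerSeries (Fin r) k) (w : PS n k) • (1 : Mat d (PS n (MvPowerSeries (Fin r) k))) := const_sq M (MvPowerSeries (Fin r) k)
    have h2 : Γ * (q * q) = (q * q) * Γ := by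
      rw [h1, mul_smul_comm, smul_mul_assoc, one_mul, mul_one]
    have h3 : Γ * F - F * Γ = Γ * ((q + Γ) * (q + Γ)) - ((q + Γ) * (q + Γ)) * Γ := by
      change Γ * (_ - ω • 1) - (_ - ω • 1) * Γ = _
      rw [mul_sub, sub_mul, mul_smul_comm, smul_mul_assoc, one_mul, mul_one, sub_sub_sub_cancel_right]
    rw [h3]
    have h4 : Γ * ((q + Γ) * (q + Γ)) - ((q + Γ) * (q + Γ)) * Γ =
      (Γ * (q * q) - (q * q) * Γ) + ((Γ * Γ) * q - q * (Γ * Γ)) := by noncomm_ring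
    rw [h4, h2, sub_self, zero_add, neg_sub]
  rw [hcomm] at hF
  have hFC : ∀ I : Ideal (MvPowerSeries (Fin r) k), F ∈ matIdeal n d I →
      extendEnd θ (-(Γ * F - F * Γ)) ∈ matIdeal n d (maximalIdeal (MvPowerSeries (Fin r) k) * I) := fun I hI => by
    refine linearMap_mem_matIdeal _ (neg_mem (sub_mem (matIdeal_mul_mem hΓm hI) ?_))
    rw [mul_comm]
    exact matIdeal_mul_mem hI hΓm
  have hgI : ∑ j, g j • (const n (MvPowerSeries (Fin r) k)).mapMatrix (c j) ∈ matIdeal n d (Ideal.span (Set.range g)) :=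
    sum_smul_mem_matIdeal (fun j => Ideal.subset_span (Set.mem_range_self j)) _
  -- Bootstrap: modulo `(g)` the defect is a linear function of `[Γ, F]`, and `Γ` has coefficients
  -- in `𝔪`, so membership modulo `𝔪 ^ N` improves to `𝔪 ^ (N + 1)`. Krull's theorem then puts `F`
  -- into `(g)`.
  have hFN : ∀ N : ℕ, F ∈ matIdeal n d (Ideal.span (Set.range g) ⊔ maximalIdeal (MvPowerSeries (Fin r) k) ^ N) := by
    intro N
    induction N with
    | zero =>
      rw [pow_zero, Ideal.one_eq_top, sup_top_eq]
      exact mem_matIdeal_top _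
    | succ N ih =>
      rw [hF]
      refine add_mem (matIdeal_mono le_sup_left hgI) (matIdeal_mono ?_ (hFC _ ih))
      rw [Ideal.mul_sup, ← pow_succ']
      exact sup_le_sup_right Ideal.mul_le_right _
  have hFI : F ∈ matIdeal n d (Ideal.span (Set.range g)) := fun a b e =>
    mem_of_forall_mem_sup_pow fun N => hFN N a b e
  refine ⟨Γ, ω, g, hΓodd, hΓadj, hΓm, ?_, fun j => linearForm_mem_of_mem_matIdeal _ hΓ2, ?_⟩
  · have h1 : Γ - ∑ i, (MvPowerSeries.X i : (MvPowerSeries (Fin r) k)) • (const n (MvPowerSeries (Fin r) k)).mapMatrix (φ i : Mat d (PS n k)) =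
        -extendEnd H (Γ * Γ) := by
      rw [sub_eq_iff_eq_add, neg_add_eq_sub]
      exact hΓ
    rw [h1]
    exact neg_mem (linearMap_mem_matIdeal _ hΓ2)
  · change F - _ ∈ _
    have h1 := hFC _ hFI
    rwa [← sub_eq_iff_eq_add'.2 hF] at h1

end kuranishi

/-! ### The parameter rings -/

section parameters
variable {k : Type*} [Field k] {r : ℕ}

theorem sub_C_constantCoeff_mem (f : MvPowerSeries (Fin r) k) :
    f - MvPowerSeries.C (MvPowerSeries.constantCoeff f) ∈
      maximalIdeal (MvPowerSeries (Fin r) k) := by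
  rw [mem_maximalIdeal, mem_nonunits_iff, MvPowerSeries.isUnit_iff_constantCoeff]
  simp

instance : IsCoeffRing k (MvPowerSeries (Fin r) k) :=
  isCoeffRing_of_exists fun f => ⟨_, sub_C_constantCoeff_mem f⟩

theorem maximalIdeal_powerSeries : maximalIdeal (MvPowerSeries (Fin r) k) =
    Ideal.span (Set.range MvPowerSeries.X) := by
  apply le_antisymm
  · intro f hf
    rw [← pow_one (Ideal.span _)]
    refine mem_span_X_pow_of_coeff fun m hm => ?_
    have h0 : m = 0 := (Finsupp.degree_eq_zero_iff m).1 (Nat.lt_one_iff.1 hm)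
    rw [mem_maximalIdeal, mem_nonunits_iff, MvPowerSeries.isUnit_iff_constantCoeff,
      isUnit_iff_ne_zero, not_not] at hf
    rw [h0, MvPowerSeries.coeff_zero_eq_constantCoeff_apply, hf]
  · rw [Ideal.span_le]
    rintro _ ⟨i, rfl⟩
    exact X_mem_maximalIdeal i

/-- Completeness descends to the quotient because completion preserves surjections, and
separatedness is Krull's theorem; the topology is then that of the maximal ideal of the quotient,
the image of the one upstairs. -/
theorem isAdicComplete_quotient (I : Ideal (MvPowerSeries (Fin r) k))
    [IsLocalRing (MvPowerSeries (Fin r) k ⧸ I)] :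
    IsAdicComplete (maximalIdeal (MvPowerSeries (Fin r) k ⧸ I))
      (MvPowerSeries (Fin r) k ⧸ I) := by
  have h1 : IsAdicComplete (maximalIdeal (MvPowerSeries (Fin r) k)) (MvPowerSeries (Fin r) k) := by
    rw [maximalIdeal_powerSeries]
    infer_instance
  have h2 : IsPrecomplete (maximalIdeal (MvPowerSeries (Fin r) k))
      (MvPowerSeries (Fin r) k ⧸ I) := by
    rw [← AdicCompletion.of_surjective_iff]
    intro x
    obtain ⟨y, rfl⟩ := AdicCompletion.map_surjective (maximalIdeal (MvPowerSeries (Fin r) k))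
      I.mkQ_surjective x
    obtain ⟨z, rfl⟩ := AdicCompletion.of_surjective _ _ y
    exact ⟨I.mkQ z, by rw [AdicCompletion.map_of]⟩
  have h3 : IsAdicComplete (maximalIdeal (MvPowerSeries (Fin r) k))
      (MvPowerSeries (Fin r) k ⧸ I) := ⟨⟩
  rw [← IsAdicComplete.map_algebraMap_iff (S := MvPowerSeries (Fin r) k ⧸ I)] at h3
  rwa [IsLocalRing.map_maximalIdeal_of_surjective
    (algebraMap (MvPowerSeries (Fin r) k) (MvPowerSeries (Fin r) k ⧸ I))
    Ideal.Quotient.mk_surjective] at h3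

variable {B : Type*} [CommRing B] [Algebra k B] [IsCoeffRing k B]

theorem powerSeries_algHom_ext [IsNoetherianRing B] {u v : MvPowerSeries (Fin r) k →ₐ[k] B}
    (h : ∀ i, u (MvPowerSeries.X i) = v (MvPowerSeries.X i)) : u = v := by
  refine AlgHom.coe_ringHom_injective (powerSeries_hom_ext (fun a => ?_) h fun i =>
    map_mem_maximalIdeal u (X_mem_maximalIdeal i))
  exact (u.commutes a).trans (v.commutes a).symm

theorem map_mul_eq_zero_of_small (u : MvPowerSeries (Fin r) k →ₐ[k] B) {J : Ideal B}
    (hJ : maximalIdeal B * J = ⊥) {𝔞 : Ideal (MvPowerSeries (Fin r) k)}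
    (h𝔞 : ∀ x ∈ 𝔞, u x ∈ J) {x : MvPowerSeries (Fin r) k}
    (hx : x ∈ maximalIdeal (MvPowerSeries (Fin r) k) * 𝔞) : u x = 0 := by
  induction hx using Submodule.mul_induction_on' with
  | mem_mul_mem x hx y hy =>
    rw [map_mul, ← Ideal.mem_bot, ← hJ]
    exact Ideal.mul_mem_mul (map_mem_maximalIdeal u hx) (h𝔞 y hy)
  | add x _ y _ hx hy => rw [map_add, hx, hy, add_zero]

/-- On a product, `u x u y - v x v y = u x (u y - v y) + v y (u x - v x)`, and both terms lie in `𝔪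
J = 0`. So the `g j`, which lie in the square of the maximal ideal, do not notice a small change of
the point. -/
theorem eq_on_sq_of_small {u v : MvPowerSeries (Fin r) k →ₐ[k] B} {J : Ideal B}
    (hJ : maximalIdeal B * J = ⊥) (h : ∀ x, u x - v x ∈ J) {x : MvPowerSeries (Fin r) k}
    (hx : x ∈ maximalIdeal (MvPowerSeries (Fin r) k) * maximalIdeal (MvPowerSeries (Fin r) k)) :
    u x = v x := by
  induction hx using Submodule.mul_induction_on' with
  | mem_mul_mem x hx y hy =>
    have h1 : u x * (u y - v y) = 0 := by
      rw [← Ideal.mem_bot, ← hJ]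
      exact Ideal.mul_mem_mul (map_mem_maximalIdeal u hx) (h y)
    have h2 : v y * (u x - v x) = 0 := by
      rw [← Ideal.mem_bot, ← hJ]
      exact Ideal.mul_mem_mul (map_mem_maximalIdeal v hy) (h x)
    rw [map_mul, map_mul]
    linear_combination h1 + h2
  | add x _ y _ hx hy => rw [map_add, map_add, hx, hy]

theorem map_smul_const {A A' : Type*} [CommRing A] [Algebra k A] [CommRing A'] [Algebra k A']
    {n d : ℕ} (u : A →ₐ[k] A') (a : A) (x : Mat d (PS n k)) :
    (MvPowerSeries.map (u : A →+* A')).mapMatrix (a • (const n A).mapMatrix x) =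
      u a • (const n A').mapMatrix x := by
  rw [← map_constMatrix u]
  ext i j m
  simp only [RingHom.mapMatrix_apply, Matrix.map_apply, Matrix.smul_apply, MvPowerSeries.coeff_map,
    map_smul, smul_eq_mul, map_mul]
  rfl

theorem map_eq_of_mem_matIdeal {A A' : Type*} [CommRing A] [CommRing A'] {n d : ℕ} {u v : A →+* A'}
    {𝔞 : Ideal A} (h : ∀ x ∈ 𝔞, u x = v x) {X : Mat d (PS n A)} (hX : X ∈ matIdeal n d 𝔞) :
    (MvPowerSeries.map u).mapMatrix X = (MvPowerSeries.map v).mapMatrix X := by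
  ext i j m
  simp only [RingHom.mapMatrix_apply, Matrix.map_apply, MvPowerSeries.coeff_map]
  exact h _ (hX i j m)

end parameters

/-! ### Values of the formal solution at points -/

section specialization
variable {k : Type u} [Field k] {n d r : ℕ} {w : MvPolynomial (Fin n) k}
  {M : MatrixFactorization w d} {b : BilinearStructure M}
  {φ : Fin r → tangentCocycles M (some b)} {m : ℕ} {c : Fin m → Mat d (PS n k)}
  {Γ : Mat d (PS n (MvPowerSeries (Fin r) k))} {ω : PS n (MvPowerSeries (Fin r) k)}
  {g : Fin m → MvPowerSeries (Fin r) k}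
  {A A' : Type u} [CommRing A] [Algebra k A] [CommRing A'] [Algebra k A']
  [IsCoeffRing k A] [IsCoeffRing k A']

theorem IsFormalSolution.map_sub_mem (h : IsFormalSolution b φ c Γ ω g)
    (u : MvPowerSeries (Fin r) k →ₐ[k] A) :
    (MvPowerSeries.map (u : MvPowerSeries (Fin r) k →+* A)).mapMatrix
      ((const n (MvPowerSeries (Fin r) k)).mapMatrix M.Q + Γ) - (const n A).mapMatrix M.Q ∈
      matIdeal n d (maximalIdeal A) := by
  rw [map_add, map_constMatrix, add_sub_cancel_left]
  refine matIdeal_mono ?_ (mem_matIdeal_map _ h.mem)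
  rw [Ideal.map_le_iff_le_comap]
  exact fun x hx => map_mem_maximalIdeal u hx

/-- The formal equation holds modulo `𝔪 · (g)`; at a point killing this ideal the defect is exactly
the value of the obstructions. -/
theorem IsFormalSolution.map_sq (h : IsFormalSolution b φ c Γ ω g) {A : Type u} [CommRing A]
    [Algebra k A]
    (u : MvPowerSeries (Fin r) k →ₐ[k] A)
    (hu : ∀ x ∈ maximalIdeal (MvPowerSeries (Fin r) k) * Ideal.span (Set.range g), u x = 0) :
    (MvPowerSeries.map (u : MvPowerSeries (Fin r) k →+* A)).mapMatrix
        ((const n (MvPowerSeries (Fin r) k)).mapMatrix M.Q + Γ) *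
      (MvPowerSeries.map (u : MvPowerSeries (Fin r) k →+* A)).mapMatrix
        ((const n (MvPowerSeries (Fin r) k)).mapMatrix M.Q + Γ) =
      MvPowerSeries.map (u : MvPowerSeries (Fin r) k →+* A) ω • (1 : Mat d (PS n A)) +
        ∑ j, u (g j) • (const n A).mapMatrix (c j) := by
  have h1 := (mem_matIdeal_ker (u : MvPowerSeries (Fin r) k →+* A) _).1
    (matIdeal_mono (fun x hx => hu x hx) h.defect)
  rw [map_sub, map_sub, map_mul, map_sum, sub_eq_zero, sub_eq_iff_eq_add',
    map_smul_one' (p := u) ω] at h1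
  rw [h1]
  congr 1
  exact Finset.sum_congr rfl fun j _ => map_smul_const u (g j) (c j)

/-- The deformation over `A` given by a point at which the obstructions vanish. -/
def IsFormalSolution.specialize (h : IsFormalSolution b φ c Γ ω g)
    (u : MvPowerSeries (Fin r) k →ₐ[k] A) (hu : ∀ j, u (g j) = 0) :
    Deformation M (some b) A where
  Q := (MvPowerSeries.map (u : MvPowerSeries (Fin r) k →+* A)).mapMatrix
    ((const n (MvPowerSeries (Fin r) k)).mapMatrix M.Q + Γ)
  odd := map_mem_homDeg _ (add_mem (map_mem_homDeg _ M.odd) h.odd)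
  sq := by
    refine ⟨MvPowerSeries.map (u : MvPowerSeries (Fin r) k →+* A) ω, ?_⟩
    have h1 : Ideal.span (Set.range g) ≤ RingHom.ker u := by
      rw [Ideal.span_le]
      rintro _ ⟨j, rfl⟩
      exact hu j
    rw [h.map_sq u fun x hx => h1 (Ideal.mul_le_right hx)]
    simp_rw [hu, zero_smul, Finset.sum_const_zero, add_zero]
  red_eq := by
    have h1 := h.map_sub_mem u
    rwa [mem_matIdeal_maximalIdeal, map_sub, sub_eq_zero] at h1
  adj_eq b' hb' := by
    obtain rfl : b = b' := by simpa using hb'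
    rw [← map_adj, adj_add, adj_const, b.adj_Q, h.adj_eq, map_zsmul, ← smul_add, map_zsmul]

theorem IsFormalSolution.specialize_map (h : IsFormalSolution b φ c Γ ω g)
    (u : MvPowerSeries (Fin r) k →ₐ[k] A) (hu : ∀ j, u (g j) = 0) (p : A →ₐ[k] A') :
    (h.specialize u hu).map p =
      h.specialize (p.comp u) (fun j => by rw [AlgHom.comp_apply, hu, map_zero]) :=
  Deformation.ext rfl

end specialization

/-! ### Lifting along small extensions -/

section versality
variable {k : Type u} [Field k] {n d r : ℕ} {w : MvPolynomial (Fin n) k}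
  {M : MatrixFactorization w d} {b : BilinearStructure M}
  {φ : Fin r → tangentCocycles M (some b)} {m : ℕ} {c : Fin m → Mat d (PS n k)}
  {Γ : Mat d (PS n (MvPowerSeries (Fin r) k))} {ω : PS n (MvPowerSeries (Fin r) k)}
  {g : Fin m → MvPowerSeries (Fin r) k}

theorem isNilpotent_of_mem_maximalIdeal {A : Type*} [CommRing A] [IsLocalRing A]
    [IsArtinianRing A] {a : A} (ha : a ∈ maximalIdeal A) : IsNilpotent a := by
  obtain ⟨e, he⟩ := (isArtinianRing_iff_isNilpotent_maximalIdeal A).1 inferInstance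
  refine ⟨e, ?_⟩
  have := Ideal.pow_mem_pow ha e
  rwa [he] at this

/-- The power series ring is formally smooth: lift the values of the variables arbitrarily; they are
nilpotent and can be substituted. -/
theorem exists_powerSeries_lift {A' A : Type*} [CommRing A'] [CommRing A] [Algebra k A']
    [Algebra k A] [IsCoeffRing k A'] [IsCoeffRing k A] [IsArtinianRing A'] [IsArtinianRing A]
    {p : A' →ₐ[k] A} (hp : Function.Surjective p) (u : MvPowerSeries (Fin r) k →ₐ[k] A) :
    ∃ v : MvPowerSeries (Fin r) k →ₐ[k] A', p.comp v = u := by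
  have : IsLocalHom (p : A' →+* A) := hp.isLocalHom (f := (p : A' →+* A))
  choose a ha using fun i => hp (u (MvPowerSeries.X i))
  have ham : ∀ i, a i ∈ maximalIdeal A' := fun i => by
    by_contra h
    have h1 : IsUnit (p (a i)) := (not_not.1 h : IsUnit (a i)).map p
    rw [ha] at h1
    exact (mem_maximalIdeal _).1 (map_mem_maximalIdeal u (X_mem_maximalIdeal i)) h1
  obtain ⟨v, hv⟩ := exists_powerSeries_eval (k := k) a fun i =>
    isNilpotent_of_mem_maximalIdeal (ham i)
  exact ⟨v, powerSeries_algHom_ext fun i => by rw [AlgHom.comp_apply, hv, ha]⟩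

/-- Effect of a small change of the point on the value of a formal solution. -/
theorem IsFormalSolution.map_eq_add (h : IsFormalSolution b φ c Γ ω g) {A : Type u} [CommRing A]
    [Algebra k A] [IsCoeffRing k A] {J : Ideal A} (hJ : maximalIdeal A * J = ⊥)
    {u v : MvPowerSeries (Fin r) k →ₐ[k] A} (huv : ∀ x, u x - v x ∈ J) :
    (MvPowerSeries.map (u : MvPowerSeries (Fin r) k →+* A)).mapMatrix
        ((const n (MvPowerSeries (Fin r) k)).mapMatrix M.Q + Γ) =
      (MvPowerSeries.map (v : MvPowerSeries (Fin r) k →+* A)).mapMatrix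
        ((const n (MvPowerSeries (Fin r) k)).mapMatrix M.Q + Γ) +
      ∑ i, (u (MvPowerSeries.X i) - v (MvPowerSeries.X i)) •
        (const n A).mapMatrix (φ i : Mat d (PS n k)) := by
  have h1 := map_eq_of_mem_matIdeal (u := (u : MvPowerSeries (Fin r) k →+* A))
    (v := (v : MvPowerSeries (Fin r) k →+* A)) (fun x hx => eq_on_sq_of_small hJ huv hx) h.linear
  rw [map_sub, map_sub, map_sum, map_sum,
    Finset.sum_congr rfl fun i _ => map_smul_const u (MvPowerSeries.X i) (φ i : Mat d (PS n k)),
    Finset.sum_congr rfl fun i _ => map_smul_const v (MvPowerSeries.X i) (φ i : Mat d (PS n k)),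
    sub_eq_iff_eq_add] at h1
  rw [map_add, map_add, map_constMatrix, map_constMatrix, h1]
  simp_rw [sub_smul, Finset.sum_sub_distrib]
  abel

/-- Lifting along small surjections. -/
theorem IsFormalSolution.exists_small_lift [CharZero k] (hd : 1 ≤ d)
    (h : IsFormalSolution b φ c Γ ω g)
    (hspan : ∀ f ∈ tangentCocycles M (some b), ∃ a : Fin r → k,
      f - ∑ i, a i • (φ i : Mat d (PS n k)) ∈ tangentBoundaries M (some b))
    (hind : ∀ (a : Fin m → k) (z : Mat d (PS n k)) (g : PS n k), z ∈ adjPart b 1 b.kind.sign →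
      ∑ j, a j • c j = anticommutator M z + g • 1 → a = 0)
    {A' A : Type u} [CommRing A'] [CommRing A] [Algebra k A'] [Algebra k A] [IsCoeffRing k A']
    [IsCoeffRing k A] [IsArtinianRing A'] [IsArtinianRing A] {p : A' →ₐ[k] A}
    (hp : Function.Surjective p) (hJ : maximalIdeal A' * RingHom.ker p = ⊥)
    (u : MvPowerSeries (Fin r) k →ₐ[k] A) (hu : ∀ j, u (g j) = 0)
    (N : Deformation M (some b) A') (hN : (N.map p).cls = (h.specialize u hu).cls) :
    ∃ (u' : MvPowerSeries (Fin r) k →ₐ[k] A') (hu' : ∀ j, u' (g j) = 0),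
      p.comp u' = u ∧ (h.specialize u' hu').cls = N.cls := by
  have hJm : RingHom.ker p ≤ maximalIdeal A' := ker_le_maximalIdeal p
  -- A first lift `v` of the point, with no regard for the obstructions or for `N`; both are
  -- repaired below.
  obtain ⟨v, rfl⟩ := exists_powerSeries_lift hp u
  obtain ⟨σ, F, hσ, hQ⟩ := (equivalent_iff_gauge b _ _).1 (Quotient.exact hN)
  obtain ⟨σ', F', hσ', hQ'⟩ := IsGauge.exists_lift b hp hJ hσ
  -- Within its class `N` is replaced by a deformation reducing on the nose to the given
  -- specialization, so that `N'` and `X` differ by entries in the kernel.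
  let N' := N.act hσ'
  set X := (MvPowerSeries.map (v : MvPowerSeries (Fin r) k →+* A')).mapMatrix
    ((const n (MvPowerSeries (Fin r) k)).mapMatrix M.Q + Γ) with hX
  have hXm := h.map_sub_mem v
  rw [← hX] at hXm
  have hNX : (MvPowerSeries.map (p : A' →+* A)).mapMatrix (N'.Q - X) = 0 := by
    rw [map_sub, sub_eq_zero]
    exact (hQ' N.Q).trans hQ
  have hXodd : X ∈ homDeg d (PS n A') 1 :=
    map_mem_homDeg _ (add_mem (map_mem_homDeg _ M.odd) h.odd)
  have hXadj : adj (b.formOver A') X = b.kind.sign • X := by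
    rw [hX, ← map_adj, adj_add, adj_const, b.adj_Q, h.adj_eq, map_zsmul, ← smul_add, map_zsmul]
  have : Module.Finite k (RingHom.ker p) := finite_of_small hJ
  let η := Module.finBasis k (RingHom.ker p)
  have hη : ∀ l, (η l : A') ∈ RingHom.ker p := fun l => (η l).2
  obtain ⟨y, hy⟩ := exists_matrix_coord η (X := N'.Q - X) (matIdeal_ker_iff.2 hNX)
  have hyodd : ∀ l, y l ∈ homDeg d (PS n k) 1 :=
    coord_homDeg η (by rw [← hy]; exact sub_mem N'.odd hXodd)
  have hyadj : ∀ l, adj b.form (y l) = b.kind.sign • y l :=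
    coord_adj b η (by rw [← hy, adj_sub, N'.adj_eq b rfl, hXadj, smul_sub])
  have hvg : ∀ x ∈ Ideal.span (Set.range g), v x ∈ RingHom.ker p := by
    have : Ideal.span (Set.range g) ≤ (RingHom.ker p).comap v := by
      rw [Ideal.span_le]
      rintro _ ⟨j, rfl⟩
      exact hu j
    exact this
  have hsq := h.map_sq v fun x hx => map_mul_eq_zero_of_small v hJ hvg hx
  rw [← hX] at hsq
  obtain ⟨ω₁, hω₁⟩ := N'.sq
  have hN'Q : N'.Q = X + ∑ l, (η l : A') • (const n A').mapMatrix (y l) := by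
    rw [← hy, add_sub_cancel]
  have hα : ∀ j, v (g j) = ∑ l, η.repr ⟨v (g j), hu j⟩ l • (η l : A') := fun j => by
    have := congrArg Subtype.val (η.sum_repr ⟨v (g j), hu j⟩)
    rw [AddSubmonoidClass.coe_finsetSum] at this
    exact this.symm
  let α : Fin m → Fin (Module.finrank k (RingHom.ker p)) → k := fun j l =>
    η.repr ⟨v (g j), hu j⟩ l
  have hc : ∑ j, v (g j) • (const n A').mapMatrix (c j) =
      ∑ l, (η l : A') • (const n A').mapMatrix (∑ j, α j l • c j) := by
    simp_rw [map_sum, Finset.smul_sum]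
    rw [Finset.sum_comm]
    refine Finset.sum_congr rfl fun j _ => ?_
    rw [hα j, Finset.sum_smul]
    refine Finset.sum_congr rfl fun l _ => ?_
    rw [const_smul, smul_smul, mul_comm, ← Algebra.smul_def]
  have heq : (ω₁ - MvPowerSeries.map (v : MvPowerSeries (Fin r) k →+* A') ω) •
      (1 : Mat d (PS n A')) = ∑ l, (η l : A') • (const n A').mapMatrix
        (∑ j, α j l • c j + (M.Q * y l + y l * M.Q)) := by
    have h1 := sq_add_small hJ hJm hη hXm y
    rw [← hN'Q, hω₁, hsq, hc] at h1
    rw [sub_smul, h1]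
    simp_rw [map_add, smul_add, Finset.sum_add_distrib]
    abel
  obtain ⟨ρ, hρ⟩ := exists_coord η ((smul_one_mem_matIdeal_iff hd).1
    (heq ▸ sum_smul_mem_matIdeal hη _))
  have hρ' : ∀ l, ρ l • 1 = ∑ j, α j l • c j + (M.Q * y l + y l * M.Q) := by
    refine matrix_coord_eq η (Eq.trans ?_ heq)
    rw [hρ, Finset.sum_smul]
    refine Finset.sum_congr rfl fun l _ => ?_
    rw [smul_assoc, const_smul_one]
  -- Both operators lift the same one and `N'` has a scalar square, so each combination `∑ α c` is a
  -- coboundary plus a scalar. Independence of the `c j` kills it: the existence of `N` forces the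
  -- obstructions to vanish at `v`.
  have hα0 : ∀ l, (fun j => α j l) = 0 := fun l => by
    refine hind _ (-y l) (ρ l) (neg_mem ⟨hyodd l, hyadj l⟩) ?_
    rw [hρ', map_neg]
    exact (neg_add_cancel_right _ _).symm.trans (by
      change _ = -(M.Q * y l + y l * M.Q) + _
      abel)
  have hv0 : ∀ j, v (g j) = 0 := fun j => by
    rw [hα]
    exact Finset.sum_eq_zero fun l _ => by
      rw [show η.repr ⟨v (g j), hu j⟩ l = 0 from congrFun (hα0 l) j, zero_smul]
  have hyc : ∀ l, y l ∈ tangentCocycles M (some b) := fun l => by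
    refine ⟨hyodd l, ⟨ρ l, ?_⟩, fun b' hb' => ?_⟩
    · rw [hρ', Finset.sum_eq_zero fun j _ => by rw [show α j l = 0 from congrFun (hα0 l) j,
        zero_smul], zero_add]
    · obtain rfl : b = b' := by simpa using hb'
      exact hyadj l
  -- The discrepancies `y l` are now first order deformations; modulo gauge they are combinations of
  -- the `φ i`, and the point is moved by these coefficients.
  choose β hβ using fun l => hspan _ (hyc l)
  have hδ : ∀ i, ∑ l, β l i • (η l : A') ∈ RingHom.ker p := fun i =>
    sum_mem fun l _ => by
      rw [Algebra.smul_def]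
      exact Ideal.mul_mem_left _ _ (hη l)
  obtain ⟨v', hv'⟩ := exists_powerSeries_eval (k := k)
    (fun i => v (MvPowerSeries.X i) + ∑ l, β l i • (η l : A')) fun i =>
    isNilpotent_of_mem_maximalIdeal (add_mem (map_mem_maximalIdeal v (X_mem_maximalIdeal i))
      (hJm (hδ i)))
  have hpv : p.comp v' = p.comp v := powerSeries_algHom_ext fun i => by
    rw [AlgHom.comp_apply, AlgHom.comp_apply, hv', map_add,
      show p (∑ l, β l i • (η l : A')) = 0 from hδ i, add_zero]
  have hvv : ∀ x, v' x - v x ∈ RingHom.ker p := fun x => by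
    rw [RingHom.mem_ker, map_sub, sub_eq_zero]
    exact DFunLike.congr_fun hpv x
  -- The moved point still satisfies the equations, because the `g j` lie in the square of the
  -- maximal ideal.
  have hv'g : ∀ j, v' (g j) = 0 := fun j => by
    rw [eq_on_sq_of_small hJ hvv (h.obstruction_mem j), hv0]
  refine ⟨v', hv'g, hpv, ?_⟩
  have hfin : (h.specialize v' hv'g).Equivalent N' := by
    refine equivalent_of_small hJ hJm hη hβ ?_
    change N'.Q = (MvPowerSeries.map (v' : MvPowerSeries (Fin r) k →+* A')).mapMatrix
      ((const n (MvPowerSeries (Fin r) k)).mapMatrix M.Q + Γ) + _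
    rw [h.map_eq_add hJ hvv, ← hX, hN'Q, add_assoc, add_right_inj]
    simp_rw [hv', add_sub_cancel_left, map_sub, smul_sub, Finset.sum_sub_distrib, map_sum,
      Finset.smul_sum, Finset.sum_smul]
    rw [Finset.sum_comm, eq_comm, add_comm, sub_add_eq_add_sub, sub_eq_iff_eq_add]
    congr 1
    refine Finset.sum_congr rfl fun l _ => Finset.sum_congr rfl fun i _ => ?_
    rw [const_smul, smul_smul, mul_comm, ← Algebra.smul_def]
  exact (Quotient.sound hfin).trans (Quotient.sound (N.equivalent_act hσ').symm)

end versality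

/-! ### Arbitrary surjections and the versal hull -/

section hull
variable {k : Type u} [Field k] {n d r : ℕ} {w : MvPolynomial (Fin n) k}
  {M : MatrixFactorization w d} {b : BilinearStructure M}
  {φ : Fin r → tangentCocycles M (some b)} {m : ℕ} {c : Fin m → Mat d (PS n k)}
  {Γ : Mat d (PS n (MvPowerSeries (Fin r) k))} {ω : PS n (MvPowerSeries (Fin r) k)}
  {g : Fin m → MvPowerSeries (Fin r) k}

/-- Lifting along arbitrary surjections of Artinian rings. -/
theorem IsFormalSolution.exists_lift [CharZero k] (hd : 1 ≤ d)
    (h : IsFormalSolution b φ c Γ ω g)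
    (hspan : ∀ f ∈ tangentCocycles M (some b), ∃ a : Fin r → k,
      f - ∑ i, a i • (φ i : Mat d (PS n k)) ∈ tangentBoundaries M (some b))
    (hind : ∀ (a : Fin m → k) (z : Mat d (PS n k)) (g : PS n k), z ∈ adjPart b 1 b.kind.sign →
      ∑ j, a j • c j = anticommutator M z + g • 1 → a = 0) (e : ℕ) :
    ∀ {A' A : Type u} [CommRing A'] [CommRing A] [Algebra k A'] [Algebra k A] [IsCoeffRing k A']
    [IsCoeffRing k A] [IsArtinianRing A'] [IsArtinianRing A] {p : A' →ₐ[k] A}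
    (_ : Function.Surjective p) (_ : maximalIdeal A' ^ (e + 1) * RingHom.ker p = ⊥)
    (u : MvPowerSeries (Fin r) k →ₐ[k] A) (hu : ∀ j, u (g j) = 0)
    (N : Deformation M (some b) A') (_ : (N.map p).cls = (h.specialize u hu).cls),
    ∃ (u' : MvPowerSeries (Fin r) k →ₐ[k] A') (hu' : ∀ j, u' (g j) = 0),
      p.comp u' = u ∧ (h.specialize u' hu').cls = N.cls := by
  induction e with
  | zero =>
    intro A' A _ _ _ _ _ _ _ _ p hp hJ u hu N hN
    rw [zero_add, pow_one] at hJ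
    exact h.exists_small_lift hd hspan hind hp hJ u hu N hN
  | succ e ih =>
    intro A' A _ _ _ _ _ _ _ _ p hp hJ u hu N hN
    -- The surjection is factored through `A' ⧸ K`: the map from `A'` is a small extension, and the
    -- kernel of the remaining map is killed by one power of the maximal ideal less.
    let K : Ideal A' := maximalIdeal A' ^ (e + 1) * RingHom.ker p
    have hK : K ≤ RingHom.ker p := Ideal.mul_le_right
    have hKJ : maximalIdeal A' * K = ⊥ := by
      rw [← hJ, pow_succ' _ (e + 1), mul_assoc]
    let p₁ : A' →ₐ[k] A' ⧸ K := Ideal.Quotient.mkₐ k K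
    have hp₁ : Function.Surjective p₁ := Ideal.Quotient.mkₐ_surjective k K
    have hker₁ : RingHom.ker p₁ = K := Ideal.Quotient.mkₐ_ker k K
    let p₂ : A' ⧸ K →ₐ[k] A := Ideal.Quotient.liftₐ K p fun a ha => hK ha
    have hp₂₁ : p₂.comp p₁ = p := AlgHom.ext fun a => rfl
    have hp₂ : Function.Surjective p₂ := fun a => by
      obtain ⟨x, rfl⟩ := hp a
      exact ⟨p₁ x, rfl⟩
    have : Nontrivial (A' ⧸ K) := Ideal.Quotient.nontrivial_iff.2
      (ne_top_of_le_ne_top (RingHom.ker_ne_top p) hK)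
    have : IsCoeffRing k (A' ⧸ K) := isCoeffRing_of_surjective p₁ hp₁
    have : IsArtinianRing (A' ⧸ K) := hp₁.isArtinianRing
    have hJ₂ : maximalIdeal (A' ⧸ K) ^ (e + 1) * RingHom.ker p₂ = ⊥ := by
      have h1 : maximalIdeal (A' ⧸ K) = (maximalIdeal A').map (p₁ : A' →+* A' ⧸ K) :=
        (IsLocalRing.map_maximalIdeal_of_surjective (p₁ : A' →+* A' ⧸ K) hp₁).symm
      have h2 : RingHom.ker p₂ = (RingHom.ker p).map (p₁ : A' →+* A' ⧸ K) := by
        ext x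
        obtain ⟨x, rfl⟩ := hp₁ x
        constructor
        · intro hx
          exact Ideal.mem_map_of_mem _ (show p x = 0 from hx)
        · intro hx
          obtain ⟨y, hy, hyx⟩ := (Ideal.mem_map_iff_of_surjective _ hp₁).1 hx
          rw [← show p₁ y = p₁ x from hyx]
          exact hy
      rw [h1, h2, ← Ideal.map_pow, ← Ideal.map_mul, Ideal.map_eq_bot_iff_le_ker]
      exact hker₁.ge
    obtain ⟨u₁, hu₁, hpu₁, hN₁⟩ := ih hp₂ hJ₂ u hu (N.map p₁) hN
    obtain ⟨u', hu', hpu', hN'⟩ := h.exists_small_lift hd hspan hind hp₁ (by rw [hker₁, hKJ]) u₁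
      hu₁ N hN₁.symm
    refine ⟨u', hu', ?_, hN'⟩
    rw [← hpu₁, ← hpu', ← AlgHom.comp_assoc, hp₂₁]

/-- The first order deformations in a formal solution. -/
theorem IsFormalSolution.specialize_dual (h : IsFormalSolution b φ c Γ ω g)
    (u : MvPowerSeries (Fin r) k →ₐ[k] DualNumber k) (hu : ∀ j, u (g j) = 0) {x : Fin r → k}
    (hx : ∀ i, u (MvPowerSeries.X i) = x i • DualNumber.eps) :
    (h.specialize u hu).cls = ∑ i, x i • tangentMk M (some b) (φ i) := by
  have h1 := (mem_matIdeal_ker (u : MvPowerSeries (Fin r) k →+* DualNumber k) _).1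
    (matIdeal_mono (fun y hy => map_mul_eq_zero_of_small u (dual_small (k := k))
      (fun z hz => map_mem_maximalIdeal u hz) hy) h.linear)
  rw [map_sub, map_sum, sub_eq_zero, Finset.sum_congr rfl fun i _ =>
    map_smul_const u (MvPowerSeries.X i) (φ i : Mat d (PS n k))] at h1
  simp_rw [← map_smul, ← map_sum]
  refine congrArg (Quotient.mk _) (Deformation.ext ?_)
  change (MvPowerSeries.map (u : MvPowerSeries (Fin r) k →+* DualNumber k)).mapMatrix
    ((const n (MvPowerSeries (Fin r) k)).mapMatrix M.Q + Γ) =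
    Q0 M + DualNumber.eps • (const n (DualNumber k)).mapMatrix
      ((∑ i, x i • φ i : tangentCocycles M (some b)) : Mat d (PS n k))
  rw [map_add, map_constMatrix, h1, AddSubmonoidClass.coe_finsetSum, map_sum, Finset.smul_sum]
  congr 1
  refine Finset.sum_congr rfl fun i _ => ?_
  rw [hx, Submodule.coe_smul, const_smul, smul_smul, mul_comm, ← Algebra.smul_def]

theorem exists_smul_eps {a : DualNumber k} (ha : a ∈ maximalIdeal (DualNumber k)) :
    ∃ x : k, a = x • DualNumber.eps := by
  rw [mem_maximalIdeal_dual] at ha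
  exact ⟨a.snd, by ext <;> simp [ha]⟩

end hull

/-- The deformation functor of a factorization with a bilinear structure has a versal hull. -/
theorem hasVersalHull {k : Type u} [Field k] [IsAlgClosed k] [CharZero k] {n d : ℕ} (hd : 1 ≤ d)
    {w : MvPolynomial (Fin n) k} (hw : MvPolynomial.constantCoeff w = 0)
    (hiso : IsolatedSingularity w) {M : MatrixFactorization w d} (b : BilinearStructure M) :
    HasVersalHull M (some b) := by
  have := finite_tangent b hd hw hiso
  let B := Module.finBasis k (Tangent M (some b))
  choose φ hφ using fun i => tangentMk_surjective (M := M) (β := some b) hd (B i)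
  obtain ⟨m, c, H, ρ, l, θ, hH, hdec, hind⟩ := exists_decomposition hiso b
  obtain ⟨Γ, ω, g, h⟩ := exists_formalSolution b φ c H ρ l θ hH hdec
  have hspan : ∀ f ∈ tangentCocycles M (some b),
      ∃ a : Fin (Module.finrank k (Tangent M (some b))) → k, f - ∑ i, a i • (φ i : Mat d (PS n k)) ∈
      tangentBoundaries M (some b) := fun f hf => by
    refine ⟨fun i => B.repr (tangentMk M (some b) ⟨f, hf⟩) i, ?_⟩
    have h1 := (tangentMk_eq_iff (∑ i, B.repr (tangentMk M (some b) ⟨f, hf⟩) i • φ i) ⟨f, hf⟩).1 (by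
      rw [map_sum]
      simp_rw [map_smul, hφ]
      exact B.sum_repr _)
    rwa [AddSubmonoidClass.coe_finsetSum] at h1
  -- The base of the hull is the power series ring on the tangent space modulo the obstruction
  -- series.
  let I : Ideal (MvPowerSeries (Fin (Module.finrank k (Tangent M (some b)))) k) :=
    Ideal.span (Set.range g)
  have hI : I ≤ maximalIdeal _ := by
    rw [Ideal.span_le]
    rintro _ ⟨j, rfl⟩
    exact Ideal.mul_le_left (h.obstruction_mem j)
  have hnt : Nontrivial (_ ⧸ I) := Ideal.Quotient.nontrivial_iff.2
    (ne_top_of_le_ne_top Ideal.IsPrime.ne_top' hI)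
  let q := Ideal.Quotient.mkₐ k I
  have hS : IsCoeffRing k (_ ⧸ I) := isCoeffRing_of_surjective q (Ideal.Quotient.mkₐ_surjective k I)
  have hq : ∀ j, q (g j) = 0 := fun j =>
    Ideal.Quotient.eq_zero_iff_mem.2 (Ideal.subset_span (Set.mem_range_self j))
  have hdesc : ∀ {A : Type u} [CommRing A] [Algebra k A] (u : MvPowerSeries _ k →ₐ[k] A),
      (∀ j, u (g j) = 0) → ∃ u' : (_ ⧸ I) →ₐ[k] A, u'.comp q = u := by
    intro A _ _ u hu
    have h1 : I ≤ RingHom.ker u := by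
      rw [Ideal.span_le]
      rintro _ ⟨j, rfl⟩
      exact hu j
    exact ⟨Ideal.Quotient.liftₐ I u fun a ha => h1 ha, AlgHom.ext fun a => rfl⟩
  have huq : ∀ {A : Type u} [CommRing A] [Algebra k A] (u : (_ ⧸ I) →ₐ[k] A) (j),
      (u.comp q) (g j) = 0 := fun u j => by rw [AlgHom.comp_apply, hq, map_zero]
  refine ⟨_ ⧸ I, inferInstance, inferInstance, hS, inferInstance, isAdicComplete_quotient I,
    h.specialize q hq, ⟨?_, ?_⟩, ?_⟩
  -- A `k[ε]`-point is given by the `ε`-coefficients of the variables, and these are the coordinates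
  -- of its class in the basis `B`.
  · intro u₁ u₂ h12
    have key : ∀ u : (_ ⧸ I) →ₐ[k] DualNumber k, ∃ x : _ → k,
        (∀ i, (u.comp q) (MvPowerSeries.X i) = x i • DualNumber.eps) ∧
        ((h.specialize q hq).map u).cls = ∑ i, x i • B i := fun u => by
      choose x hx using fun i => exists_smul_eps
        (map_mem_maximalIdeal (u.comp q) (X_mem_maximalIdeal i))
      refine ⟨x, hx, ?_⟩
      rw [h.specialize_map, h.specialize_dual (u.comp q) (huq u) hx]
      simp_rw [hφ]
    obtain ⟨x₁, hx₁, h1⟩ := key u₁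
    obtain ⟨x₂, hx₂, h2⟩ := key u₂
    have h3 : ∑ i, x₁ i • B i = ∑ i, x₂ i • B i := h1.symm.trans (h12.trans h2)
    have h4 : x₁ = x₂ := by
      have := congrArg B.equivFun h3
      rwa [← B.equivFun_symm_apply, ← B.equivFun_symm_apply, LinearEquiv.apply_symm_apply,
        LinearEquiv.apply_symm_apply] at this
    refine Ideal.Quotient.algHom_ext k (powerSeries_algHom_ext fun i => ?_)
    exact (hx₁ i).trans ((congrArg (fun x => x i • DualNumber.eps) h4).trans (hx₂ i).symm)
  · intro x
    obtain ⟨u, hu⟩ := exists_powerSeries_eval (k := k)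
      (fun i => B.repr x i • (DualNumber.eps : DualNumber k)) fun i =>
      isNilpotent_of_mem_maximalIdeal (by
        rw [Algebra.smul_def]
        exact Ideal.mul_mem_left _ _ eps_mem)
    -- The `g j` lie in the square of the maximal ideal, so they impose no condition on
    -- `k[ε]`-points and every tangent vector is attained.
    have hug : ∀ j, u (g j) = 0 := fun j => map_mul_eq_zero_of_small u (dual_small (k := k))
      (fun z hz => map_mem_maximalIdeal u hz) (h.obstruction_mem j)
    obtain ⟨u', rfl⟩ := hdesc u hug
    refine ⟨u', ?_⟩
    change ((h.specialize q hq).map u').cls = x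
    rw [h.specialize_map, h.specialize_dual _ hug hu]
    simp_rw [hφ]
    exact B.sum_repr x
  · intro A' A _ _ _ _ _ _ _ _ p hp u N hN
    obtain ⟨e, he⟩ := (isArtinianRing_iff_isNilpotent_maximalIdeal A').1 inferInstance
    -- Nilpotency of the maximal ideal bounds the number of small extensions needed.
    have hJ : maximalIdeal A' ^ (e + 1) * RingHom.ker p = ⊥ := by
      rw [pow_succ, he, Ideal.zero_eq_bot, Ideal.bot_mul, Ideal.bot_mul]
    have hNu : (N.map p).cls = (h.specialize (u.comp q) (huq u)).cls :=
      hN.trans (congrArg Deformation.cls (h.specialize_map q hq u))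
    obtain ⟨u', hu', hpu', hN'⟩ := h.exists_lift hd hspan hind e hp hJ (u.comp q) (huq u) N hNu
    obtain ⟨v, rfl⟩ := hdesc u' hu'
    refine ⟨v, Ideal.Quotient.algHom_ext k ?_, ?_⟩
    · exact hpu'
    · rw [h.specialize_map]
      exact hN'

end

end MF

theorem proposition4 {k : Type u} [Field k] [IsAlgClosed k] [CharZero k] {n d : ℕ} (hd : 1 ≤ d)
    (w : MvPolynomial (Fin n) k) (hw : MvPolynomial.constantCoeff w = 0)
    (hiso : IsolatedSingularity w) (M : MatrixFactorization w d) (b : BilinearStructure M) :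
    -- versal hull
    HasVersalHull M (some b) ∧
    -- the tangent space is the anti-selfadjoint (resp. selfadjoint) part of that of `M`
    (Function.Injective (tangentForget b) ∧
      LinearMap.range (tangentForget b) = tangentPart b b.kind.sign) ∧
    -- the exact sequence `0 → Ext^1(M, M)^∓ → t → I → 0`
    (∃ (ι : b.extPart 1 b.kind.sign →ₗ[k] Tangent M (some b))
      (π : Tangent M (some b) →ₗ[k] M.exactClasses),
      (∀ (f : M.Z 1) (e : b.extPart 1 b.kind.sign) (N : Deformation M (some b) (DualNumber k)),
        (e : M.Ext 1) = M.cls f →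
        N.Q = (const n (DualNumber k)).mapMatrix M.Q +
          (DualNumber.eps : DualNumber k) •
            (const n (DualNumber k)).mapMatrix (f : Mat d (PS n k)) →
        ι e = N.cls) ∧
      (∀ (N : Deformation M (some b) (DualNumber k)) (h : PS n k),
        N.Q * N.Q = (const n (DualNumber k) (w : PS n k) +
          (DualNumber.eps : DualNumber k) • const n (DualNumber k) h) •
            (1 : Mat d (PS n (DualNumber k))) →
        (π N.cls : PS n k ⧸ jacobianIdeal w) = Ideal.Quotient.mk (jacobianIdeal w) h) ∧
      Function.Injective ι ∧ Function.Exact ι π ∧ Function.Surjective π) ∧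
    -- obstructions
    (∀ (A' A : Type u) [CommRing A'] [CommRing A] [Algebra k A'] [Algebra k A]
      [IsCoeffRing k A'] [IsCoeffRing k A] [IsArtinianRing A'] [IsArtinianRing A]
      (p : A' →ₐ[k] A), Function.Surjective p →
      IsLocalRing.maximalIdeal A' * RingHom.ker p = ⊥ →
      ∃ ob : Def M (some b) A → b.ObstructionSpace ⊗[k] RingHom.ker p,
        IsObstructionMap b p ob) := by
  exact ⟨hasVersalHull hd hw hiso b, ⟨tangentForget_injective b hd, range_tangentForget b hd⟩,
    exists_tangent_sequence b hd hw hiso,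
    fun A' A _ _ _ _ _ _ _ _ p hp hJ => exists_obstructionMap hp hJ hd b⟩
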